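/- Let $q\ge 1$, let $E_1'$ be a Borel subset of $\mathbb R^e$, let $|\cdot|$ be an arbitrary norm on $\mathbb R^e$, and let $f_1,f_2:\mathbb R^q\times E_1'\to\mathbb R$ be measurable. On a probability space let $((Z_t,\varepsilon_t))_{t\in\mathbb Z}$ be a stationary and ergodic process with values in $E_1'\times\mathbb R$, and consider $$Y_t=f_1(Y_{t-1},\dots,Y_{t-q},Z_{t-1})+\varepsilon_t\,f_2(Y_{t-1},\dots,Y_{t-q},Z_{t-1})\ \text{ a.s.},\qquad t\in\mathbb Z. \tag{1}$$ Assume that there are measurable $a_{i,j}:E_1'\to\mathbb R_+$ ($1\le i\le q$, $j=1,2$) with $$|f_j(y,z)-f_j(y',z)|\le\sum_{i=1}^q a_{i,j}(z)|y_i-y_i'|,\qquad y,y'\in\mathbb R^q,\ z\in E_1'.$$ Put $c_{i,t}=a_{i,1}(Z_{t-1})+a_{i,2}(Z_{t-1})|\varepsilon_t|$, and let $A_t$ be the $q\times q$ companion matrix with first row $(c_{1,t},\dots,c_{q,t})$, ones on the subdiagonal and zeros elsewhere. Solutions are considered on the given probability space, and uniqueness means almost sure equality at each time $t$. 1. Let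 $\|\cdot\|$ be any norm on the $q\times q$ real matrices. Assume that $\mathbb E\log^+\|A_1\|<\infty$, that $\mathbb E\log^+|f_1(x,Z_0)+\varepsilon_1f_2(x,Z_0)|<\infty$ for some $x\in\mathbb R^q$, and that the Lyapunov exponent $$\chi=\lim_{n\to\infty}\frac1n\,\mathbb E\log\|A_n\cdots A_1\|\in[-\infty,\infty)$$ (with $\log 0=-\infty$) is negative. Then (1) has a stationary solution, it is unique among the stationary solutions, and it is ergodic. 2. Let $(\mathcal F_t)_{t\in\mathbb Z}$ be a filtration such that $Z_t$ and $\varepsilon_t$ are $\mathcal F_t$-measurable and $\varepsilon_t$ is independent of $\mathcal F_{t-1}$ for every $t$. Let $p\in[1,\infty)$ be such that $f_1(\bar x,Z_0)+\varepsilon_1f_2(\bar x,Z_0)\in\mathbb L^p$ for some $\bar x\in\mathbb R^q$ and $$\sum_{i=1}^q\ \sup_{z\in E_1'}\big\|a_{i,1}(z)+a_{i,2}(z)|\varepsilon_1|\big\|_p<1 .$$ Then (1) has a stationary non-anticipative solution (that is, $Y_t$ is $\mathcal F_t$-measurable for all $t$); it is unique among the stationary non-anticipative solutions, it is ergodic,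 and $\mathbb E|Y_1|^p<\infty$. 3. In addition to the assumptions of part 2, assume the following. There are $r\in[p,\infty)$ and $s\in[p,\infty]$ with $r^{-1}+s^{-1}=p^{-1}$, $\|\varepsilon_1\|_p<\infty$, $\mathbb E|Z_0|^r<\infty$, and measurable $L_1,L_2:\mathbb R^q\to\mathbb R$ with $|f_j(y,z)-f_j(y,z')|\le L_j(y)|z-z'|$ for $j=1,2$ and all $y\in\mathbb R^q$, $z,z'\in E_1'$. There are random variables $\eta_t$ in a measurable space $G_1$ such that $\xi_t=(\varepsilon_t,\eta_t)$, $t\in\mathbb Z$, are i.i.d., and a measurable $H'$ with $Z_t=H'(\eta_t,\eta_{t-1},\dots)$ a.s. for all $t$. The solution $Y$ of part 2 satisfies $L_j(Y_q,\dots,Y_1)\in\mathbb L^s$ for $j=1,2$. For a process $X_t=g(\xi_t,\xi_{t-1},\dots)$, let $\bar\xi_0=\xi_0'$ be a copy of $\xi_0$ independent of $(\xi_t)_{t\in\mathbb Z}$, let $\bar\xi_t=\xi_t$ for $t\ne0$, and define $$\theta_{m,t}(X)=\|g(\xi_t,\xi_{t-1},\dots)-g(\bar\xi_t,\bar\xi_{t-1},\dots)\|_m,\qquad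 \Theta_{m,h}(X)=\sum_{t\ge h}\theta_{m,t}(X)\in[0,\infty].$$ Then $Y_t=g(\xi_t,\xi_{t-1},\dots)$ a.s. for all $t$, for some measurable $g$, and there are $C>0$ and $\rho\in(0,1)$ such that for all $h\ge1$ $$\Theta_{p,h}(Y)\le C\Big[\rho^h+\sum_{i=1}^h\rho^i\,\Theta_{r,h-i}(Z)\Big].$$ -/

import Mathlib

open MeasureTheory ProbabilityTheory Filter Topology
open scoped ENNReal NNReal

noncomputable section

namespace CHARN

/-! ### Stationary and ergodic two-sided processes -/

section Processes

variable {Ω S : Type*} [MeasurableSpace Ω] [MeasurableSpace S]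

/-- The shift `x ↦ (x (t + 1))_t` on two-sided sequences. -/
def shift (x : ℤ → S) : ℤ → S := fun t => x (t + 1)

/-- The law of the whole trajectory of the process `X` on the sequence space `ℤ → S`. -/
def pathLaw (μ : Measure Ω) (X : ℤ → Ω → S) : Measure (ℤ → S) :=
  μ.map fun ω t => X t ω

/-- `X` is a (strictly) stationary process: the law of its trajectory is invariant under the
shift. -/
structure IsStationary (μ : Measure Ω) (X : ℤ → Ω → S) : Prop where
  measurable : ∀ t, Measurable (X t)
  measurePreserving : MeasurePreserving (shift (S := S)) (pathLaw μ X) (pathLaw μ X)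

/-- `X` is an ergodic stationary process: the shift is ergodic for the law of its trajectory
(`Ergodic` in particular contains the invariance of the law). -/
structure IsStationaryErgodic (μ : Measure Ω) (X : ℤ → Ω → S) : Prop where
  measurable : ∀ t, Measurable (X t)
  ergodic : Ergodic (shift (S := S)) (pathLaw μ X)

end Processes

/-! ### Lyapunov exponent -/

section Lyapunov

variable {Ω : Type*} [MeasurableSpace Ω] {q : ℕ}

/-- The expectation `E[X⁺] - E[X⁻]` of an extended real random variable (meaningful as soon as
one of the two terms is finite). -/
def expectation (μ : Measure Ω) (X : Ω → EReal) : EReal :=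
  ((∫⁻ ω, (X ω).toENNReal ∂μ : ℝ≥0∞) : EReal) - ((∫⁻ ω, (-X ω).toENNReal ∂μ : ℝ≥0∞) : EReal)

/-- The product `A_n ⋯ A_1`. -/
def matProd (A : ℤ → Matrix (Fin q) (Fin q) ℝ) : ℕ → Matrix (Fin q) (Fin q) ℝ
  | 0 => 1
  | n + 1 => A ((n : ℤ) + 1) * matProd A n

/-- `E[log N(A_n ⋯ A_1)] / n`, where `log 0 = -∞`. -/
def meanLogGrowth (μ : Measure Ω) (N : Matrix (Fin q) (Fin q) ℝ → ℝ)
    (A : ℤ → Ω → Matrix (Fin q) (Fin q) ℝ) (n : ℕ) : EReal :=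
  expectation μ (fun ω => ENNReal.log (ENNReal.ofReal (N (matProd (fun t => A t ω) n)))) /
    (n : EReal)

/-- The Lyapunov exponent of a sequence of random matrices, computed with the norm `N`: the limit
of `E[log N(A_n ⋯ A_1)] / n`, an element of `[-∞, ∞]`. It is written as an upper limit so that it
is a total function; see `lyapunovExponent_eq` for the agreement with the limit. -/
def lyapunovExponent (μ : Measure Ω) (N : Matrix (Fin q) (Fin q) ℝ → ℝ)
    (A : ℤ → Ω → Matrix (Fin q) (Fin q) ℝ) : EReal :=
  limsup (meanLogGrowth μ N A) atTop

theorem lyapunovExponent_eq (μ : Measure Ω) (N : Matrix (Fin q) (Fin q) ℝ → ℝ)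
    (A : ℤ → Ω → Matrix (Fin q) (Fin q) ℝ) (χ : EReal)
    (h : Tendsto (meanLogGrowth μ N A) atTop (𝓝 χ)) : lyapunovExponent μ N A = χ :=
  h.limsup_eq

end Lyapunov

/-! ### The model -/

section Model

variable {Ω E₁ : Type*} [MeasurableSpace Ω] {q : ℕ}

/-- The vector of lags `(Y_{t-1}, …, Y_{t-q})`. -/
def lags (q : ℕ) (Y : ℤ → Ω → ℝ) (t : ℤ) (ω : Ω) : Fin q → ℝ :=
  fun i => Y (t - 1 - (i : ℤ)) ω

/-- The process `Y` solves, for every `t`, almost surely,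
`Y_t = f₁(Y_{t-1}, …, Y_{t-q}, Z_{t-1}) + ε_t f₂(Y_{t-1}, …, Y_{t-q}, Z_{t-1})`. -/
def IsSolution (μ : Measure Ω) (f₁ f₂ : (Fin q → ℝ) × E₁ → ℝ) (Z : ℤ → Ω → E₁)
    (ε : ℤ → Ω → ℝ) (Y : ℤ → Ω → ℝ) : Prop :=
  ∀ t, ∀ᵐ ω ∂μ, Y t ω =
    f₁ (lags q Y t ω, Z (t - 1) ω) + ε t ω * f₂ (lags q Y t ω, Z (t - 1) ω)

/-- `|f(y, z) - f(y', z)| ≤ ∑ i, a_i(z) |y_i - y'_i|`. -/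
def LipschitzInLags (f : (Fin q → ℝ) × E₁ → ℝ) (a : Fin q → E₁ → ℝ≥0) : Prop :=
  ∀ (y y' : Fin q → ℝ) (z : E₁), |f (y, z) - f (y', z)| ≤ ∑ i, (a i z : ℝ) * |y i - y' i|

/-- The random companion matrix `A_t`, with first row
`c_{i,t} = a_{i,1}(Z_{t-1}) + a_{i,2}(Z_{t-1}) |ε_t|` and ones on the subdiagonal. -/
def companion (a₁ a₂ : Fin q → E₁ → ℝ≥0) (Z : ℤ → Ω → E₁) (ε : ℤ → Ω → ℝ) (t : ℤ) (ω : Ω) :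
    Matrix (Fin q) (Fin q) ℝ :=
  Matrix.of fun i j =>
    if (i : ℕ) = 0 then (a₁ j (Z (t - 1) ω) : ℝ) + (a₂ j (Z (t - 1) ω) : ℝ) * |ε t ω|
    else if (i : ℕ) = (j : ℕ) + 1 then 1 else 0

end Model

/-! ### Functional dependence measure -/

section FunctionalDependence

variable {Ω G S : Type*} [MeasurableSpace Ω] [MeasurableSpace G] [MeasurableSpace S]

/-- The past `(ξ_t, ξ_{t-1}, …)`. -/
def past (ξ : ℤ → Ω → G) (t : ℤ) (ω : Ω) : ℕ → G := fun j => ξ (t - (j : ℤ)) ω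

/-- Causal Bernoulli shift representation `X_t = H(ξ_t, ξ_{t-1}, …)` almost surely. -/
structure IsBernoulliShift (μ : Measure Ω) (ξ : ℤ → Ω → G) (H : (ℕ → G) → S)
    (X : ℤ → Ω → S) : Prop where
  measurable : Measurable H
  eq_ae : ∀ t, ∀ᵐ ω ∂μ, X t ω = H (past ξ t ω)

/-- The sequence `ξ̄`, in which `ξ_0` is replaced by an independent copy `ξ_0'` of itself. It lives
on `Ω × Ω` with the product measure: the original sequence is read from the first coordinate and
`ξ_0'` is `ξ_0` read from the second one. -/
def coupled (ξ : ℤ → Ω → G) (t : ℤ) (ω : Ω × Ω) : G :=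
  if t = 0 then ξ 0 ω.2 else ξ t ω.1

/-- `θ_{p,t} = E^{1/p} |H(ξ_t, ξ_{t-1}, …) - H(ξ̄_t, ξ̄_{t-1}, …)|^p`. -/
def theta {V : Type*} [NormedAddCommGroup V] (μ : Measure Ω) (ξ : ℤ → Ω → G)
    (H : (ℕ → G) → V) (p : ℝ) (t : ℕ) : ℝ≥0∞ :=
  eLpNorm (fun ω : Ω × Ω => H (past ξ t ω.1) - H (past (coupled ξ) t ω))
    (ENNReal.ofReal p) (μ.prod μ)

/-- `Θ_{p,h} = ∑_{t ≥ h} θ_{p,t}`, an element of `[0, ∞]`. -/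
def Theta {V : Type*} [NormedAddCommGroup V] (μ : Measure Ω) (ξ : ℤ → Ω → G)
    (H : (ℕ → G) → V) (p : ℝ) (h : ℕ) : ℝ≥0∞ :=
  ∑' t : ℕ, theta μ ξ H p (h + t)

end FunctionalDependence

end CHARN

end

/-! Write `W t = (Z t, ε t)` and view the model as a recursion for the state `(Y_t, …, Y_{t-q+1})`
driven by the past of `W`. By the Lipschitz condition, the coordinatewise distance between two
states is multiplied at each step by at most the companion matrix. Its entries are nonnegative, so
these bounds can be iterated (`abs_stateIter_succ_sub_le`, `abs_state_sub_le`). Start the recursion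
`n` steps ago at a fixed `v₀`. The change caused by one further step back is at most the product of
the last `n` companion matrices applied to the one-step defect of `v₀`. If these changes are
summable, the limit is a measurable functional of the past of `W`. It is therefore stationary,
ergodic and adapted, and it solves the equation because the recursion is continuous in the state.
Any two stationary solutions agree: their difference is bounded by a matrix product tending to zero
times a tight sequence (`IsSolution.ae_eq`).

It remains to make the matrix products decay. In part 1, a negative exponent provides one `m` for
which the logarithm of the `m`-fold product, truncated from below, has negative mean. The maximal
ergodic inequality makes its Birkhoff sums decrease linearly. Multiplying `m` consecutive norms
turns this into exponential decay (`eventually_le_exp_of_window`), without asking that the `m`-th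
iterate of the shift be ergodic. Integrability of the positive logarithm of the defect keeps the
defect subexponential. In part 2, `ε t` is independent of the past, so row `0` acts in `L^p` with
coefficients `α j` of sum below `1`. A norm with weights `ρ^{-i}` on the coordinates then contracts
at rate `ρ` (`exists_geometric_rate`, `eLpNorm_cocycle_mulVec_le`).

In part 3, the trajectory with `ξ 0` replaced has the same law as the original one, so it gives a
solution of the same equation. Subtracting the two equations, with independence for the coefficients
and Hölder for the covariate term, gives a linear recursive inequality for the dependence measures,
with those of `Z` as input (`eLpNorm_sub_coupled_le`). Summing it over tails gives the bound
(`exists_const_tail_sum_le`). -/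

noncomputable section

namespace CHARN

/-! ### Maximal ergodic inequality and growth along orbits. -/

section MaximalErgodic

variable {X : Type*}

/-- The maximum of the Birkhoff sums of orders `0, …, n` of `f` along `τ`. -/
def maxBirkhoffSum (τ : X → X) (f : X → ℝ) : ℕ → X → ℝ
  | 0 => fun _ => 0
  | n + 1 => fun x => max 0 (f x + maxBirkhoffSum τ f n (τ x))

variable {τ : X → X} {f : X → ℝ}

lemma maxBirkhoffSum_nonneg (n : ℕ) (x : X) : 0 ≤ maxBirkhoffSum τ f n x := by
  cases n <;> simp [maxBirkhoffSum]

lemma maxBirkhoffSum_le_succ (n : ℕ) (x : X) :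
    maxBirkhoffSum τ f n x ≤ maxBirkhoffSum τ f (n + 1) x := by
  induction n generalizing x with
  | zero => exact maxBirkhoffSum_nonneg _ _
  | succ n ih => exact max_le_max le_rfl (by gcongr; exact ih _)

lemma maxBirkhoffSum_mono (x : X) : Monotone fun n => maxBirkhoffSum τ f n x :=
  monotone_nat_of_le_succ fun n => maxBirkhoffSum_le_succ n x

lemma birkhoffSum_le_maxBirkhoffSum (n : ℕ) (x : X) :
    birkhoffSum τ f n x ≤ maxBirkhoffSum τ f n x := by
  induction n generalizing x with
  | zero => simp [maxBirkhoffSum]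
  | succ n ih =>
    rw [birkhoffSum_succ']
    exact le_max_of_le_right (by gcongr; exact ih _)

variable [MeasurableSpace X] {ν : Measure X}

lemma measurable_maxBirkhoffSum (hτ : Measurable τ) (hf : Measurable f) (n : ℕ) :
    Measurable (maxBirkhoffSum τ f n) := by
  induction n with
  | zero => exact measurable_const
  | succ n ih => exact measurable_const.max (hf.add (ih.comp hτ))

lemma integrable_maxBirkhoffSum (hτ : MeasurePreserving τ ν ν) (hf : Integrable f ν) (n : ℕ) :
    Integrable (maxBirkhoffSum τ f n) ν := by
  induction n with
  | zero => exact integrable_zero _ _ _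
  | succ n ih =>
    have h := (hf.add (hτ.integrable_comp_of_integrable ih)).pos_part
    refine h.congr (Eventually.of_forall fun x => ?_)
    simp [maxBirkhoffSum, max_comm]

/-- The maximal ergodic inequality. -/
lemma setIntegral_maxBirkhoffSum_pos_nonneg (hτ : MeasurePreserving τ ν ν) (hfm : Measurable f)
    (hf : Integrable f ν) (n : ℕ) :
    0 ≤ ∫ x in {x | 0 < maxBirkhoffSum τ f n x}, f x ∂ν := by
  set M := maxBirkhoffSum τ f n with hM
  have hMm : Measurable M := measurable_maxBirkhoffSum hτ.measurable hfm n
  have hMi : Integrable M ν := integrable_maxBirkhoffSum hτ hf n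
  have hMτ : Integrable (fun x => M (τ x)) ν := hτ.integrable_comp_of_integrable hMi
  have hset : MeasurableSet {x | 0 < M x} := measurableSet_lt measurable_const hMm
  have h0 : ∫ x, (M x - M (τ x)) ∂ν = 0 := by
    rw [integral_sub hMi hMτ, sub_eq_zero]
    have := integral_map (μ := ν) hτ.measurable.aemeasurable (f := M)
      hMm.aestronglyMeasurable
    rwa [hτ.map_eq] at this
  rw [← integral_indicator hset]
  -- Garsia's argument: where `M > 0`, the maximum is attained by the second term, so `M - M ∘ τ ≤
  -- f`; elsewhere `M ≤ 0 ≤ M ∘ τ`.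
  refine h0.symm.le.trans (integral_mono (hMi.sub hMτ) (hf.indicator hset) fun x => ?_)
  have hτx : 0 ≤ M (τ x) := maxBirkhoffSum_nonneg _ _
  by_cases hx : 0 < M x
  · rw [Set.indicator_of_mem (by exact hx)]
    cases n with
    | zero => simp [hM, maxBirkhoffSum] at hx
    | succ n =>
      have h1 : M x = max 0 (f x + maxBirkhoffSum τ f n (τ x)) := rfl
      have h2 : maxBirkhoffSum τ f n (τ x) ≤ M (τ x) := maxBirkhoffSum_le_succ n _
      rcases max_choice 0 (f x + maxBirkhoffSum τ f n (τ x)) with h3 | h3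
      · rw [h1, h3] at hx; exact absurd hx (lt_irrefl _)
      · simp only [h1, h3]; linarith
  · rw [Set.indicator_of_notMem (by exact hx)]
    linarith [not_lt.1 hx]

/-- With `δ` half of minus the mean, `f + δ` still has negative mean. The set where its Birkhoff
sums are bounded above is invariant, hence null or of full measure. If it were null, the sets `{0 <
maxBirkhoffSum}` would increase to almost everything, and the maximal inequality would make the mean
nonnegative. -/
lemma exists_birkhoffSum_le_of_integral_neg [IsProbabilityMeasure ν] (hτ : Ergodic τ ν)
    (hfm : Measurable f) (hf : Integrable f ν) (hneg : ∫ x, f x ∂ν < 0) :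
    ∃ δ > 0, ∀ᵐ x ∂ν, ∃ C : ℝ, ∀ n : ℕ, birkhoffSum τ f n x ≤ C - δ * n := by
  set δ := -(∫ x, f x ∂ν) / 2 with hδ
  have hδ0 : 0 < δ := by linarith
  refine ⟨δ, hδ0, ?_⟩
  set f' : X → ℝ := fun x => f x + δ
  have hf'm : Measurable f' := hfm.add_const _
  have hf' : Integrable f' ν := hf.add (integrable_const _)
  have hint : ∫ x, f' x ∂ν < 0 := by
    have : ∫ x, f' x ∂ν = ∫ x, f x ∂ν + δ := by
      rw [integral_add hf (integrable_const _)]; simp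
    rw [this]; linarith
  have hsum : ∀ n x, birkhoffSum τ f' n x = birkhoffSum τ f n x + δ * n := by
    intro n x
    simp [birkhoffSum, f', Finset.sum_add_distrib, mul_comm]
  set F : Set X := {x | ∃ C : ℕ, ∀ n : ℕ, birkhoffSum τ f' n x ≤ C} with hF
  have hBm : ∀ n, Measurable (birkhoffSum τ f' n) := fun n => by
    refine Finset.measurable_sum _ fun i _ => hf'm.comp (hτ.measurable.iterate i)
  have hFm : MeasurableSet F := by
    have : F = ⋃ C : ℕ, ⋂ n : ℕ, {x | birkhoffSum τ f' n x ≤ C} := by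
      ext x; simp [hF]
    rw [this]
    exact .iUnion fun C => .iInter fun n => measurableSet_le (hBm n) measurable_const
  have hinv : τ ⁻¹' F = F := by
    ext x
    simp only [Set.mem_preimage, hF, Set.mem_ofPred_eq]
    constructor
    · rintro ⟨C, hC⟩
      obtain ⟨C', hC'⟩ := exists_nat_ge (max 0 (f' x + C))
      refine ⟨C', fun n => ?_⟩
      cases n with
      | zero => simp
      | succ n =>
        rw [birkhoffSum_succ']
        exact (by linarith [hC n] : _ ≤ f' x + C).trans ((le_max_right _ _).trans hC')
    · rintro ⟨C, hC⟩
      obtain ⟨C', hC'⟩ := exists_nat_ge (C - f' x)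
      refine ⟨C', fun n => ?_⟩
      have := hC (n + 1)
      rw [birkhoffSum_succ'] at this
      linarith
  rcases hτ.toPreErgodic.ae_mem_or_ae_notMem hFm hinv with h | h
  · filter_upwards [h] with x hx
    obtain ⟨C, hC⟩ := hx
    exact ⟨C, fun n => by have := hC n; rw [hsum] at this; linarith⟩
  · exfalso
    set s : ℕ → Set X := fun n => {x | 0 < maxBirkhoffSum τ f' n x}
    have hsm : ∀ n, MeasurableSet (s n) := fun n =>
      measurableSet_lt measurable_const (measurable_maxBirkhoffSum hτ.measurable hf'm n)
    have hmono : Monotone s := fun a b hab x hx =>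
      lt_of_lt_of_le (show 0 < maxBirkhoffSum τ f' a x from hx) (maxBirkhoffSum_mono x hab)
    have hlim := tendsto_setIntegral_of_monotone hsm hmono hf'.integrableOn
    have hfull : ∀ᵐ x ∂ν, x ∈ ⋃ n, s n := by
      filter_upwards [h] with x hx
      by_contra hcon
      refine hx ⟨0, fun n => ?_⟩
      have : ¬ 0 < maxBirkhoffSum τ f' n x := fun h0 => hcon (Set.mem_iUnion.2 ⟨n, h0⟩)
      simpa using (birkhoffSum_le_maxBirkhoffSum n x).trans (not_lt.1 this)
    rw [setIntegral_eq_integral_of_ae_compl_eq_zero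
      (hfull.mono fun x hx hx' => absurd hx hx')] at hlim
    have := ge_of_tendsto' hlim fun n =>
      setIntegral_maxBirkhoffSum_pos_nonneg hτ.toMeasurePreserving hf'm hf' n
    linarith

/-- Borel–Cantelli: `f ∘ τ^[n]` has the law of `f`, and integrability makes the probabilities of
`|f| / δ > n` summable. The values `δ = 1 / (k + 1)` suffice, which leaves countably many null sets.
-/
lemma eventually_iterate_le_mul [IsProbabilityMeasure ν] (hτ : MeasurePreserving τ ν ν)
    (hfm : Measurable f) (hf : Integrable f ν) :
    ∀ᵐ x ∂ν, ∀ δ > 0, ∀ᶠ n : ℕ in atTop, f (τ^[n] x) ≤ δ * n := by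
  have key : ∀ k : ℕ, ∀ᵐ x ∂ν, ∀ᶠ n : ℕ in atTop, f (τ^[n] x) ≤ (k + 1 : ℝ)⁻¹ * n := by
    intro k
    set δ : ℝ := (k + 1 : ℝ)⁻¹ with hδ
    have hδ0 : 0 < δ := by positivity
    have h1 : ∑' n : ℕ, ν {x | |f x| / δ ∈ Set.Ioi (n : ℝ)} < ⊤ := by
      -- `tsum_prob_mem_Ioi_lt_top` speaks of `volume`, so `ν` is installed as such.
      let _ : MeasureSpace X := ⟨ν⟩
      have : IsProbabilityMeasure (volume : Measure X) := ‹IsProbabilityMeasure ν›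
      exact tsum_prob_mem_Ioi_lt_top (hf.abs.div_const δ) fun x => by
        simp only [Pi.zero_apply]; positivity
    have h2 : ∑' n : ℕ, ν {x | |f (τ^[n] x)| / δ ∈ Set.Ioi (n : ℝ)} ≠ ⊤ := by
      refine ne_of_lt (lt_of_eq_of_lt (tsum_congr fun n => ?_) h1)
      have hms : MeasurableSet {x | |f x| / δ ∈ Set.Ioi (n : ℝ)} :=
        (hfm.abs.div_const δ) measurableSet_Ioi
      exact (hτ.iterate n).measure_preimage hms.nullMeasurableSet
    filter_upwards [ae_eventually_notMem h2] with x hx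
    filter_upwards [hx] with n hn
    simp only [Set.mem_Ioi, not_lt] at hn
    rw [div_le_iff₀ hδ0] at hn
    linarith [le_abs_self (f (τ^[n] x))]
  filter_upwards [ae_all_iff.2 key] with x hx δ hδ
  obtain ⟨k, hk⟩ := exists_nat_one_div_lt hδ
  filter_upwards [hx k] with n hn
  refine hn.trans (mul_le_mul_of_nonneg_right ?_ (Nat.cast_nonneg n))
  rw [← one_div]; exact hk.le

end MaximalErgodic

/-! ### Exponential decay of matrix cocycles. -/

section Cocycle

/-- The product `Q n` of `m` consecutive terms satisfies `Q (n + 1) ≤ Q n * exp (η n)`, since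
passing from `n` to `n + 1` only exchanges `a n` for `a (n + m)`. Thus sums of `η` over all starting
points control `Q`, although `η` describes blocks of length `m`. The subexponential one-step growth
`γ` then recovers a single term from `Q`. -/
lemma eventually_le_exp_of_window {a γ η : ℕ → ℝ} {m : ℕ} (hm : 1 ≤ m) {C δ : ℝ} (hδ : 0 < δ)
    (ha : ∀ n, 0 ≤ a n) (hγ : ∀ n, 0 ≤ γ n) (h1 : ∀ n, a (n + 1) ≤ a n * Real.exp (γ n))
    (hwin : ∀ n, a (n + m) ≤ a n * Real.exp (η n))
    (hη : ∀ n : ℕ, ∑ k ∈ Finset.range n, η k ≤ C - δ * n)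
    (hγs : ∀ ε > 0, ∀ᶠ n : ℕ in atTop, γ n ≤ ε * n) :
    ∃ δ' > 0, ∀ᶠ n : ℕ in atTop, a n ≤ Real.exp (-δ' * n) := by
  have hm0 : (0 : ℝ) < m := by exact_mod_cast hm
  set Q : ℕ → ℝ := fun n => ∏ j ∈ Finset.range m, a (n + j) with hQ
  have hQ0 : ∀ n, 0 ≤ Q n := fun n => Finset.prod_nonneg fun j _ => ha _
  have hQs : ∀ n, Q (n + 1) ≤ Q n * Real.exp (η n) := by
    intro n
    obtain ⟨k, rfl⟩ : ∃ k, m = k + 1 := ⟨m - 1, by omega⟩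
    simp only [hQ]
    rw [Finset.prod_range_succ, Finset.prod_range_succ']
    have e : ∀ j, a (n + 1 + j) = a (n + (j + 1)) := fun j => by congr 1; ring
    simp only [e, add_zero]
    rw [mul_assoc]
    exact mul_le_mul_of_nonneg_left (hwin n) (Finset.prod_nonneg fun j _ => ha _)
  have hQn : ∀ n, Q n ≤ Q 0 * Real.exp (C - δ * n) := by
    intro n
    have : Q n ≤ Q 0 * Real.exp (∑ k ∈ Finset.range n, η k) := by
      induction n with
      | zero => simp
      | succ n ih =>
        rw [Finset.sum_range_succ, Real.exp_add, ← mul_assoc]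
        exact (hQs n).trans (mul_le_mul_of_nonneg_right ih (Real.exp_pos _).le)
    exact this.trans (mul_le_mul_of_nonneg_left (Real.exp_le_exp.2 (hη n)) (hQ0 0))
  have hstep : ∀ n i, a (n + i) ≤ a n * Real.exp (∑ l ∈ Finset.range i, γ (n + l)) := by
    intro n i
    induction i with
    | zero => simp
    | succ i ih =>
      rw [Finset.sum_range_succ, Real.exp_add, ← mul_assoc, ← add_assoc]
      exact (h1 _).trans (mul_le_mul_of_nonneg_right ih (Real.exp_pos _).le)
  set G : ℕ → ℝ := fun n => ∑ l ∈ Finset.range m, γ (n + l) with hG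
  have hpow : ∀ n, a (n + m) ^ m ≤ Q n * Real.exp (m * G n) := by
    intro n
    have h2 : ∀ j ∈ Finset.range m, a (n + m) ≤ a (n + j) * Real.exp (G n) := by
      intro j hj
      have hj' := Finset.mem_range.1 hj
      have h3 := hstep (n + j) (m - j)
      rw [show n + j + (m - j) = n + m by omega] at h3
      refine h3.trans (mul_le_mul_of_nonneg_left (Real.exp_le_exp.2 ?_) (ha _))
      have h4 : ∑ l ∈ Finset.range (m - j), γ (n + j + l)
          = ∑ l ∈ Finset.Ico j m, γ (n + l) := by
        rw [Finset.sum_Ico_eq_sum_range]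
        simp [add_assoc]
      rw [h4]
      refine Finset.sum_le_sum_of_subset_of_nonneg (fun l hl => ?_) fun _ _ _ => hγ _
      exact Finset.mem_range.2 (Finset.mem_Ico.1 hl).2
    calc a (n + m) ^ m = ∏ j ∈ Finset.range m, a (n + m) := by simp
      _ ≤ ∏ j ∈ Finset.range m, (a (n + j) * Real.exp (G n)) :=
        Finset.prod_le_prod (fun _ _ => ha _) h2
      _ = Q n * Real.exp (m * G n) := by
        rw [Finset.prod_mul_distrib]; simp [hQ, Real.exp_nat_mul]
  -- Budget for the decay `δ` of `Q`: one quarter pays for `m * G`, which is why `ε` carries `m *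
  -- m`; another quarter absorbs the constant `D`. The remaining half belongs to the `m`-th power,
  -- whence the rate `δ / (2 * m)`.
  set ε : ℝ := δ / (4 * m * m) with hε
  have hε0 : 0 < ε := by positivity
  obtain ⟨N, hN⟩ := eventually_atTop.1 (hγs ε hε0)
  set D : ℝ := Q 0 * Real.exp (C + δ * m) with hD
  have hlarge : ∀ᶠ n : ℕ in atTop, D ≤ Real.exp (δ / 4 * n) := by
    have : Tendsto (fun n : ℕ => Real.exp (δ / 4 * n)) atTop atTop :=
      Real.tendsto_exp_atTop.comp
        (tendsto_natCast_atTop_atTop.const_mul_atTop (by positivity))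
    exact this.eventually_ge_atTop D
  refine ⟨δ / (2 * m), by positivity, ?_⟩
  filter_upwards [hlarge, eventually_ge_atTop (N + m)] with n hn hnN
  obtain ⟨k, rfl⟩ : ∃ k, n = k + m := ⟨n - m, by omega⟩
  have hk : N ≤ k := by omega
  have hGk : G k ≤ m * (ε * (k + m : ℕ)) := by
    have : ∀ l ∈ Finset.range m, γ (k + l) ≤ ε * (k + m : ℕ) := by
      intro l hl
      refine (hN (k + l) (by omega)).trans (mul_le_mul_of_nonneg_left ?_ hε0.le)
      exact_mod_cast Nat.add_le_add_left (Finset.mem_range.1 hl).le k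
    calc G k ≤ ∑ l ∈ Finset.range m, ε * (k + m : ℕ) := Finset.sum_le_sum this
      _ = m * (ε * (k + m : ℕ)) := by simp
  have hmG : m * G k ≤ δ / 4 * (k + m : ℕ) := by
    calc m * G k ≤ m * (m * (ε * (k + m : ℕ))) := by gcongr
      _ = δ / 4 * (k + m : ℕ) := by rw [hε]; field_simp
  have hfin : a (k + m) ^ m ≤ Real.exp (-(δ / (2 * m)) * (k + m : ℕ)) ^ m := by
    rw [← Real.exp_nat_mul]
    calc a (k + m) ^ m ≤ Q k * Real.exp (m * G k) := hpow k
      _ ≤ (Q 0 * Real.exp (C - δ * k)) * Real.exp (δ / 4 * (k + m : ℕ)) := by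
        gcongr
        · exact mul_nonneg (hQ0 0) (Real.exp_pos _).le
        · exact hQn k
      _ = D * Real.exp (-(3 / 4) * δ * (k + m : ℕ)) := by
        rw [hD, mul_assoc, mul_assoc, ← Real.exp_add, ← Real.exp_add]
        congr 2; push_cast; ring
      _ ≤ Real.exp (δ / 4 * (k + m : ℕ)) * Real.exp (-(3 / 4) * δ * (k + m : ℕ)) := by
        gcongr
      _ = Real.exp (m * (-(δ / (2 * m)) * (k + m : ℕ))) := by
        rw [← Real.exp_add]; congr 1; field_simp; ring
  exact (pow_le_pow_iff_left₀ (ha _) (Real.exp_pos _).le (by omega)).1 hfin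

variable {X A : Type*} [NormedRing A]

/-- The product `B x * B (τ x) * ⋯ * B (τ^[n - 1] x)`. -/
def cocycle {A : Type*} [Monoid A] (τ : X → X) (B : X → A) : ℕ → X → A
  | 0 => fun _ => 1
  | n + 1 => fun x => B x * cocycle τ B n (τ x)

lemma cocycle_add {A : Type*} [Monoid A] (τ : X → X) (B : X → A) (n k : ℕ) (x : X) :
    cocycle τ B (n + k) x = cocycle τ B n x * cocycle τ B k (τ^[n] x) := by
  induction n generalizing x with
  | zero => simp [cocycle]
  | succ n ih => rw [Nat.add_right_comm]; simp [cocycle, ih, mul_assoc]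

lemma norm_le_exp_posLog (a : A) : ‖a‖ ≤ Real.exp (Real.posLog ‖a‖) := by
  rcases (norm_nonneg a).eq_or_lt with h | h
  · rw [← h]; exact (Real.exp_pos _).le
  · calc ‖a‖ = Real.exp (Real.log ‖a‖) := (Real.exp_log h).symm
      _ ≤ _ := Real.exp_le_exp.2 (le_max_right _ _)

/-- The window lemma along almost every orbit. The function `η` majorizes the logarithm of the
`m`-fold product, and the exponential form of the hypothesis allows that product to vanish. -/
lemma exists_cocycle_le_exp [MeasurableSpace X] {ν : Measure X} [IsProbabilityMeasure ν]
    {τ : X → X} (hτ : Ergodic τ ν) {B : X → A} (hBm : Measurable fun x => Real.posLog ‖B x‖)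
    (hB : Integrable (fun x => Real.posLog ‖B x‖) ν) {m : ℕ} (hm : 1 ≤ m) {η : X → ℝ}
    (hηm : Measurable η) (hη : Integrable η ν) (hneg : ∫ x, η x ∂ν < 0)
    (hle : ∀ x, ‖cocycle τ B m x‖ ≤ Real.exp (η x)) :
    ∀ᵐ x ∂ν, ∃ δ > 0, ∀ᶠ n : ℕ in atTop, ‖cocycle τ B n x‖ ≤ Real.exp (-δ * n) := by
  obtain ⟨δ, hδ, hsum⟩ := exists_birkhoffSum_le_of_integral_neg hτ hηm hη hneg
  filter_upwards [hsum, eventually_iterate_le_mul hτ.toMeasurePreserving hBm hB]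
    with x ⟨C, hC⟩ hx
  refine eventually_le_exp_of_window (a := fun n => ‖cocycle τ B n x‖)
    (γ := fun n => Real.posLog ‖B (τ^[n] x)‖) (η := fun n => η (τ^[n] x)) hm (C := C) hδ
    (fun _ => norm_nonneg _) (fun _ => Real.posLog_nonneg) ?_ ?_ (fun n => hC n) hx
  · intro n
    rw [cocycle_add]
    refine (norm_mul_le _ _).trans (mul_le_mul_of_nonneg_left ?_ (norm_nonneg _))
    simpa [cocycle] using norm_le_exp_posLog (B (τ^[n] x))
  · intro n
    rw [cocycle_add]
    exact (norm_mul_le _ _).trans (mul_le_mul_of_nonneg_left (hle _) (norm_nonneg _))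

end Cocycle

/-! ### Pasts of stationary processes as factors of the two-sided shift. -/

section Past

variable {Ω S T : Type*} [MeasurableSpace Ω] [MeasurableSpace S] [MeasurableSpace T]
  {μ : Measure Ω} {X : ℤ → Ω → S}

/-- The one-sided shift, which drops the most recent value of a past. -/
def tail {S : Type*} (x : ℕ → S) : ℕ → S := fun j => x (j + 1)

lemma measurable_tail : Measurable (tail (S := S)) :=
  measurable_pi_lambda _ fun _ => measurable_pi_apply _

lemma measurable_past (hX : ∀ t, Measurable (X t)) (t : ℤ) : Measurable (past X t) :=
  measurable_pi_lambda _ fun _ => hX _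

lemma tail_past {Ω S : Type*} (X : ℤ → Ω → S) (t : ℤ) (ω : Ω) :
    tail (past X t ω) = past X (t - 1) ω := by
  funext j
  simp only [tail, past]
  congr 1; push_cast; ring

lemma tail_iterate_past {Ω S : Type*} (X : ℤ → Ω → S) (n : ℕ) (t : ℤ) (ω : Ω) :
    tail^[n] (past X t ω) = past X (t - n) ω := by
  induction n generalizing t with
  | zero => simp
  | succ n ih =>
    rw [Function.iterate_succ_apply, tail_past, ih]
    congr 1; push_cast; ring

/-- The two-sided shift as a measurable equivalence. -/
def shiftEquiv (S : Type*) [MeasurableSpace S] : (ℤ → S) ≃ᵐ (ℤ → S) where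
  toFun := shift
  invFun y := fun t => y (t - 1)
  left_inv y := by funext t; simp [shift]
  right_inv y := by funext t; simp [shift]
  measurable_toFun := measurable_pi_lambda _ fun _ => measurable_pi_apply _
  measurable_invFun := measurable_pi_lambda _ fun _ => measurable_pi_apply _

lemma measurable_path (hX : ∀ t, Measurable (X t)) : Measurable fun ω t => X t ω :=
  measurable_pi_lambda _ hX

lemma IsStationaryErgodic.isStationary (h : IsStationaryErgodic μ X) : IsStationary μ X :=
  ⟨h.measurable, h.ergodic.toMeasurePreserving⟩

lemma IsStationary.map_path_add (h : IsStationary μ X) (k : ℤ) :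
    μ.map (fun ω t => X (t + k) ω) = pathLaw μ X := by
  have h1 : ∀ k : ℤ, (μ.map fun ω t => X (t + k) ω).map shift
      = μ.map fun ω t => X (t + (k + 1)) ω := by
    intro k
    refine (Measure.map_map (shiftEquiv S).measurable
      (measurable_path fun t => h.measurable (t + k))).trans ?_
    congr 1; funext ω t
    simp only [Function.comp, shiftEquiv, MeasurableEquiv.coe_mk, Equiv.coe_fn_mk, shift]
    congr 1; ring
  have hs : (pathLaw μ X).map shift = pathLaw μ X := h.measurePreserving.map_eq
  induction k using Int.induction_on with
  | zero => simp [pathLaw]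
  | succ k ih => rw [← h1, ih, hs]
  -- Going backwards in time uses that the shift is invertible.
  | pred k ih =>
    have h2 := h1 (-(k : ℤ) - 1)
    rw [sub_add_cancel, ih] at h2
    refine (shiftEquiv S).map_measurableEquiv_injective ?_
    exact h2.trans hs.symm

lemma IsStationary.map_past (h : IsStationary μ X) (t : ℤ) :
    μ.map (past X t) = μ.map (past X 0) := by
  have hm : Measurable fun (y : ℤ → S) (j : ℕ) => y (-(j : ℤ)) :=
    measurable_pi_lambda _ fun _ => measurable_pi_apply _
  have h1 : ∀ k : ℤ, μ.map (past X k) = (pathLaw μ X).map fun y (j : ℕ) => y (-(j : ℤ)) := by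
    intro k
    rw [← h.map_path_add k, Measure.map_map hm (measurable_path fun t => h.measurable (t + k))]
    congr 1; funext ω j
    simp only [Function.comp, past]; congr 1; ring
  rw [h1, h1]

lemma IsStationary.map_eq (h : IsStationary μ X) (t t' : ℤ) : μ.map (X t) = μ.map (X t') := by
  have h1 : ∀ k, μ.map (X k) = (μ.map (past X 0)).map fun y => y 0 := by
    intro k
    rw [← h.map_past k, Measure.map_map (measurable_pi_apply _) (measurable_past h.measurable k)]
    congr 1; funext ω; simp [past]
  rw [h1, h1]

lemma IsStationaryErgodic.measurePreserving_past (h : IsStationaryErgodic μ X) (t : ℤ) :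
    MeasurePreserving (past X t) μ (μ.map (past X 0)) :=
  ⟨measurable_past h.measurable t, h.isStationary.map_past t⟩

/-- Dropping the latest value is a factor of the inverse shift, through `y ↦ (y (-j))_j`. The
inverse of an ergodic equivalence is ergodic, and so are its factors. -/
lemma IsStationaryErgodic.ergodic_tail (h : IsStationaryErgodic μ X) :
    Ergodic tail (μ.map (past X 0)) := by
  have hm : Measurable fun (y : ℤ → S) (j : ℕ) => y (-(j : ℤ)) :=
    measurable_pi_lambda _ fun _ => measurable_pi_apply _
  have hp : MeasurePreserving (fun (y : ℤ → S) (j : ℕ) => y (-(j : ℤ))) (pathLaw μ X)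
      (μ.map (past X 0)) := by
    refine ⟨hm, ?_⟩
    rw [pathLaw, Measure.map_map hm (measurable_path h.measurable)]
    congr 1; funext ω j
    simp [past]
  have he : Ergodic (shiftEquiv S).symm (pathLaw μ X) := Ergodic.symm h.ergodic
  refine hp.ergodic_of_ergodic_semiconj he measurable_tail ?_
  intro y; funext j
  change y (-(j : ℤ) - 1) = y (-((j + 1 : ℕ) : ℤ))
  congr 1; push_cast; ring

/-- Applying `U` to the past at each time commutes with the shift, so the new path law is a factor
of the old one. -/
lemma IsStationaryErgodic.comp_past (h : IsStationaryErgodic μ X) {U : (ℕ → S) → T}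
    (hU : Measurable U) : IsStationaryErgodic μ fun t ω => U (past X t ω) := by
  refine ⟨fun t => hU.comp (measurable_past h.measurable t), ?_⟩
  have hm : Measurable fun (y : ℤ → S) (t : ℤ) => U fun j : ℕ => y (t - j) :=
    measurable_pi_lambda _ fun _ =>
      hU.comp (measurable_pi_lambda _ fun _ => measurable_pi_apply _)
  have hp : MeasurePreserving (fun (y : ℤ → S) (t : ℤ) => U fun j : ℕ => y (t - j)) (pathLaw μ X)
      (pathLaw μ fun t ω => U (past X t ω)) := by
    refine ⟨hm, ?_⟩
    rw [pathLaw, Measure.map_map hm (measurable_path h.measurable)]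
    rfl
  refine hp.ergodic_of_ergodic_semiconj h.ergodic (shiftEquiv T).measurable ?_
  intro y; funext t
  simp only [shift]
  congr 1; funext j; congr 1; ring

end Past

/-! ### The state recursion and its domination by the companion matrices. -/

section State

variable {E : Type*} {q : ℕ}

/-- The right-hand side of the model as a function of the past of the covariate/noise process and
of the lags. -/
def regression (f₁ f₂ : (Fin (q + 1) → ℝ) × E → ℝ) (x : ℕ → E × ℝ) (v : Fin (q + 1) → ℝ) : ℝ :=
  f₁ (v, (x 1).1) + (x 0).2 * f₂ (v, (x 1).1)

/-- The map `(Y_{t-1}, …, Y_{t-q}) ↦ (Y_t, …, Y_{t-q+1})`. -/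
def stateStep (f₁ f₂ : (Fin (q + 1) → ℝ) × E → ℝ) (x : ℕ → E × ℝ) (v : Fin (q + 1) → ℝ) :
    Fin (q + 1) → ℝ :=
  Fin.cons (regression f₁ f₂ x v) (Fin.init v)

/-- The state at the present time when the recursion is started `n` steps ago at `v₀`. -/
def stateIter (f₁ f₂ : (Fin (q + 1) → ℝ) × E → ℝ) (v₀ : Fin (q + 1) → ℝ) :
    ℕ → (ℕ → E × ℝ) → Fin (q + 1) → ℝ
  | 0 => fun _ => v₀
  | n + 1 => fun x => stateStep f₁ f₂ x (stateIter f₁ f₂ v₀ n (tail x))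

/-- The limit of the present value of the recursion when its starting time tends to `-∞`. -/
def stateLimit (f₁ f₂ : (Fin (q + 1) → ℝ) × E → ℝ) (v₀ : Fin (q + 1) → ℝ) (x : ℕ → E × ℝ) : ℝ :=
  limsup (fun n => stateIter f₁ f₂ v₀ n x 0) atTop

/-- The coefficient `a_{j,1}(Z_{t-1}) + a_{j,2}(Z_{t-1}) |ε_t|` as a function of the past. -/
def lagCoeff (a₁ a₂ : Fin (q + 1) → E → ℝ≥0) (x : ℕ → E × ℝ) (j : Fin (q + 1)) : ℝ :=
  (a₁ j (x 1).1 : ℝ) + (a₂ j (x 1).1 : ℝ) * |(x 0).2|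

/-- The companion matrix as a function of the past. -/
def pastCompanion (a₁ a₂ : Fin (q + 1) → E → ℝ≥0) (x : ℕ → E × ℝ) :
    Matrix (Fin (q + 1)) (Fin (q + 1)) ℝ :=
  Matrix.of fun i j =>
    if (i : ℕ) = 0 then lagCoeff a₁ a₂ x j else if (i : ℕ) = (j : ℕ) + 1 then 1 else 0

variable {f₁ f₂ : (Fin (q + 1) → ℝ) × E → ℝ} {a₁ a₂ : Fin (q + 1) → E → ℝ≥0}

lemma lagCoeff_nonneg (x : ℕ → E × ℝ) (j : Fin (q + 1)) : 0 ≤ lagCoeff a₁ a₂ x j := by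
  unfold lagCoeff; positivity

lemma pastCompanion_past {Ω : Type*} (Z : ℤ → Ω → E) (ε : ℤ → Ω → ℝ) (t : ℤ) (ω : Ω) :
    pastCompanion a₁ a₂ (past (fun t ω => (Z t ω, ε t ω)) t ω) = companion a₁ a₂ Z ε t ω := by
  ext i j
  simp [pastCompanion, companion, lagCoeff, past]

lemma pastCompanion_mulVec_zero (x : ℕ → E × ℝ) (u : Fin (q + 1) → ℝ) :
    (pastCompanion a₁ a₂ x).mulVec u 0 = ∑ j, lagCoeff a₁ a₂ x j * u j := by
  simp [Matrix.mulVec, dotProduct, pastCompanion]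

lemma pastCompanion_mulVec_succ (x : ℕ → E × ℝ) (u : Fin (q + 1) → ℝ) (i : Fin q) :
    (pastCompanion a₁ a₂ x).mulVec u i.succ = u i.castSucc := by
  simp only [Matrix.mulVec, dotProduct, pastCompanion, Matrix.of_apply]
  rw [Finset.sum_eq_single i.castSucc]
  · simp
  · intro j _ hj
    have : ¬ ((i : ℕ) = (j : ℕ)) := fun h => hj (Fin.ext (by simp [h]))
    simp [this]
  · simp

lemma pastCompanion_mulVec_mono (x : ℕ → E × ℝ) {u w : Fin (q + 1) → ℝ} (h : ∀ i, u i ≤ w i)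
    (i : Fin (q + 1)) :
    (pastCompanion a₁ a₂ x).mulVec u i ≤ (pastCompanion a₁ a₂ x).mulVec w i := by
  induction i using Fin.cases with
  | zero =>
    simp only [pastCompanion_mulVec_zero]
    exact Finset.sum_le_sum fun j _ => mul_le_mul_of_nonneg_left (h j) (lagCoeff_nonneg x j)
  | succ i => simp only [pastCompanion_mulVec_succ]; exact h _

lemma cocycle_succ_mulVec (n : ℕ) (x : ℕ → E × ℝ) (u : Fin (q + 1) → ℝ) :
    (cocycle tail (pastCompanion a₁ a₂) (n + 1) x).mulVec u
      = (pastCompanion a₁ a₂ x).mulVec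
        ((cocycle tail (pastCompanion a₁ a₂) n (tail x)).mulVec u) := by
  rw [Matrix.mulVec_mulVec]; rfl

lemma cocycle_mulVec_mono (n : ℕ) (x : ℕ → E × ℝ) {u w : Fin (q + 1) → ℝ} (h : ∀ i, u i ≤ w i)
    (i : Fin (q + 1)) :
    (cocycle tail (pastCompanion a₁ a₂) n x).mulVec u i
      ≤ (cocycle tail (pastCompanion a₁ a₂) n x).mulVec w i := by
  induction n generalizing x i with
  | zero => simpa [cocycle] using h i
  | succ n ih =>
    rw [cocycle_succ_mulVec, cocycle_succ_mulVec]
    exact pastCompanion_mulVec_mono x (fun i => ih (tail x) i) i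

lemma cocycle_mulVec_nonneg (n : ℕ) (x : ℕ → E × ℝ) {u : Fin (q + 1) → ℝ} (h : ∀ i, 0 ≤ u i)
    (i : Fin (q + 1)) : 0 ≤ (cocycle tail (pastCompanion a₁ a₂) n x).mulVec u i := by
  simpa using cocycle_mulVec_mono (a₁ := a₁) (a₂ := a₂) n x (u := 0) (w := u) h i

lemma abs_regression_sub_le (h₁ : LipschitzInLags f₁ a₁) (h₂ : LipschitzInLags f₂ a₂)
    (x : ℕ → E × ℝ) (v w : Fin (q + 1) → ℝ) :
    |regression f₁ f₂ x v - regression f₁ f₂ x w| ≤ ∑ j, lagCoeff a₁ a₂ x j * |v j - w j| := by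
  have e : regression f₁ f₂ x v - regression f₁ f₂ x w
      = (f₁ (v, (x 1).1) - f₁ (w, (x 1).1)) + (x 0).2 * (f₂ (v, (x 1).1) - f₂ (w, (x 1).1)) := by
    unfold regression; ring
  rw [e]
  refine (abs_add_le _ _).trans ?_
  rw [abs_mul]
  calc _ ≤ ∑ j, (a₁ j (x 1).1 : ℝ) * |v j - w j|
        + |(x 0).2| * ∑ j, (a₂ j (x 1).1 : ℝ) * |v j - w j| :=
        add_le_add (h₁ v w _) (mul_le_mul_of_nonneg_left (h₂ v w _) (abs_nonneg _))
    _ = _ := by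
      rw [Finset.mul_sum, ← Finset.sum_add_distrib]
      refine Finset.sum_congr rfl fun j _ => ?_
      unfold lagCoeff; ring

lemma abs_stateStep_sub_le (h₁ : LipschitzInLags f₁ a₁) (h₂ : LipschitzInLags f₂ a₂)
    (x : ℕ → E × ℝ) (v w : Fin (q + 1) → ℝ) (i : Fin (q + 1)) :
    |stateStep f₁ f₂ x v i - stateStep f₁ f₂ x w i|
      ≤ (pastCompanion a₁ a₂ x).mulVec (fun j => |v j - w j|) i := by
  induction i using Fin.cases with
  | zero =>
    rw [pastCompanion_mulVec_zero]
    simpa [stateStep] using abs_regression_sub_le h₁ h₂ x v w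
  | succ i => rw [pastCompanion_mulVec_succ]; simp [stateStep, Fin.init]

/-- The two iterations use the same inputs over the last `n` steps and differ only in their state
`n` steps ago: one application of the recursion to `v₀` against `v₀` itself. Monotonicity of the
companion matrices carries this defect forward. -/
lemma abs_stateIter_succ_sub_le (h₁ : LipschitzInLags f₁ a₁) (h₂ : LipschitzInLags f₂ a₂)
    (v₀ : Fin (q + 1) → ℝ) (n : ℕ) (x : ℕ → E × ℝ) (i : Fin (q + 1)) :
    |stateIter f₁ f₂ v₀ (n + 1) x i - stateIter f₁ f₂ v₀ n x i|
      ≤ (cocycle tail (pastCompanion a₁ a₂) n x).mulVec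
        (fun j => |stateStep f₁ f₂ (tail^[n] x) v₀ j - v₀ j|) i := by
  induction n generalizing x i with
  | zero => simp [cocycle, stateIter]
  | succ n ih =>
    rw [cocycle_succ_mulVec]
    exact (abs_stateStep_sub_le h₁ h₂ x _ _ i).trans
      (pastCompanion_mulVec_mono x (fun i => ih (tail x) i) i)

/-- The comparison behind uniqueness: two complete trajectories with the same inputs, followed back
`n` steps. -/
lemma abs_state_sub_le (h₁ : LipschitzInLags f₁ a₁) (h₂ : LipschitzInLags f₂ a₂)
    {x : ℤ → ℕ → E × ℝ} (hx : ∀ t, tail (x t) = x (t - 1)) {v w : ℤ → Fin (q + 1) → ℝ}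
    (hv : ∀ t, v t = stateStep f₁ f₂ (x t) (v (t - 1)))
    (hw : ∀ t, w t = stateStep f₁ f₂ (x t) (w (t - 1))) (n : ℕ) (t : ℤ) (i : Fin (q + 1)) :
    |v t i - w t i| ≤ (cocycle tail (pastCompanion a₁ a₂) n (x t)).mulVec
      (fun j => |v (t - n) j - w (t - n) j|) i := by
  induction n generalizing t i with
  | zero => simp [cocycle]
  | succ n ih =>
    rw [cocycle_succ_mulVec, hv t, hw t, hx]
    refine (abs_stateStep_sub_le h₁ h₂ _ _ _ i).trans (pastCompanion_mulVec_mono _ (fun i => ?_) i)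
    have := ih (t - 1) i
    rwa [show t - 1 - (n : ℤ) = t - ((n + 1 : ℕ) : ℤ) by push_cast; ring] at this

/-- The state at time `t` is `lags (q + 1) Y (t + 1)`, whose first entry is `Y t`. The unsimplified
`t - 1 + 1` matches `v (t - 1)` in `abs_state_sub_le`. -/
lemma lags_add_one_eq_stateStep {Ω : Type*} {Z : ℤ → Ω → E} {ε : ℤ → Ω → ℝ} {Y : ℤ → Ω → ℝ} {ω : Ω}
    (hY : ∀ t, Y t ω = f₁ (lags (q + 1) Y t ω, Z (t - 1) ω)
      + ε t ω * f₂ (lags (q + 1) Y t ω, Z (t - 1) ω)) (t : ℤ) :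
    lags (q + 1) Y (t + 1) ω
      = stateStep f₁ f₂ (past (fun t ω => (Z t ω, ε t ω)) t ω) (lags (q + 1) Y (t - 1 + 1) ω) := by
  funext i
  induction i using Fin.cases with
  | zero => simp [lags, stateStep, regression, past, hY t]
  | succ i =>
    simp only [lags, stateStep, Fin.cons_succ, Fin.init, Fin.val_succ, Fin.val_castSucc]
    congr 1; push_cast; ring

lemma tendsto_stateIter_of_summable (h₁ : LipschitzInLags f₁ a₁) (h₂ : LipschitzInLags f₂ a₂)
    {v₀ : Fin (q + 1) → ℝ} {x : ℕ → E × ℝ}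
    (hx : ∀ i, Summable fun n => (cocycle tail (pastCompanion a₁ a₂) n x).mulVec
      (fun j => |stateStep f₁ f₂ (tail^[n] x) v₀ j - v₀ j|) i) :
    ∃ v : Fin (q + 1) → ℝ, Tendsto (fun n => stateIter f₁ f₂ v₀ n x) atTop (𝓝 v) := by
  have h : ∀ i, ∃ c : ℝ, Tendsto (fun n => stateIter f₁ f₂ v₀ n x i) atTop (𝓝 c) := fun i => by
    refine cauchySeq_tendsto_of_complete
      (cauchySeq_of_dist_le_of_summable _ (fun n => ?_) (hx i))
    rw [dist_comm, Real.dist_eq]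
    exact abs_stateIter_succ_sub_le h₁ h₂ v₀ n x i
  choose v hv using h
  exact ⟨v, tendsto_pi_nhds.2 hv⟩

/-- Only measurability of `f₁` and `f₂` is available in the covariate; continuity in the state comes
from the Lipschitz bound. -/
lemma tendsto_stateStep (h₁ : LipschitzInLags f₁ a₁) (h₂ : LipschitzInLags f₂ a₂)
    (x : ℕ → E × ℝ) {v : ℕ → Fin (q + 1) → ℝ} {w : Fin (q + 1) → ℝ}
    (h : Tendsto v atTop (𝓝 w)) :
    Tendsto (fun n => stateStep f₁ f₂ x (v n)) atTop (𝓝 (stateStep f₁ f₂ x w)) := by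
  refine tendsto_pi_nhds.2 fun i => tendsto_iff_dist_tendsto_zero.2 ?_
  have h3 : Tendsto (fun n => (pastCompanion a₁ a₂ x).mulVec (fun j => |v n j - w j|) i) atTop
      (𝓝 0) := by
    have h4 : ∀ j, Tendsto (fun n => |v n j - w j|) atTop (𝓝 0) := fun j => by
      have := (tendsto_pi_nhds.1 h j).sub_const (w j)
      simpa using this.abs
    have := tendsto_finsetSum Finset.univ fun j _ => (h4 j).const_mul (pastCompanion a₁ a₂ x i j)
    simpa [Matrix.mulVec, dotProduct] using this
  exact squeeze_zero (fun _ => dist_nonneg)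
    (fun n => by rw [Real.dist_eq]; exact abs_stateStep_sub_le h₁ h₂ x _ _ i) h3

variable [MeasurableSpace E]

lemma measurable_regression (hf₁ : Measurable f₁) (hf₂ : Measurable f₂) {X : Type*}
    [MeasurableSpace X] {x : X → ℕ → E × ℝ} {v : X → Fin (q + 1) → ℝ}
    (hx1 : Measurable fun y => (x y 1).1) (hx0 : Measurable fun y => (x y 0).2)
    (hv : Measurable v) :
    Measurable fun y => regression f₁ f₂ (x y) (v y) := by
  unfold regression
  exact (hf₁.comp (hv.prodMk hx1)).add (hx0.mul (hf₂.comp (hv.prodMk hx1)))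

lemma measurable_stateStep (hf₁ : Measurable f₁) (hf₂ : Measurable f₂) {X : Type*}
    [MeasurableSpace X] {x : X → ℕ → E × ℝ} {v : X → Fin (q + 1) → ℝ}
    (hx1 : Measurable fun y => (x y 1).1) (hx0 : Measurable fun y => (x y 0).2)
    (hv : Measurable v) :
    Measurable fun y => stateStep f₁ f₂ (x y) (v y) := by
  refine measurable_pi_lambda _ fun i => ?_
  induction i using Fin.cases with
  | zero => simpa [stateStep] using measurable_regression hf₁ hf₂ hx1 hx0 hv
  | succ i => simpa [stateStep, Fin.init] using measurable_pi_iff.1 hv i.castSucc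

lemma measurable_stateIter (hf₁ : Measurable f₁) (hf₂ : Measurable f₂) (v₀ : Fin (q + 1) → ℝ)
    (n : ℕ) : Measurable (stateIter f₁ f₂ v₀ n) := by
  induction n with
  | zero => exact measurable_const
  | succ n ih =>
    exact measurable_stateStep hf₁ hf₂ (measurable_fst.comp (measurable_pi_apply 1))
      (measurable_snd.comp (measurable_pi_apply 0)) (ih.comp measurable_tail)

/-- Taking a `limsup` keeps `stateLimit` total and measurable without singling out the set of
convergence. -/
lemma measurable_stateLimit (hf₁ : Measurable f₁) (hf₂ : Measurable f₂) (v₀ : Fin (q + 1) → ℝ) :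
    Measurable (stateLimit f₁ f₂ v₀) :=
  Measurable.limsup fun n => (measurable_pi_apply 0).comp (measurable_stateIter hf₁ hf₂ v₀ n)

lemma measurable_lagCoeff (ha₁ : ∀ i, Measurable (a₁ i)) (ha₂ : ∀ i, Measurable (a₂ i))
    (j : Fin (q + 1)) : Measurable fun x => lagCoeff a₁ a₂ x j := by
  unfold lagCoeff
  have h1 : Measurable fun x : ℕ → E × ℝ => (x 1).1 := measurable_fst.comp (measurable_pi_apply 1)
  have h0 : Measurable fun x : ℕ → E × ℝ => (x 0).2 := measurable_snd.comp (measurable_pi_apply 0)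
  exact ((ha₁ j).comp h1).coe_nnreal_real.add
    (((ha₂ j).comp h1).coe_nnreal_real.mul h0.abs)

lemma measurable_pastCompanion (ha₁ : ∀ i, Measurable (a₁ i)) (ha₂ : ∀ i, Measurable (a₂ i))
    (i j : Fin (q + 1)) : Measurable fun x => pastCompanion a₁ a₂ x i j := by
  simp only [pastCompanion, Matrix.of_apply]
  split_ifs
  · exact measurable_lagCoeff ha₁ ha₂ j
  · exact measurable_const
  · exact measurable_const

lemma measurable_cocycle (ha₁ : ∀ i, Measurable (a₁ i)) (ha₂ : ∀ i, Measurable (a₂ i))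
    (n : ℕ) (i j : Fin (q + 1)) :
    Measurable fun x => cocycle tail (pastCompanion a₁ a₂) n x i j := by
  induction n generalizing i j with
  | zero => exact measurable_const
  | succ n ih =>
    simp only [cocycle, Matrix.mul_apply]
    exact Finset.measurable_sum _ fun k _ =>
      (measurable_pastCompanion ha₁ ha₂ i k).mul ((ih k j).comp measurable_tail)

end State

/-! ### Law of the lag vector. -/

section Lags

variable {Ω : Type*} [MeasurableSpace Ω] {μ : Measure Ω}

lemma measurable_lags {q : ℕ} {Y : ℤ → Ω → ℝ} (hY : ∀ t, Measurable (Y t)) (t : ℤ) :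
    Measurable (lags q Y t) :=
  measurable_pi_lambda _ fun _ => hY _

lemma IsStationary.map_lags {q : ℕ} {Y : ℤ → Ω → ℝ} (hY : IsStationary μ Y) (t t' : ℤ) :
    μ.map (lags q Y t) = μ.map (lags q Y t') := by
  have hm : Measurable fun (x : ℕ → ℝ) (i : Fin q) => x i :=
    measurable_pi_lambda _ fun _ => measurable_pi_apply _
  have h1 : ∀ k, μ.map (lags q Y k) = (μ.map (past Y 0)).map fun x (i : Fin q) => x i := by
    intro k
    rw [← hY.map_past (k - 1), Measure.map_map hm (measurable_past hY.measurable _)]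
    rfl
  rw [h1, h1]

end Lags

/-! ### Uniqueness among stationary solutions. -/

section Uniqueness

variable {Ω : Type*} [MeasurableSpace Ω] {μ : Measure Ω}

/-- A random variable dominated by the product of a sequence tending to `0` and of a tight
sequence is nonpositive. -/
lemma ae_nonpos_of_le_mul {D : Ω → ℝ} {r N : ℕ → Ω → ℝ} {φ : ℕ → ℝ≥0∞}
    (hr : ∀ᵐ ω ∂μ, Tendsto (fun n => r n ω) atTop (𝓝 0)) (hr0 : ∀ n ω, 0 ≤ r n ω)
    (hN : ∀ (K n : ℕ), μ {ω | (K : ℝ) < N n ω} ≤ φ K) (hφ : Tendsto φ atTop (𝓝 0))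
    (hD : ∀ᵐ ω ∂μ, ∀ n, D ω ≤ r n ω * N n ω) : ∀ᵐ ω ∂μ, D ω ≤ 0 := by
  have key : ∀ K : ℕ, μ {ω | ¬ D ω ≤ 0} ≤ φ K := by
    intro K
    -- Where `D > 0`, convergence gives `r n * K < D` from some rank on, and then `D ≤ r n * N n`
    -- forces `N n > K`. So this event lies in the increasing union of the `s m`, of measure at most
    -- `φ K`.
    set s : ℕ → Set Ω := fun m => {ω | ∀ n, m ≤ n → (K : ℝ) < N n ω} with hs
    have hmono : Monotone s := fun a b hab ω hω n hn => hω n (hab.trans hn)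
    have h1 : μ (⋃ m, s m) ≤ φ K := by
      rw [hmono.measure_iUnion]
      exact iSup_le fun m => (measure_mono fun ω (hω : ∀ n, m ≤ n → (K : ℝ) < N n ω) => hω m le_rfl).trans (hN K m)
    refine (measure_mono_ae ?_).trans h1
    filter_upwards [hr, hD] with ω hrω hDω hpos
    have hpos' : 0 < D ω := not_le.1 hpos
    have h2 : Tendsto (fun n => r n ω * K) atTop (𝓝 0) := by simpa using hrω.mul_const (K : ℝ)
    obtain ⟨m, hm⟩ := eventually_atTop.1 (h2.eventually_lt_const hpos')
    refine Set.mem_iUnion.2 ⟨m, fun n hn => ?_⟩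
    by_contra hcon
    have := (hDω n).trans (mul_le_mul_of_nonneg_left (not_lt.1 hcon) (hr0 n ω))
    exact absurd (hm n hn) (not_lt.2 this)
  exact le_antisymm (ge_of_tendsto' hφ key) bot_le

variable [IsProbabilityMeasure μ]

lemma tendsto_measure_norm_gt {M : Type*} [NormedAddCommGroup M] [MeasurableSpace M]
    [OpensMeasurableSpace M] {f : Ω → M} (hf : Measurable f) :
    Tendsto (fun K : ℕ => μ {ω | (K : ℝ) < ‖f ω‖}) atTop (𝓝 0) := by
  have h0 : ⋂ K : ℕ, {ω | (K : ℝ) < ‖f ω‖} = ∅ := by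
    ext ω
    simp only [Set.mem_iInter, Set.mem_ofPred_eq, Set.mem_empty_iff_false, iff_false, not_forall,
      not_lt]
    exact exists_nat_ge _
  have := tendsto_measure_iInter_atTop (μ := μ) (s := fun K : ℕ => {ω | (K : ℝ) < ‖f ω‖})
    (fun K => (measurableSet_lt measurable_const hf.norm).nullMeasurableSet)
    (fun a b hab ω hω => lt_of_le_of_lt (by exact_mod_cast hab : (a : ℝ) ≤ b) hω)
    ⟨0, measure_ne_top _ _⟩
  rwa [h0, measure_empty] at this

variable {E : Type*} {q : ℕ}
  {f₁ f₂ : (Fin (q + 1) → ℝ) × E → ℝ} {a₁ a₂ : Fin (q + 1) → E → ℝ≥0}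
  {Z : ℤ → Ω → E} {ε : ℤ → Ω → ℝ}

/-- The difference at time `t` is at most a vanishing coefficient times the norms of both lag
vectors `n` steps ago. Their marginal laws do not depend on `n`, which gives tightness; neither a
moment nor joint stationarity is needed. -/
lemma IsSolution.ae_eq (h₁ : LipschitzInLags f₁ a₁) (h₂ : LipschitzInLags f₂ a₂)
    (hzero : ∀ t, ∀ᵐ ω ∂μ, Tendsto (fun n => (cocycle tail (pastCompanion a₁ a₂) n
      (past (fun t ω => (Z t ω, ε t ω)) t ω)).mulVec (fun _ => 1) 0) atTop (𝓝 0))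
    {Y Y' : ℤ → Ω → ℝ} (hY : IsStationary μ Y) (hY' : IsStationary μ Y')
    (hYs : IsSolution μ f₁ f₂ Z ε Y) (hYs' : IsSolution μ f₁ f₂ Z ε Y') (t : ℤ) :
    Y' t =ᵐ[μ] Y t := by
  -- The factor `2` is there because a sum of two norms above `K` requires one of them to exceed `K
  -- / 2`.
  set φ : ℕ → ℝ≥0∞ := fun K => μ {ω | (K : ℝ) < 2 * ‖lags (q + 1) Y' 0 ω‖}
    + μ {ω | (K : ℝ) < 2 * ‖lags (q + 1) Y 0 ω‖} with hφ
  have hφ0 : Tendsto φ atTop (𝓝 0) := by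
    have h := fun (X : ℤ → Ω → ℝ) (hX : IsStationary μ X) =>
      tendsto_measure_norm_gt (μ := μ) ((measurable_lags (q := q + 1) hX.measurable 0).const_smul
        (2 : ℝ))
    simpa [hφ, norm_smul] using (h Y' hY').add (h Y hY)
  have htail : ∀ (X : ℤ → Ω → ℝ), IsStationary μ X → ∀ (K n : ℕ),
      μ {ω | (K : ℝ) < 2 * ‖lags (q + 1) X (t - n + 1) ω‖}
        = μ {ω | (K : ℝ) < 2 * ‖lags (q + 1) X 0 ω‖} := by
    intro X hX K n
    have hs : MeasurableSet {v : Fin (q + 1) → ℝ | (K : ℝ) < 2 * ‖v‖} :=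
      measurableSet_lt measurable_const (measurable_norm.const_mul _)
    have := congrArg (fun m => m {v : Fin (q + 1) → ℝ | (K : ℝ) < 2 * ‖v‖})
      (hX.map_lags (q := q + 1) (t - n + 1) 0)
    simpa only [Measure.map_apply (measurable_lags hX.measurable _) hs] using! this
  have h := ae_nonpos_of_le_mul (μ := μ) (D := fun ω => |Y' t ω - Y t ω|)
    (r := fun n ω => (cocycle tail (pastCompanion a₁ a₂) n
      (past (fun t ω => (Z t ω, ε t ω)) t ω)).mulVec (fun _ => 1) 0)
    (N := fun n ω => ‖lags (q + 1) Y' (t - n + 1) ω‖ + ‖lags (q + 1) Y (t - n + 1) ω‖) (φ := φ)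
    (hzero t) (fun n ω => cocycle_mulVec_nonneg _ _ (fun _ => zero_le_one) _) ?_ hφ0 ?_
  · filter_upwards [h] with ω hω
    exact sub_eq_zero.1 (abs_nonpos_iff.1 hω)
  · intro K n
    rw [hφ]
    simp only
    rw [← htail Y' hY' K n, ← htail Y hY K n]
    refine (measure_mono fun ω hω => ?_).trans (measure_union_le _ _)
    by_contra hcon
    simp only [Set.mem_union, Set.mem_ofPred_eq, not_or, not_lt] at hcon hω
    linarith [hcon.1, hcon.2]
  · filter_upwards [ae_all_iff.2 hYs, ae_all_iff.2 hYs'] with ω hω hω' n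
    have h3 := abs_state_sub_le h₁ h₂ (x := fun t => past (fun t ω => (Z t ω, ε t ω)) t ω)
      (fun t => tail_past _ _ _) (v := fun t => lags (q + 1) Y' (t + 1) ω)
      (w := fun t => lags (q + 1) Y (t + 1) ω) (lags_add_one_eq_stateStep hω')
      (lags_add_one_eq_stateStep hω) n t 0
    have h4 : ∀ X : ℤ → Ω → ℝ, lags (q + 1) X (t + 1) ω 0 = X t ω := fun X => by simp [lags]
    simp only [h4] at h3
    refine h3.trans ?_
    set c := ‖lags (q + 1) Y' (t - n + 1) ω‖ + ‖lags (q + 1) Y (t - n + 1) ω‖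
    have h5 : ∀ i, |lags (q + 1) Y' (t - n + 1) ω i - lags (q + 1) Y (t - n + 1) ω i|
        ≤ (c • fun _ : Fin (q + 1) => (1 : ℝ)) i := by
      intro i
      simp only [Pi.smul_apply, smul_eq_mul, mul_one]
      exact (abs_sub _ _).trans (add_le_add
        (norm_le_pi_norm (lags (q + 1) Y' (t - n + 1) ω) i)
        (norm_le_pi_norm (lags (q + 1) Y (t - n + 1) ω) i))
    refine (cocycle_mulVec_mono n _ h5 0).trans (le_of_eq ?_)
    rw [Matrix.mulVec_smul]
    simp [mul_comm]

end Uniqueness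

/-! ### The limit of the recursion is a solution. -/

section Existence

variable {Ω : Type*} [MeasurableSpace Ω] {μ : Measure Ω}
  {E : Type*} {q : ℕ}
  {f₁ f₂ : (Fin (q + 1) → ℝ) × E → ℝ} {a₁ a₂ : Fin (q + 1) → E → ℝ≥0}
  {Z : ℤ → Ω → E} {ε : ℤ → Ω → ℝ}

/-- The full limiting states satisfy the recursion by continuity. Its lower rows are pure shifts, so
coordinate `i` of a limiting state is the first coordinate `i` steps earlier; the limiting state is
thus the lag vector of the limit process. -/
lemma isSolution_stateLimit (h₁ : LipschitzInLags f₁ a₁) (h₂ : LipschitzInLags f₂ a₂)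
    {v₀ : Fin (q + 1) → ℝ}
    (hsum : ∀ t, ∀ᵐ ω ∂μ, ∃ v : Fin (q + 1) → ℝ, Tendsto (fun n => stateIter f₁ f₂ v₀ n
      (past (fun t ω => (Z t ω, ε t ω)) t ω)) atTop (𝓝 v)) :
    IsSolution μ f₁ f₂ Z ε
      fun t ω => stateLimit f₁ f₂ v₀ (past (fun t ω => (Z t ω, ε t ω)) t ω) := by
  intro t
  filter_upwards [ae_all_iff.2 hsum] with ω hω
  choose v hv using hω
  set x : ℤ → ℕ → E × ℝ := fun t => past (fun t ω => (Z t ω, ε t ω)) t ω with hx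
  have hstep : ∀ t, v t = stateStep f₁ f₂ (x t) (v (t - 1)) := by
    intro t
    refine tendsto_nhds_unique ((hv t).comp (tendsto_add_atTop_nat 1)) ?_
    have h3 := tendsto_stateStep h₁ h₂ (x t) (hv (t - 1))
    refine h3.congr fun n => ?_
    simp only [Function.comp, stateIter, hx, tail_past]
  have hlim : ∀ t, stateLimit f₁ f₂ v₀ (x t) = v t 0 := fun t =>
    (tendsto_pi_nhds.1 (hv t) 0).limsup_eq
  have hlag : ∀ (i : Fin (q + 1)) (t : ℤ), v t i = stateLimit f₁ f₂ v₀ (x (t - (i : ℤ))) := by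
    intro i
    induction i using Fin.induction with
    | zero => intro t; simp [hlim]
    | succ i ih =>
      intro t
      rw [hstep t]
      simp only [stateStep, Fin.cons_succ, Fin.init]
      rw [ih]
      congr 2
      simp only [Fin.val_succ, Fin.val_castSucc]; push_cast; ring
  have hl : lags (q + 1) (fun t ω => stateLimit f₁ f₂ v₀
      (past (fun t ω => (Z t ω, ε t ω)) t ω)) t ω = v (t - 1) := by
    funext i
    rw [hlag]; rfl
  rw [hl]
  change stateLimit f₁ f₂ v₀ (x t) = _
  rw [hlim, hstep]
  simp [stateStep, regression, hx, past]

end Existence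

/-! ### Truncating logarithms whose expectation may be minus infinity. -/

section LogExpectation

lemma toENNReal_log_ofReal {y : ℝ} (hy : 0 ≤ y) :
    (ENNReal.log (ENNReal.ofReal y)).toENNReal = ENNReal.ofReal (Real.posLog y) := by
  rcases hy.eq_or_lt with rfl | hy
  · simp
  · rw [ENNReal.log_ofReal_of_pos hy, EReal.real_coe_toENNReal, Real.posLog]
    simp [ENNReal.ofReal_max]

/-- The floor `exp (-c)` keeps the logarithm finite at `y = 0`; letting `c` grow restores the full
negative part, in the form required by monotone convergence. -/
lemma iSup_ofReal_neg_log_max {y : ℝ} (hy : 0 ≤ y) :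
    (-ENNReal.log (ENNReal.ofReal y)).toENNReal
      = ⨆ c : ℕ, ENNReal.ofReal (-Real.log (max y (Real.exp (-c)))) := by
  rcases hy.eq_or_lt with rfl | hy
  · have : ∀ c : ℕ, ENNReal.ofReal (-Real.log (max 0 (Real.exp (-c)))) = (c : ℝ≥0∞) := fun c => by
      rw [max_eq_right (Real.exp_pos _).le, Real.log_exp, neg_neg, ENNReal.ofReal_natCast]
    simp [this, ENNReal.iSup_natCast]
  · rw [ENNReal.log_ofReal_of_pos hy, ← EReal.coe_neg, EReal.real_coe_toENNReal]
    refine le_antisymm ?_ (iSup_le fun c => ?_)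
    · obtain ⟨c, hc⟩ := exists_nat_ge (-Real.log y)
      refine le_iSup_of_le c (le_of_eq ?_)
      rw [max_eq_left]
      rw [← Real.exp_log hy]
      exact Real.exp_le_exp.2 (by linarith)
    · exact ENNReal.ofReal_le_ofReal (neg_le_neg (Real.log_le_log hy (le_max_left _ _)))

/-- A floor at most `1` leaves the positive part of the logarithm untouched. -/
lemma ofReal_log_max_exp_neg {y : ℝ} (hy : 0 ≤ y) (c : ℕ) :
    ENNReal.ofReal (Real.log (max y (Real.exp (-c)))) = ENNReal.ofReal (Real.posLog y) := by
  have hc : Real.exp (-c) ≤ 1 := Real.exp_le_one_iff.2 (by simp)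
  rcases le_total 1 y with h | h
  · rw [max_eq_left (hc.trans h), Real.posLog_eq_log (by rwa [abs_of_nonneg hy])]
  · rw [(Real.posLog_eq_zero_iff y).2 (by rwa [abs_of_nonneg hy]), ENNReal.ofReal_zero,
      ENNReal.ofReal_eq_zero]
    exact Real.log_nonpos (le_max_of_le_left hy) (max_le h hc)

lemma coe_sub_coe_of_ne_top {a b : ℝ≥0∞} (ha : a ≠ ⊤) (hb : b ≠ ⊤) :
    (a : EReal) - (b : EReal) = ((a.toReal - b.toReal : ℝ) : EReal) := by
  lift a to ℝ≥0 using ha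
  lift b to ℝ≥0 using hb
  rfl

/-- Replaces an extended-valued expectation by an integral to which the ergodic argument applies.
The floor changes only the negative part, whose integrals increase to the full one. -/
lemma exists_integral_log_max_lt {X : Type*} [MeasurableSpace X] {ν : Measure X}
    [IsProbabilityMeasure ν] {y : X → ℝ} (hym : Measurable y) (hy : ∀ x, 0 ≤ y x)
    (hint : Integrable (fun x => Real.posLog (y x)) ν) {κ : ℝ}
    (h : expectation ν (fun x => ENNReal.log (ENNReal.ofReal (y x))) < (-κ : ℝ)) :
    ∃ c : ℕ, Integrable (fun x => Real.log (max (y x) (Real.exp (-c)))) ν ∧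
      ∫ x, Real.log (max (y x) (Real.exp (-c))) ∂ν < -κ := by
  set b : ℕ → ℝ≥0∞ := fun c => ∫⁻ x, ENNReal.ofReal (-Real.log (max (y x) (Real.exp (-c)))) ∂ν
  set a : ℝ≥0∞ := ∫⁻ x, ENNReal.ofReal (Real.posLog (y x)) ∂ν with ha
  have hmeas : ∀ c : ℕ, Measurable fun x => Real.log (max (y x) (Real.exp (-c))) := fun c =>
    (hym.max measurable_const).log
  have hmono : Monotone fun (c : ℕ) x => ENNReal.ofReal (-Real.log (max (y x) (Real.exp (-c)))) := by
    intro c d hcd x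
    refine ENNReal.ofReal_le_ofReal (neg_le_neg (Real.log_le_log
      (lt_max_of_lt_right (Real.exp_pos _)) (max_le_max le_rfl (Real.exp_le_exp.2 ?_))))
    exact neg_le_neg (by exact_mod_cast hcd)
  have hbc : ∀ c : ℕ, b c ≤ c := by
    intro c
    calc b c ≤ ∫⁻ _, (c : ℝ≥0∞) ∂ν := by
          refine lintegral_mono fun x => ?_
          rw [← ENNReal.ofReal_natCast]
          refine ENNReal.ofReal_le_ofReal ?_
          have := Real.log_le_log (Real.exp_pos _) (le_max_right (y x) (Real.exp (-c)))
          rw [Real.log_exp] at this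
          linarith
      _ = c := by simp
  have ha_top : a ≠ ⊤ := by
    have := hint.lintegral_lt_top
    exact this.ne
  have hexp : expectation ν (fun x => ENNReal.log (ENNReal.ofReal (y x)))
      = (a : EReal) - ((⨆ c, b c : ℝ≥0∞) : EReal) := by
    unfold expectation
    simp only [toENNReal_log_ofReal (hy _), iSup_ofReal_neg_log_max (hy _)]
    rw [lintegral_iSup (f := fun (c : ℕ) x => ENNReal.ofReal
      (-Real.log (max (y x) (Real.exp (-c))))) (fun c => (hmeas c).neg.ennreal_ofReal) hmono]
  rw [hexp] at h
  have hbt : ∀ c, b c ≠ ⊤ := fun c => ne_top_of_le_ne_top (ENNReal.natCast_ne_top c) (hbc c)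
  -- If every truncated mean were at least `-κ`, the negative parts would stay below `a + κ`. Their
  -- supremum would be finite, and the extended subtraction in `h` would become a real one, with a
  -- contradiction.
  have hex : ∃ c, a.toReal - (b c).toReal < -κ := by
    by_contra! hcon
    have hs : (⨆ c, b c) ≤ ENNReal.ofReal (a.toReal + κ) := iSup_le fun c => by
      rw [← ENNReal.ofReal_toReal (hbt c)]
      exact ENNReal.ofReal_le_ofReal (by linarith [hcon c])
    have h0 : 0 ≤ a.toReal + κ := by
      linarith [hcon 0, ENNReal.toReal_nonneg (a := b 0)]
    have hst : (⨆ c, b c) ≠ ⊤ := ne_top_of_le_ne_top ENNReal.ofReal_ne_top hs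
    rw [coe_sub_coe_of_ne_top ha_top hst] at h
    have h3 : a.toReal - (⨆ c, b c).toReal < -κ := by exact_mod_cast h
    rw [← ENNReal.ofReal_toReal hst, ENNReal.ofReal_le_ofReal_iff h0] at hs
    linarith
  obtain ⟨c, hc⟩ := hex
  have hi : Integrable (fun x => Real.log (max (y x) (Real.exp (-c)))) ν := by
    refine (hint.add (integrable_const (c : ℝ))).mono' (hmeas c).aestronglyMeasurable
      (Eventually.of_forall fun x => ?_)
    have h1 := Real.log_le_log (Real.exp_pos _) (le_max_right (y x) (Real.exp (-c)))
    rw [Real.log_exp] at h1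
    have h2 : Real.log (max (y x) (Real.exp (-c))) ≤ Real.posLog (y x) := by
      have := ofReal_log_max_exp_neg (hy x) c
      by_contra hcon
      have h3 := (ENNReal.ofReal_lt_ofReal_iff
        (lt_of_le_of_lt Real.posLog_nonneg (not_le.1 hcon))).2 (not_le.1 hcon)
      exact absurd this h3.ne'
    have h3 : (0 : ℝ) ≤ Real.posLog (y x) := Real.posLog_nonneg
    have h4 : (0 : ℝ) ≤ c := Nat.cast_nonneg c
    rw [Real.norm_eq_abs, abs_le]
    simp only [Pi.add_apply]
    constructor <;> linarith
  refine ⟨c, hi, ?_⟩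
  rw [integral_eq_lintegral_pos_part_sub_lintegral_neg_part hi]
  simp only [ofReal_log_max_exp_neg (hy _)]
  exact hc

lemma expectation_comp {Ω X : Type*} [MeasurableSpace Ω] [MeasurableSpace X] {μ : Measure Ω}
    {ν : Measure X} {g : Ω → X} (hg : MeasurePreserving g μ ν) {F : X → EReal}
    (hF : Measurable F) : expectation μ (fun ω => F (g ω)) = expectation ν F := by
  unfold expectation
  rw [hg.lintegral_comp hF.ereal_toENNReal,
    hg.lintegral_comp (f := fun x => (-F x).toENNReal) hF.neg.ereal_toENNReal]

end LogExpectation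

/-! ### Equivalence of norms in finite dimension. -/

section Seminorm

variable {M : Type*} [NormedAddCommGroup M] [NormedSpace ℝ M] [FiniteDimensional ℝ M]

lemma continuous_seminorm (N : Seminorm ℝ M) : Continuous N :=
  (N.convexOn.locallyLipschitz).continuous

lemma exists_norm_le_mul_seminorm (N : Seminorm ℝ M) (hN : ∀ x, N x = 0 → x = 0) :
    ∃ K : ℝ, 1 ≤ K ∧ ∀ x, ‖x‖ ≤ K * N x := by
  -- The unit sphere is empty exactly when the space is trivial; otherwise the minimum of `N` on it
  -- is positive.
  rcases (Metric.sphere (0 : M) 1).eq_empty_or_nonempty with he | hne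
  · refine ⟨1, le_rfl, fun x => ?_⟩
    by_cases hx : x = 0
    · simp [hx]
    · exfalso
      have : (‖x‖⁻¹ • x) ∈ Metric.sphere (0 : M) 1 := by
        simp [norm_smul, norm_ne_zero_iff.2 hx]
      rw [he] at this
      exact this
  · obtain ⟨x₀, hx₀, hmin⟩ := (isCompact_sphere (0 : M) 1).exists_isMinOn hne
      (continuous_seminorm N).continuousOn
    have hx₀' : x₀ ≠ 0 := by
      rintro rfl
      simp at hx₀
    have hpos : 0 < N x₀ := lt_of_le_of_ne (apply_nonneg N _) fun h => hx₀' (hN _ h.symm)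
    refine ⟨max 1 (N x₀)⁻¹, le_max_left _ _, fun x => ?_⟩
    by_cases hx : x = 0
    · simp [hx]
    · have hn : 0 < ‖x‖ := norm_pos_iff.2 hx
      have h1 : N x₀ ≤ N (‖x‖⁻¹ • x) := hmin (by simp [norm_smul, hn.ne'])
      rw [map_smul_eq_mul, norm_inv, norm_norm] at h1
      have h2 : ‖x‖ ≤ (N x₀)⁻¹ * N x := by
        rw [inv_mul_eq_div, le_div_iff₀ hpos]
        calc ‖x‖ * N x₀ ≤ ‖x‖ * (‖x‖⁻¹ * N x) := by gcongr
          _ = N x := by field_simp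
      exact h2.trans (mul_le_mul_of_nonneg_right (le_max_right _ _) (apply_nonneg N _))

lemma exists_seminorm_le_mul_norm (N : Seminorm ℝ M) : ∃ K : ℝ, 1 ≤ K ∧ ∀ x, N x ≤ K * ‖x‖ := by
  obtain ⟨C, hC, h⟩ := N.bound_of_continuous_normedSpace (continuous_seminorm N)
  exact ⟨max 1 C, le_max_left _ _, fun x =>
    (h x).trans (mul_le_mul_of_nonneg_right (le_max_right _ _) (norm_nonneg _))⟩

end Seminorm

/-! ### Part 1: decay of the products from a negative Lyapunov exponent. -/

section Decay

attribute [local instance] Matrix.linftyOpNormedRing Matrix.linftyOpNormedAlgebra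

variable {E : Type*} {q : ℕ}
  {f₁ f₂ : (Fin (q + 1) → ℝ) × E → ℝ} {a₁ a₂ : Fin (q + 1) → E → ℝ≥0}

lemma measurable_seminorm_matrix {X : Type*} [MeasurableSpace X] {n : ℕ}
    (N : Seminorm ℝ (Matrix (Fin n) (Fin n) ℝ)) {F : X → Matrix (Fin n) (Fin n) ℝ}
    (hF : ∀ i j, Measurable fun x => F x i j) : Measurable fun x => N (F x) := by
  have hc : Continuous (N.comp (Matrix.ofLinearEquiv ℝ).toLinearMap) := continuous_seminorm _
  exact hc.measurable.comp
    (measurable_pi_lambda _ fun i => measurable_pi_lambda _ fun j => hF i j)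

/-- The leftmost factor of `A_n ⋯ A_1` is the latest one, so the cocycle over `tail` has to be read
from the past at time `n`. -/
lemma matProd_eq_cocycle {Ω : Type*} (Z : ℤ → Ω → E) (ε : ℤ → Ω → ℝ) (n : ℕ) (ω : Ω) :
    matProd (fun t => companion a₁ a₂ Z ε t ω) n
      = cocycle tail (pastCompanion a₁ a₂) n (past (fun t ω => (Z t ω, ε t ω)) n ω) := by
  induction n with
  | zero => rfl
  | succ n ih =>
    rw [matProd, ih]
    simp only [cocycle, pastCompanion_past, tail_past]
    congr 3
    push_cast; ring

lemma posLog_norm_cocycle_le {X A : Type*} [NormedRing A] (τ : X → X) (B : X → A) (n : ℕ) (x : X) :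
    Real.posLog ‖cocycle τ B n x‖
      ≤ Real.posLog ‖(1 : A)‖ + birkhoffSum τ (fun x => Real.posLog ‖B x‖) n x := by
  induction n generalizing x with
  | zero => simp [cocycle]
  | succ n ih =>
    rw [birkhoffSum_succ', cocycle]
    have h1 := Real.posLog_le_posLog (norm_nonneg _)
      (norm_mul_le (B x) (cocycle τ B n (τ x)))
    have h2 := Real.posLog_mul (x := ‖B x‖) (y := ‖cocycle τ B n (τ x)‖)
    linarith [ih (τ x)]

lemma cocycle_mulVec_le_norm (n : ℕ) (x : ℕ → E × ℝ) (u : Fin (q + 1) → ℝ) (i : Fin (q + 1)) :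
    (cocycle tail (pastCompanion a₁ a₂) n x).mulVec u i
      ≤ ‖cocycle tail (pastCompanion a₁ a₂) n x‖ * ‖u‖ :=
  (le_abs_self _).trans ((norm_le_pi_norm ((cocycle tail (pastCompanion a₁ a₂) n x).mulVec u)
    i).trans (Matrix.linfty_opNorm_mulVec _ _))

lemma tendsto_cocycle_mulVec_one {x : ℕ → E × ℝ} {δ : ℝ} (hδ : 0 < δ)
    (h : ∀ᶠ n : ℕ in atTop, ‖cocycle tail (pastCompanion a₁ a₂) n x‖ ≤ Real.exp (-δ * n)) :
    Tendsto (fun n => (cocycle tail (pastCompanion a₁ a₂) n x).mulVec (fun _ => 1) 0) atTop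
      (𝓝 0) := by
  have h0 : Tendsto (fun n : ℕ => Real.exp (-δ * n) * ‖fun _ : Fin (q + 1) => (1 : ℝ)‖) atTop
      (𝓝 0) := by
    have : Tendsto (fun n : ℕ => Real.exp (-δ * n)) atTop (𝓝 0) :=
      Real.tendsto_exp_atBot.comp
        (tendsto_natCast_atTop_atTop.const_mul_atTop_of_neg (by linarith))
    simpa using this.mul_const ‖fun _ : Fin (q + 1) => (1 : ℝ)‖
  refine tendsto_of_tendsto_of_tendsto_of_le_of_le' tendsto_const_nhds h0
    (Eventually.of_forall fun n => cocycle_mulVec_nonneg _ _ (fun _ => zero_le_one) _) ?_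
  filter_upwards [h] with n hn
  exact (cocycle_mulVec_le_norm n x _ 0).trans (mul_le_mul_of_nonneg_right hn (norm_nonneg _))

lemma norm_abs_stateStep_sub_le (x : ℕ → E × ℝ) (v₀ : Fin (q + 1) → ℝ) :
    ‖fun j => |stateStep f₁ f₂ x v₀ j - v₀ j|‖ ≤ |regression f₁ f₂ x v₀| + 2 * ‖v₀‖ := by
  refine (pi_norm_le_iff_of_nonneg (by positivity)).2 fun j => ?_
  rw [Real.norm_eq_abs, abs_abs]
  have h1 : |v₀ j| ≤ ‖v₀‖ := norm_le_pi_norm v₀ j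
  refine (abs_sub _ _).trans ?_
  induction j using Fin.cases with
  | zero =>
    simp only [stateStep, Fin.cons_zero]
    linarith [norm_nonneg v₀]
  | succ j =>
    simp only [stateStep, Fin.cons_succ, Fin.init]
    have h2 : |v₀ j.castSucc| ≤ ‖v₀‖ := norm_le_pi_norm v₀ j.castSucc
    linarith [abs_nonneg (regression f₁ f₂ x v₀)]

/-- The product decays at rate `δ` and the defect grows at rate at most `δ / 2`, which leaves a
geometric series of rate `δ / 2`. -/
lemma summable_cocycle_mulVec {x : ℕ → E × ℝ} {v₀ : Fin (q + 1) → ℝ} {δ : ℝ} (hδ : 0 < δ)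
    (h : ∀ᶠ n : ℕ in atTop, ‖cocycle tail (pastCompanion a₁ a₂) n x‖ ≤ Real.exp (-δ * n))
    (hr : ∀ᶠ n : ℕ in atTop, Real.posLog |regression f₁ f₂ (tail^[n] x) v₀| ≤ δ / 2 * n)
    (i : Fin (q + 1)) :
    Summable fun n => (cocycle tail (pastCompanion a₁ a₂) n x).mulVec
      (fun j => |stateStep f₁ f₂ (tail^[n] x) v₀ j - v₀ j|) i := by
  have hs : Summable fun n : ℕ => Real.exp (n * (-(δ / 2))) * (1 + 2 * ‖v₀‖) :=
    (Real.summable_exp_nat_mul_iff.2 (by linarith)).mul_right _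
  refine summable_of_isBigO_nat hs (Asymptotics.IsBigO.of_bound 1 ?_)
  filter_upwards [h, hr] with n hn hrn
  rw [Real.norm_of_nonneg (cocycle_mulVec_nonneg _ _ (fun _ => abs_nonneg _) _), one_mul,
    Real.norm_of_nonneg (by positivity)]
  refine (cocycle_mulVec_le_norm n x _ i).trans ?_
  have h1 : |regression f₁ f₂ (tail^[n] x) v₀| ≤ Real.exp (δ / 2 * n) := by
    have := norm_le_exp_posLog |regression f₁ f₂ (tail^[n] x) v₀|
    rw [Real.norm_eq_abs, abs_abs] at this
    exact this.trans (Real.exp_le_exp.2 hrn)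
  have h2 : (1 : ℝ) ≤ Real.exp (δ / 2 * n) := Real.one_le_exp (by positivity)
  calc _ ≤ Real.exp (-δ * n) * (Real.exp (δ / 2 * n) * (1 + 2 * ‖v₀‖)) := by
        refine mul_le_mul hn ((norm_abs_stateStep_sub_le _ _).trans ?_) (norm_nonneg _)
          (Real.exp_pos _).le
        nlinarith [norm_nonneg v₀]
    _ = Real.exp (n * (-(δ / 2))) * (1 + 2 * ‖v₀‖) := by
        rw [← mul_assoc, ← Real.exp_add]
        congr 2; ring

variable [MeasurableSpace E] {Ω : Type*} [MeasurableSpace Ω] {μ : Measure Ω}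
  [IsProbabilityMeasure μ] {Z : ℤ → Ω → E} {ε : ℤ → Ω → ℝ}

/-- A negative Lyapunov exponent forces the exponential decay of the products of the companion
matrices. -/
lemma ae_cocycle_le_exp_of_lyapunovExponent_neg
    (hZε : IsStationaryErgodic μ fun t ω => (Z t ω, ε t ω))
    (ha₁ : ∀ i, Measurable (a₁ i)) (ha₂ : ∀ i, Measurable (a₂ i))
    (N : Seminorm ℝ (Matrix (Fin (q + 1)) (Fin (q + 1)) ℝ)) (hN : ∀ M, N M = 0 → M = 0)
    (hint : Integrable (fun ω => Real.posLog (N (companion a₁ a₂ Z ε 1 ω))) μ)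
    (hlyap : lyapunovExponent μ N (companion a₁ a₂ Z ε) < 0) :
    ∀ᵐ x ∂(μ.map (past (fun t ω => (Z t ω, ε t ω)) 0)), ∃ δ > 0, ∀ᶠ n : ℕ in atTop,
      ‖cocycle tail (pastCompanion a₁ a₂) n x‖ ≤ Real.exp (-δ * n) := by
  set W : ℤ → Ω → E × ℝ := fun t ω => (Z t ω, ε t ω) with hW
  set ν := μ.map (past W 0) with hν
  set B : (ℕ → E × ℝ) → Matrix (Fin (q + 1)) (Fin (q + 1)) ℝ := pastCompanion a₁ a₂ with hB
  have hp := hZε.measurePreserving_past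
  have : IsProbabilityMeasure ν :=
    Measure.isProbabilityMeasure_map (measurable_past hZε.measurable 0).aemeasurable
  have hcm : ∀ n, Measurable fun x => N (cocycle tail B n x) := fun n =>
    measurable_seminorm_matrix N fun i j => measurable_cocycle ha₁ ha₂ n i j
  have hBN : Measurable fun x => N (B x) :=
    measurable_seminorm_matrix N fun i j => measurable_pastCompanion ha₁ ha₂ i j
  have hBm : Measurable fun x => ‖B x‖ :=
    measurable_seminorm_matrix (normSeminorm ℝ _) fun i j => measurable_pastCompanion ha₁ ha₂ i j
  have hBpm : Measurable fun x => Real.posLog ‖B x‖ := Real.continuous_posLog.measurable.comp hBm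
  obtain ⟨K, hK1, hK⟩ := exists_norm_le_mul_seminorm N hN
  obtain ⟨K', hK'1, hK'⟩ := exists_seminorm_le_mul_norm N
  have hBNi : Integrable (fun x => Real.posLog (N (B x))) ν := by
    refine ((hp 1).integrable_comp
      (Real.continuous_posLog.measurable.comp hBN).aestronglyMeasurable).1 ?_
    refine hint.congr (Eventually.of_forall fun ω => ?_)
    simp only [Function.comp, hB, hW, pastCompanion_past]
  have hBi : Integrable (fun x => Real.posLog ‖B x‖) ν := by
    refine ((integrable_const (Real.posLog K)).add hBNi).mono' hBpm.aestronglyMeasurable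
      (Eventually.of_forall fun x => ?_)
    rw [Real.norm_of_nonneg Real.posLog_nonneg]
    exact (Real.posLog_le_posLog (norm_nonneg _) (hK _)).trans Real.posLog_mul
  have hτ : Ergodic tail ν := hZε.ergodic_tail
  have hci : ∀ n, Integrable (fun x => Real.posLog (N (cocycle tail B n x))) ν := by
    intro n
    have hb : Integrable (fun x => birkhoffSum tail (fun x => Real.posLog ‖B x‖) n x) ν :=
      integrable_finsetSum _ fun i _ =>
        (hτ.toMeasurePreserving.iterate i).integrable_comp_of_integrable hBi
    refine ((integrable_const (Real.posLog K')).add ((integrable_const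
      (Real.posLog ‖(1 : Matrix (Fin (q + 1)) (Fin (q + 1)) ℝ)‖)).add hb)).mono'
      (Real.continuous_posLog.measurable.comp (hcm n)).aestronglyMeasurable
      (Eventually.of_forall fun x => ?_)
    rw [Real.norm_of_nonneg Real.posLog_nonneg]
    exact ((Real.posLog_le_posLog (apply_nonneg N _) (hK' _)).trans Real.posLog_mul).trans
      (add_le_add le_rfl (posLog_norm_cocycle_le _ _ _ _))
  obtain ⟨δ, hδ1, hδ0⟩ := EReal.exists_between_coe_real hlyap
  have hδneg : δ < 0 := by exact_mod_cast hδ0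
  have hev : ∀ᶠ n : ℕ in atTop, meanLogGrowth μ N (companion a₁ a₂ Z ε) n < (δ : EReal) :=
    eventually_lt_of_limsup_lt hδ1
  -- Passing from `N` to the operator norm costs a factor `K`. For `m ≥ log K / (-δ)` the mean `δ *
  -- m` absorbs `log K`.
  obtain ⟨n₀, hn₀⟩ := exists_nat_ge (Real.log K / (-δ))
  obtain ⟨m, hm, hm0, hm1⟩ := (hev.and ((eventually_ge_atTop n₀).and
    (eventually_ge_atTop 1))).exists
  have hmexp : expectation ν
      (fun x => ENNReal.log (ENNReal.ofReal (N (cocycle tail B m x)))) < (-Real.log K : ℝ) := by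
    rw [meanLogGrowth, EReal.div_lt_iff (by exact_mod_cast hm1)
      (by exact_mod_cast EReal.coe_ne_top (m : ℝ))] at hm
    simp only [matProd_eq_cocycle] at hm
    have h1 := expectation_comp (hp m) (F := fun x => ENNReal.log (ENNReal.ofReal
      (N (cocycle tail B m x)))) (ENNReal.measurable_log.comp (hcm m).ennreal_ofReal)
    rw [← h1]
    refine hm.trans_le ?_
    have h2 : δ * m ≤ -Real.log K := by
      have : Real.log K / (-δ) ≤ m := hn₀.trans (by exact_mod_cast hm0)
      rw [div_le_iff₀ (by linarith)] at this
      linarith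
    exact_mod_cast h2
  obtain ⟨c, hci', hcneg⟩ := exists_integral_log_max_lt (hcm m) (fun x => apply_nonneg N _)
    (hci m) hmexp
  refine exists_cocycle_le_exp hτ hBpm hBi hm1
    (η := fun x => Real.log K + Real.log (max (N (cocycle tail B m x)) (Real.exp (-c))))
    (measurable_const.add ((hcm m).max measurable_const).log)
    ((integrable_const _).add hci') ?_ fun x => ?_
  · rw [integral_add (integrable_const _) hci']
    simp only [integral_const, probReal_univ, one_smul]
    linarith
  · rw [Real.exp_add, Real.exp_log (by linarith), Real.exp_log (lt_max_of_lt_right (Real.exp_pos _))]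
    exact (hK _).trans (mul_le_mul_of_nonneg_left (le_max_left _ _) (by linarith))

/-- Existence, uniqueness and ergodicity of the stationary solution when the Lyapunov exponent is
negative. -/
theorem exists_stationary_solution_of_lyapunovExponent_neg
    (hf₁ : Measurable f₁) (hf₂ : Measurable f₂)
    (hZε : IsStationaryErgodic μ fun t ω => (Z t ω, ε t ω))
    (ha₁ : ∀ i, Measurable (a₁ i)) (ha₂ : ∀ i, Measurable (a₂ i))
    (h₁ : LipschitzInLags f₁ a₁) (h₂ : LipschitzInLags f₂ a₂)
    (N : Seminorm ℝ (Matrix (Fin (q + 1)) (Fin (q + 1)) ℝ)) (hN : ∀ M, N M = 0 → M = 0)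
    (hint : Integrable (fun ω => Real.posLog (N (companion a₁ a₂ Z ε 1 ω))) μ)
    {v₀ : Fin (q + 1) → ℝ}
    (hv₀ : Integrable (fun ω => Real.posLog |f₁ (v₀, Z 0 ω) + ε 1 ω * f₂ (v₀, Z 0 ω)|) μ)
    (hlyap : lyapunovExponent μ N (companion a₁ a₂ Z ε) < 0) :
    ∃ Y : ℤ → Ω → ℝ, IsStationary μ Y ∧ IsSolution μ f₁ f₂ Z ε Y ∧ IsStationaryErgodic μ Y ∧
      ∀ Y' : ℤ → Ω → ℝ, IsStationary μ Y' → IsSolution μ f₁ f₂ Z ε Y' → ∀ t, Y' t =ᵐ[μ] Y t := by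
  have hdecay := ae_cocycle_le_exp_of_lyapunovExponent_neg hZε ha₁ ha₂ N hN hint hlyap
  set W : ℤ → Ω → E × ℝ := fun t ω => (Z t ω, ε t ω) with hW
  set ν := μ.map (past W 0) with hν
  have hp := hZε.measurePreserving_past
  have : IsProbabilityMeasure ν :=
    Measure.isProbabilityMeasure_map (measurable_past hZε.measurable 0).aemeasurable
  have hrm : Measurable fun x : ℕ → E × ℝ => Real.posLog |regression f₁ f₂ x v₀| :=
    Real.continuous_posLog.measurable.comp (measurable_regression hf₁ hf₂
      (measurable_fst.comp (measurable_pi_apply 1)) (measurable_snd.comp (measurable_pi_apply 0))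
      measurable_const).abs
  have hri : Integrable (fun x => Real.posLog |regression f₁ f₂ x v₀|) ν := by
    refine ((hp 1).integrable_comp hrm.aestronglyMeasurable).1 ?_
    refine hv₀.congr (Eventually.of_forall fun ω => ?_)
    simp [regression, hW, past]
  have hgrow := eventually_iterate_le_mul hZε.ergodic_tail.toMeasurePreserving hrm hri
  have hzero : ∀ t, ∀ᵐ ω ∂μ, Tendsto (fun n => (cocycle tail (pastCompanion a₁ a₂) n
      (past W t ω)).mulVec (fun _ => 1) 0) atTop (𝓝 0) := fun t =>
    (hp t).quasiMeasurePreserving.ae (hdecay.mono fun x ⟨δ, hδ, h⟩ =>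
      tendsto_cocycle_mulVec_one hδ h)
  have hsol : IsSolution μ f₁ f₂ Z ε fun t ω => stateLimit f₁ f₂ v₀ (past W t ω) := by
    refine isSolution_stateLimit h₁ h₂ fun t => (hp t).quasiMeasurePreserving.ae
      (p := fun x => ∃ v, Tendsto (fun n => stateIter f₁ f₂ v₀ n x) atTop (𝓝 v)) ?_
    filter_upwards [hdecay, hgrow] with x ⟨δ, hδ, h⟩ hr
    exact tendsto_stateIter_of_summable h₁ h₂
      (summable_cocycle_mulVec hδ h (hr (δ / 2) (by linarith)))
  have herg : IsStationaryErgodic μ fun t ω => stateLimit f₁ f₂ v₀ (past W t ω) :=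
    hZε.comp_past (measurable_stateLimit hf₁ hf₂ v₀)
  exact ⟨_, herg.isStationary, hsol, herg, fun Y' hY' hs' t =>
    IsSolution.ae_eq h₁ h₂ hzero herg.isStationary hY' hsol hs' t⟩

end Decay

/-! ### Random coefficients in `L^p` and the choice of the rate. -/

section Lp

variable {Ω : Type*} [MeasurableSpace Ω] {μ : Measure Ω}

/-- A random coefficient `k (W, e)`, with `e` independent of `(W, X)`, acts on `X` with an `L^p`
operator norm bounded by the supremum over `w` of the `L^p` norm of `k (w, e)`. -/
lemma eLpNorm_mul_le_of_indepFun [IsProbabilityMeasure μ] {β γ : Type*} [MeasurableSpace β]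
    [MeasurableSpace γ] {W : Ω → β} {X : Ω → ℝ} {e : Ω → γ} (hW : Measurable W)
    (hX : Measurable X) (he : Measurable e) (hind : IndepFun (fun ω => (W ω, X ω)) e μ)
    {k : β → γ → ℝ} (hk : Measurable (Function.uncurry k)) {p : ℝ} (hp : 1 ≤ p) {α : ℝ≥0∞}
    (hα : ∀ w, eLpNorm (fun ω => k w (e ω)) (ENNReal.ofReal p) μ ≤ α) :
    eLpNorm (fun ω => k (W ω) (e ω) * X ω) (ENNReal.ofReal p) μ
      ≤ α * eLpNorm X (ENNReal.ofReal p) μ := by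
  have hp0 : 0 < p := by linarith
  have hpne : ENNReal.ofReal p ≠ 0 := by simpa using hp0
  have hpr : (ENNReal.ofReal p).toReal = p := ENNReal.toReal_ofReal hp0.le
  have hkw : ∀ w, Measurable fun y => k w y := fun w => hk.comp measurable_prodMk_left
  have hα' : ∀ w, ∫⁻ y, ‖k w y‖ₑ ^ p ∂(μ.map e) ≤ α ^ p := by
    intro w
    have h1 := hα w
    rw [eLpNorm_eq_lintegral_rpow_enorm_toReal hpne ENNReal.ofReal_ne_top, hpr] at h1
    rw [lintegral_map ((hkw _).enorm.pow_const p) he]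
    have h2 := ENNReal.rpow_le_rpow h1 hp0.le
    rwa [← ENNReal.rpow_mul, one_div, inv_mul_cancel₀ hp0.ne', ENNReal.rpow_one] at h2
  rw [eLpNorm_eq_lintegral_rpow_enorm_toReal hpne ENNReal.ofReal_ne_top,
    eLpNorm_eq_lintegral_rpow_enorm_toReal hpne ENNReal.ofReal_ne_top, hpr]
  -- By independence and Fubini, `(W, X)` is frozen while `e` is integrated out, and the inner
  -- integral is at most `α ^ p` uniformly in the frozen value.
  have hmain : ∫⁻ ω, ‖k (W ω) (e ω) * X ω‖ₑ ^ p ∂μ ≤ α ^ p * ∫⁻ ω, ‖X ω‖ₑ ^ p ∂μ := by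
    have hmap := (indepFun_iff_map_prod_eq_prod_map_map (hW.prodMk hX).aemeasurable
      he.aemeasurable).1 hind
    have hF : Measurable fun y : (β × ℝ) × γ => ‖k y.1.1 y.2 * y.1.2‖ₑ ^ p :=
      (((hk.comp ((measurable_fst.comp measurable_fst).prodMk measurable_snd)).mul
        (measurable_snd.comp measurable_fst)).enorm).pow_const p
    have : IsProbabilityMeasure (μ.map e) := Measure.isProbabilityMeasure_map he.aemeasurable
    calc ∫⁻ ω, ‖k (W ω) (e ω) * X ω‖ₑ ^ p ∂μ
        = ∫⁻ y, ‖k y.1.1 y.2 * y.1.2‖ₑ ^ p ∂(μ.map fun ω => ((W ω, X ω), e ω)) :=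
          (lintegral_map hF ((hW.prodMk hX).prodMk he)).symm
      _ = ∫⁻ v, ∫⁻ y, ‖k v.1 y * v.2‖ₑ ^ p ∂(μ.map e) ∂(μ.map fun ω => (W ω, X ω)) := by
          rw [hmap, lintegral_prod _ hF.aemeasurable]
      _ ≤ ∫⁻ v, α ^ p * ‖v.2‖ₑ ^ p ∂(μ.map fun ω => (W ω, X ω)) := by
          refine lintegral_mono fun v => ?_
          simp only [enorm_mul, ENNReal.mul_rpow_of_nonneg _ _ hp0.le]
          rw [lintegral_mul_const _ ((hkw _).enorm.pow_const p)]
          exact mul_le_mul_left (hα' v.1) _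
      _ = α ^ p * ∫⁻ ω, ‖X ω‖ₑ ^ p ∂μ := by
          have hm : Measurable fun v : β × ℝ => ‖v.2‖ₑ ^ p :=
            measurable_snd.enorm.pow_const p
          rw [lintegral_const_mul _ hm, lintegral_map hm (hW.prodMk hX)]
  calc _ ≤ (α ^ p * ∫⁻ ω, ‖X ω‖ₑ ^ p ∂μ) ^ (1 / p) :=
        ENNReal.rpow_le_rpow hmain (by positivity)
    _ = _ := by
        rw [ENNReal.mul_rpow_of_nonneg _ _ (by positivity), ← ENNReal.rpow_mul, one_div,
          mul_inv_cancel₀ hp0.ne', ENNReal.rpow_one]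

/-- On a probability space the `L^1` norms are below the `L^p` norms, so the sum of the absolute
values has finite expectation. -/
lemma ae_summable_of_tsum_eLpNorm_ne_top [IsProbabilityMeasure μ] {f : ℕ → Ω → ℝ}
    (hf : ∀ n, Measurable (f n)) {p : ℝ≥0∞} (hp : 1 ≤ p) (h : ∑' n, eLpNorm (f n) p μ ≠ ⊤) :
    ∀ᵐ ω ∂μ, Summable fun n => f n ω := by
  have h1 : ∑' n, ∫⁻ ω, ‖f n ω‖ₑ ∂μ ≠ ⊤ := by
    refine ne_top_of_le_ne_top h (ENNReal.tsum_le_tsum fun n => ?_)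
    rw [← eLpNorm_one_eq_lintegral_enorm]
    exact eLpNorm_le_eLpNorm_of_exponent_le hp (hf n).aestronglyMeasurable
  rw [← lintegral_tsum fun n => (hf n).enorm.aemeasurable] at h1
  filter_upwards [ae_lt_top' (AEMeasurable.tsum fun n => (hf n).enorm.aemeasurable) h1]
    with ω hω
  refine Summable.of_norm (NNReal.summable_coe.2 (ENNReal.tsum_coe_ne_top_iff_summable.1 ?_) :
    Summable fun n => ((‖f n ω‖₊ : ℝ≥0) : ℝ))
  exact hω.ne

/-- Take `ρ ^ (q + 1) = c` with `∑ α j ≤ c < 1`. Each weight is at most `ρ^{-q}`, so the weighted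
sum is at most `ρ ^ (q + 1) * ρ^{-q} = ρ`. The floor `1 / 2` in `c` keeps `ρ` positive when all `α
j` vanish. -/
lemma exists_geometric_rate {q : ℕ} {α : Fin (q + 1) → ℝ≥0∞} (hα : ∑ j, α j < 1) :
    ∃ ρ : ℝ≥0, 0 < ρ ∧ ρ < 1 ∧ ∑ j, α j * ((ρ : ℝ≥0∞)⁻¹) ^ (j : ℕ) ≤ ρ := by
  obtain ⟨b, hb⟩ : ∃ b : ℝ≥0, (b : ℝ≥0∞) = ∑ j, α j :=
    ⟨_, ENNReal.coe_toNNReal (hα.trans ENNReal.one_lt_top).ne⟩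
  rw [← hb] at hα
  have hb1 : b < 1 := by exact_mod_cast hα
  set c : ℝ≥0 := max b 2⁻¹ with hc
  have hc1 : c < 1 := max_lt hb1 (by
    rw [← NNReal.coe_lt_coe]; push_cast; norm_num)
  have hc0 : 0 < c := lt_max_of_lt_right (by positivity)
  set ρ : ℝ≥0 := c ^ (((q + 1 : ℕ) : ℝ)⁻¹) with hρ
  have hρq : ρ ^ (q + 1) = c := NNReal.rpow_inv_natCast_pow c (by omega)
  have hρ0 : 0 < ρ := NNReal.rpow_pos hc0
  have hρ1 : ρ < 1 := NNReal.rpow_lt_one hc1 (by positivity)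
  refine ⟨ρ, hρ0, hρ1, ?_⟩
  have hρe0 : (ρ : ℝ≥0∞) ≠ 0 := by exact_mod_cast hρ0.ne'
  have hinv : 1 ≤ (ρ : ℝ≥0∞)⁻¹ := ENNReal.one_le_inv.2 (by exact_mod_cast hρ1.le)
  calc ∑ j, α j * ((ρ : ℝ≥0∞)⁻¹) ^ (j : ℕ) ≤ ∑ j, α j * ((ρ : ℝ≥0∞)⁻¹) ^ q := by
        refine Finset.sum_le_sum fun j _ => mul_le_mul_right ?_ _
        exact pow_le_pow_right₀ hinv (Nat.lt_succ_iff.1 j.2)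
    _ = b * ((ρ : ℝ≥0∞)⁻¹) ^ q := by rw [← Finset.sum_mul, hb]
    _ ≤ (ρ : ℝ≥0∞) ^ (q + 1) * ((ρ : ℝ≥0∞)⁻¹) ^ q := by
        refine mul_le_mul_left ?_ _
        rw [← ENNReal.coe_pow, hρq]
        exact_mod_cast le_max_left b 2⁻¹
    _ = ρ := by
        rw [pow_succ, mul_comm _ (ρ : ℝ≥0∞), mul_assoc, ← mul_pow,
          ENNReal.mul_inv_cancel hρe0 ENNReal.coe_ne_top, one_pow, mul_one]

end Lp

/-! ### Part 2: contraction of the companion matrices in `L^p`. -/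

section Contraction

variable {E : Type*} [MeasurableSpace E] {q : ℕ}
  {f₁ f₂ : (Fin (q + 1) → ℝ) × E → ℝ} {a₁ a₂ : Fin (q + 1) → E → ℝ≥0}

lemma eLpNorm_sum_coeff_mul_le {Ω : Type*} [MeasurableSpace Ω] {μ : Measure Ω}
    [IsProbabilityMeasure μ] (ha₁ : ∀ i, Measurable (a₁ i)) (ha₂ : ∀ i, Measurable (a₂ i))
    {ζ : Ω → E} {e : Ω → ℝ} {X : Fin (q + 1) → Ω → ℝ} (hζ : Measurable ζ) (he : Measurable e)
    (hX : ∀ j, Measurable (X j)) (hind : ∀ j, IndepFun (fun ω => (ζ ω, X j ω)) e μ)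
    {p : ℝ} (hp : 1 ≤ p) {α : Fin (q + 1) → ℝ≥0∞}
    (hα : ∀ j z, eLpNorm (fun ω => (a₁ j z : ℝ) + (a₂ j z : ℝ) * |e ω|) (ENNReal.ofReal p) μ
      ≤ α j) :
    eLpNorm (fun ω => ∑ j, ((a₁ j (ζ ω) : ℝ) + (a₂ j (ζ ω) : ℝ) * |e ω|) * X j ω)
        (ENNReal.ofReal p) μ
      ≤ ∑ j, α j * eLpNorm (X j) (ENNReal.ofReal p) μ := by
  have hm : ∀ j, Measurable fun ω => ((a₁ j (ζ ω) : ℝ) + (a₂ j (ζ ω) : ℝ) * |e ω|) * X j ω :=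
    fun j => ((((ha₁ j).comp hζ).coe_nnreal_real).add
      ((((ha₂ j).comp hζ).coe_nnreal_real).mul he.abs)).mul (hX j)
  have h1 := eLpNorm_sum_le (μ := μ) (p := ENNReal.ofReal p) (s := Finset.univ)
    (f := fun j ω => ((a₁ j (ζ ω) : ℝ) + (a₂ j (ζ ω) : ℝ) * |e ω|) * X j ω)
    (fun j _ => (hm j).aestronglyMeasurable) (by simpa using hp)
  have h2 : (∑ j, fun ω => ((a₁ j (ζ ω) : ℝ) + (a₂ j (ζ ω) : ℝ) * |e ω|) * X j ω)
      = fun ω => ∑ j, ((a₁ j (ζ ω) : ℝ) + (a₂ j (ζ ω) : ℝ) * |e ω|) * X j ω := by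
    ext ω; simp
  rw [h2] at h1
  refine h1.trans (Finset.sum_le_sum fun j _ => ?_)
  refine eLpNorm_mul_le_of_indepFun (k := fun z y => (a₁ j z : ℝ) + (a₂ j z : ℝ) * |y|) hζ (hX j)
    he (hind j) ?_ hp (hα j)
  exact (((ha₁ j).comp measurable_fst).coe_nnreal_real).add
    ((((ha₂ j).comp measurable_fst).coe_nnreal_real).mul measurable_snd.abs)

lemma measurable_cocycle_mulVec {Ω : Type*} [MeasurableSpace Ω]
    (ha₁ : ∀ i, Measurable (a₁ i)) (ha₂ : ∀ i, Measurable (a₂ i)) (n : ℕ) {x : Ω → ℕ → E × ℝ}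
    (hx : Measurable x) {u : Ω → Fin (q + 1) → ℝ} (hu : Measurable u) :
    Measurable fun ω => (cocycle tail (pastCompanion a₁ a₂) n (x ω)).mulVec (u ω) := by
  refine measurable_pi_lambda _ fun i => ?_
  simp only [Matrix.mulVec, dotProduct]
  exact Finset.measurable_sum _ fun j _ => ((measurable_cocycle ha₁ ha₂ n i j).comp hx).mul
    (measurable_pi_iff.1 hu j)

variable {Ω : Type*} {mΩ : MeasurableSpace Ω} {μ : Measure Ω}
  {Z : ℤ → Ω → E} {ε : ℤ → Ω → ℝ} {𝓕 : Filtration ℤ mΩ}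

lemma indepFun_of_measurable_filtration
    (hind : ∀ t, Indep (MeasurableSpace.comap (ε t) inferInstance) (𝓕 (t - 1)) μ) {β : Type*}
    [MeasurableSpace β] {X : Ω → β} {t : ℤ} (hX : Measurable[𝓕 (t - 1)] X) :
    IndepFun X (ε t) μ :=
  (IndepFun_iff_Indep _ _ _).2 (indep_of_indep_of_le_left (hind t).symm hX.comap_le)

lemma measurable_past_filtration (hZ : ∀ t, Measurable[𝓕 t] (Z t))
    (hε : ∀ t, Measurable[𝓕 t] (ε t)) (t : ℤ) :
    Measurable[𝓕 t] (past (fun t ω => (Z t ω, ε t ω)) t) :=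
  @measurable_pi_lambda _ _ _ (𝓕 t) _ _ fun j => by
    have hle : 𝓕 (t - j) ≤ 𝓕 t := 𝓕.mono (by omega)
    exact ((hZ _).mono hle le_rfl).prodMk ((hε _).mono hle le_rfl)

lemma eLpNorm_noise_coeff_eq (hZε : IsStationaryErgodic μ fun t ω => (Z t ω, ε t ω))
    (c d : ℝ) (p : ℝ≥0∞) (t t' : ℤ) :
    eLpNorm (fun ω => c + d * |ε t ω|) p μ = eLpNorm (fun ω => c + d * |ε t' ω|) p μ := by
  have hm : Measurable fun w : E × ℝ => c + d * |w.2| :=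
    measurable_const.add (measurable_const.mul measurable_snd.abs)
  have h : ∀ t, eLpNorm (fun ω => c + d * |ε t ω|) p μ
      = eLpNorm (fun w : E × ℝ => c + d * |w.2|) p (μ.map fun ω => (Z t ω, ε t ω)) := fun t =>
    (eLpNorm_map_measure hm.aestronglyMeasurable (hZε.measurable t).aemeasurable).symm
  rw [h, h]
  congr 1
  exact hZε.isStationary.map_eq t t'

variable [IsProbabilityMeasure μ]

/-- Geometric decay in `L^p` of the products of the companion matrices applied to a random vector
which is measurable with respect to the past. -/
lemma eLpNorm_cocycle_mulVec_le (hZε : IsStationaryErgodic μ fun t ω => (Z t ω, ε t ω))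
    (ha₁ : ∀ i, Measurable (a₁ i)) (ha₂ : ∀ i, Measurable (a₂ i))
    (hZ : ∀ t, Measurable[𝓕 t] (Z t)) (hε : ∀ t, Measurable[𝓕 t] (ε t))
    (hind : ∀ t, Indep (MeasurableSpace.comap (ε t) inferInstance) (𝓕 (t - 1)) μ)
    {p : ℝ} (hp : 1 ≤ p) {α : Fin (q + 1) → ℝ≥0∞}
    (hα : ∀ j z, eLpNorm (fun ω => (a₁ j z : ℝ) + (a₂ j z : ℝ) * |ε 1 ω|) (ENNReal.ofReal p) μ
      ≤ α j) {ρ : ℝ≥0} (hρ0 : 0 < ρ) (hρ1 : ρ < 1)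
    (hρ : ∑ j, α j * ((ρ : ℝ≥0∞)⁻¹) ^ (j : ℕ) ≤ ρ) {M : ℝ≥0∞} {s : ℤ}
    {u : Ω → Fin (q + 1) → ℝ} (hu : Measurable[𝓕 s] u)
    (hM : ∀ i, eLpNorm (fun ω => u ω i) (ENNReal.ofReal p) μ ≤ M) (n : ℕ) (i : Fin (q + 1)) :
    eLpNorm (fun ω => (cocycle tail (pastCompanion a₁ a₂) n
        (past (fun t ω => (Z t ω, ε t ω)) (s + n) ω)).mulVec (u ω) i) (ENNReal.ofReal p) μ
      ≤ (ρ : ℝ≥0∞) ^ n * ((ρ : ℝ≥0∞)⁻¹) ^ (i : ℕ) * M := by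
  have hρe0 : (ρ : ℝ≥0∞) ≠ 0 := by exact_mod_cast hρ0.ne'
  have hinv : 1 ≤ (ρ : ℝ≥0∞)⁻¹ := ENNReal.one_le_inv.2 (by exact_mod_cast hρ1.le)
  set W : ℤ → Ω → E × ℝ := fun t ω => (Z t ω, ε t ω) with hW
  set v : ℕ → Ω → Fin (q + 1) → ℝ := fun n ω =>
    (cocycle tail (pastCompanion a₁ a₂) n (past W (s + n) ω)).mulVec (u ω) with hv
  have hvs : ∀ n ω, v (n + 1) ω = (pastCompanion a₁ a₂ (past W (s + (n + 1 : ℕ)) ω)).mulVec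
      (v n ω) := by
    intro n ω
    simp only [hv]
    rw [cocycle_succ_mulVec, tail_past]
    congr 4; push_cast; ring
  have hvm : ∀ n : ℕ, Measurable[𝓕 (s + n)] (v n) := fun n =>
    @measurable_cocycle_mulVec _ _ _ _ _ _ (𝓕 (s + n)) ha₁ ha₂ n _
      (measurable_past_filtration hZ hε _) _ (hu.mono (𝓕.mono (by omega)) le_rfl)
  change eLpNorm (fun ω => v n ω i) (ENNReal.ofReal p) μ ≤ _
  -- The weight `ρ^{-i}` reflects that coordinate `i` lags `i` steps behind coordinate `0`. Row `0`
  -- gains a factor `ρ` by `hρ`; a shift row trades one step for one coordinate without loss.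
  induction n generalizing i with
  | zero =>
    simp only [pow_zero, one_mul]
    have h0 : ∀ ω, v 0 ω = u ω := fun ω => by simp [hv, cocycle]
    simp only [h0]
    exact (hM i).trans (le_mul_of_one_le_left' (one_le_pow₀ hinv))
  | succ n ih =>
    simp only [hvs]
    induction i using Fin.cases with
    | zero =>
      simp only [pastCompanion_mulVec_zero]
      set t : ℤ := s + (n + 1 : ℕ) with ht
      have ht1 : t - 1 = s + n := by rw [ht]; push_cast; ring
      have hvj : ∀ j, Measurable[𝓕 (t - 1)] fun ω => v n ω j := fun j => by
        rw [ht1]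
        exact (measurable_pi_apply j).comp (hvm n)
      have hb := eLpNorm_sum_coeff_mul_le (μ := μ) (X := fun j ω => v n ω j) (ζ := Z (t - 1))
        (e := ε t) ha₁ ha₂ ((hZ _).mono (𝓕.le _) le_rfl) ((hε _).mono (𝓕.le _) le_rfl)
        (fun j => (hvj j).mono (𝓕.le _) le_rfl)
        (fun j => indepFun_of_measurable_filtration hind
          ((hZ _).prodMk (hvj j))) hp (α := α)
        (fun j z => by rw [eLpNorm_noise_coeff_eq hZε _ _ _ t 1]; exact hα j z)
      have he : ∀ ω j, lagCoeff a₁ a₂ (past W t ω) j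
          = (a₁ j (Z (t - 1) ω) : ℝ) + (a₂ j (Z (t - 1) ω) : ℝ) * |ε t ω| := fun ω j => by
        simp [lagCoeff, past, hW]
      simp only [he]
      refine hb.trans ?_
      calc ∑ j, α j * eLpNorm (fun ω => v n ω j) (ENNReal.ofReal p) μ
          ≤ ∑ j, α j * ((ρ : ℝ≥0∞) ^ n * ((ρ : ℝ≥0∞)⁻¹) ^ (j : ℕ) * M) :=
            Finset.sum_le_sum fun j _ => mul_le_mul_right (ih j) _
        _ = (∑ j, α j * ((ρ : ℝ≥0∞)⁻¹) ^ (j : ℕ)) * ((ρ : ℝ≥0∞) ^ n * M) := by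
            rw [Finset.sum_mul]
            exact Finset.sum_congr rfl fun j _ => by ring
        _ ≤ ρ * ((ρ : ℝ≥0∞) ^ n * M) := mul_le_mul_left hρ _
        _ = _ := by simp [pow_succ]; ring
    | succ i =>
      simp only [pastCompanion_mulVec_succ]
      refine (ih _).trans (le_of_eq ?_)
      simp only [Fin.val_castSucc, Fin.val_succ]
      rw [pow_succ, pow_succ, mul_mul_mul_comm, ENNReal.mul_inv_cancel hρe0 ENNReal.coe_ne_top,
        mul_one]

end Contraction

/-! ### Part 2: solution, moments and uniqueness. -/

section NonAnticipative

variable {E : Type*} [MeasurableSpace E] {q : ℕ}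
  {f₁ f₂ : (Fin (q + 1) → ℝ) × E → ℝ} {a₁ a₂ : Fin (q + 1) → E → ℝ≥0}
  {Ω : Type*} {mΩ : MeasurableSpace Ω} {μ : Measure Ω} [IsProbabilityMeasure μ]
  {Z : ℤ → Ω → E} {ε : ℤ → Ω → ℝ} {𝓕 : Filtration ℤ mΩ}

lemma tsum_geometric_mul_ne_top {ρ : ℝ≥0} (hρ1 : ρ < 1) {c : ℝ≥0∞} (hc : c ≠ ⊤) :
    ∑' n : ℕ, (ρ : ℝ≥0∞) ^ n * c ≠ ⊤ := by
  rw [ENNReal.tsum_mul_right, ENNReal.tsum_geometric]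
  refine ENNReal.mul_ne_top (ENNReal.inv_ne_top.2 ?_) hc
  exact (tsub_pos_of_lt (by exact_mod_cast hρ1)).ne'

/-- The stationary solution `stateLimit` under the contraction condition in `L^p`, together with the
fact that all stationary solutions coincide with it. -/
theorem stateLimit_spec_of_contraction
    (hf₁ : Measurable f₁) (hf₂ : Measurable f₂)
    (hZε : IsStationaryErgodic μ fun t ω => (Z t ω, ε t ω))
    (ha₁ : ∀ i, Measurable (a₁ i)) (ha₂ : ∀ i, Measurable (a₂ i))
    (h₁ : LipschitzInLags f₁ a₁) (h₂ : LipschitzInLags f₂ a₂)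
    (hZ : ∀ t, Measurable[𝓕 t] (Z t)) (hε : ∀ t, Measurable[𝓕 t] (ε t))
    (hind : ∀ t, Indep (MeasurableSpace.comap (ε t) inferInstance) (𝓕 (t - 1)) μ)
    {p : ℝ} (hp : 1 ≤ p) {v₀ : Fin (q + 1) → ℝ}
    (hv₀ : MemLp (fun ω => f₁ (v₀, Z 0 ω) + ε 1 ω * f₂ (v₀, Z 0 ω)) (ENNReal.ofReal p) μ)
    (hα : (∑ i, ⨆ z : E, eLpNorm (fun ω => (a₁ i z : ℝ) + (a₂ i z : ℝ) * |ε 1 ω|)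
        (ENNReal.ofReal p) μ) < 1) :
    IsSolution μ f₁ f₂ Z ε
        (fun t ω => stateLimit f₁ f₂ v₀ (past (fun t ω => (Z t ω, ε t ω)) t ω)) ∧
      (∀ t, MemLp (fun ω => stateLimit f₁ f₂ v₀ (past (fun t ω => (Z t ω, ε t ω)) t ω))
        (ENNReal.ofReal p) μ) ∧
      ∀ Y' : ℤ → Ω → ℝ, IsStationary μ Y' → IsSolution μ f₁ f₂ Z ε Y' → ∀ t, Y' t =ᵐ[μ]
        fun ω => stateLimit f₁ f₂ v₀ (past (fun t ω => (Z t ω, ε t ω)) t ω) := by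
  set W : ℤ → Ω → E × ℝ := fun t ω => (Z t ω, ε t ω) with hW
  set P : ℝ≥0∞ := ENNReal.ofReal p with hP
  have hP1 : 1 ≤ P := by simpa [hP] using hp
  have hWm := hZε.measurable
  have hpm : ∀ t, Measurable (past W t) := fun t => measurable_past hWm t
  obtain ⟨ρ, hρ0, hρ1, hρ⟩ := exists_geometric_rate hα
  have hρe0 : (ρ : ℝ≥0∞) ≠ 0 := by exact_mod_cast hρ0.ne'
  have hαz := fun j z => le_iSup (fun z : E => eLpNorm (fun ω => (a₁ j z : ℝ)
    + (a₂ j z : ℝ) * |ε 1 ω|) P μ) z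
  have hinvpow : ∀ i : ℕ, ((ρ : ℝ≥0∞)⁻¹) ^ i ≠ ⊤ := fun i =>
    ENNReal.pow_ne_top (ENNReal.inv_ne_top.2 hρe0)
  set D : (ℕ → E × ℝ) → Fin (q + 1) → ℝ := fun x j => |stateStep f₁ f₂ x v₀ j - v₀ j| with hD
  have hDm : Measurable D := by
    refine measurable_pi_lambda _ fun j => ?_
    exact ((measurable_pi_iff.1 (measurable_stateStep hf₁ hf₂
      (measurable_fst.comp (measurable_pi_apply 1)) (measurable_snd.comp (measurable_pi_apply 0))
      measurable_const) j).sub_const _).abs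
  have hDL : ∀ j, MemLp (fun ω => D (past W 1 ω) j) P μ := by
    intro j
    refine MemLp.abs ?_
    induction j using Fin.cases with
    | zero =>
      refine (hv₀.sub (memLp_const (v₀ 0))).ae_eq (Eventually.of_forall fun ω => ?_)
      simp [stateStep, regression, hW, past]
    | succ j =>
      simp only [stateStep, Fin.cons_succ, Fin.init]
      exact memLp_const _
  set M : ℝ≥0∞ := ∑ j, eLpNorm (fun ω => D (past W 1 ω) j) P μ with hM
  have hMt : M ≠ ⊤ := (ENNReal.sum_lt_top.2 fun j _ => (hDL j).eLpNorm_lt_top).ne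
  have hDM : ∀ t j, eLpNorm (fun ω => D (past W t ω) j) P μ ≤ M := by
    intro t j
    have hDj : AEStronglyMeasurable (fun x => D x j) (μ.map (past W 0)) :=
      (measurable_pi_iff.1 hDm j).aestronglyMeasurable
    have h : ∀ t, eLpNorm ((fun x => D x j) ∘ past W t) P μ
        = eLpNorm (fun x => D x j) P (μ.map (past W 0)) := fun t =>
      eLpNorm_comp_measurePreserving hDj (hZε.measurePreserving_past t)
    refine ((h t).trans (h 1).symm).le.trans ?_
    exact Finset.single_le_sum (f := fun j => eLpNorm (fun ω => D (past W 1 ω) j) P μ)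
      (fun _ _ => bot_le) (Finset.mem_univ j)
  set F : ℤ → Fin (q + 1) → ℕ → Ω → ℝ := fun t i n ω =>
    (cocycle tail (pastCompanion a₁ a₂) n (past W t ω)).mulVec (D (tail^[n] (past W t ω))) i
    with hF
  have hFm : ∀ t i n, Measurable (F t i n) := fun t i n =>
    measurable_pi_iff.1 (measurable_cocycle_mulVec ha₁ ha₂ n (hpm t)
      (hDm.comp ((measurable_tail.iterate n).comp (hpm t)))) i
  -- The defect at time `t - n` is measurable for `𝓕 (t - n)`, hence independent of each later noise
  -- variable, as the geometric bound requires.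
  have hFn : ∀ t i n, eLpNorm (F t i n) P μ
      ≤ (ρ : ℝ≥0∞) ^ n * (((ρ : ℝ≥0∞)⁻¹) ^ (i : ℕ) * M) := by
    intro t i n
    have h := eLpNorm_cocycle_mulVec_le hZε ha₁ ha₂ hZ hε hind hp hαz hρ0 hρ1 hρ
      (s := t - n) (u := fun ω => D (past W (t - n) ω))
      (hDm.comp (measurable_past_filtration hZ hε _)) (hDM (t - n)) n i
    rw [sub_add_cancel] at h
    simp only [hF, tail_iterate_past]
    rw [← mul_assoc]
    exact h
  have hFs : ∀ t i, ∑' n, eLpNorm (F t i n) P μ ≠ ⊤ := fun t i =>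
    ne_top_of_le_ne_top (tsum_geometric_mul_ne_top hρ1 (ENNReal.mul_ne_top (hinvpow i) hMt))
      (ENNReal.tsum_le_tsum (hFn t i))
  have hconv : ∀ t, ∀ᵐ ω ∂μ, ∃ v : Fin (q + 1) → ℝ,
      Tendsto (fun n => stateIter f₁ f₂ v₀ n (past W t ω)) atTop (𝓝 v) := by
    intro t
    filter_upwards [ae_all_iff.2 fun i =>
      ae_summable_of_tsum_eLpNorm_ne_top (hFm t i) hP1 (hFs t i)] with ω hω
    exact tendsto_stateIter_of_summable h₁ h₂ hω
  have hzero : ∀ t, ∀ᵐ ω ∂μ, Tendsto (fun n => (cocycle tail (pastCompanion a₁ a₂) n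
      (past W t ω)).mulVec (fun _ => 1) 0) atTop (𝓝 0) := by
    intro t
    have hb : ∀ n, eLpNorm (fun ω => (cocycle tail (pastCompanion a₁ a₂) n
        (past W t ω)).mulVec (fun _ => 1) 0) P μ ≤ (ρ : ℝ≥0∞) ^ n * eLpNorm (fun _ => (1 : ℝ)) P μ := by
      intro n
      have h := eLpNorm_cocycle_mulVec_le hZε ha₁ ha₂ hZ hε hind hp hαz hρ0 hρ1 hρ
        (s := t - n) (u := fun _ _ => (1 : ℝ)) (M := eLpNorm (fun _ => (1 : ℝ)) P μ)
        (@measurable_const _ _ _ (𝓕 (t - n)) _) (fun _ => le_rfl) n 0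
      rw [sub_add_cancel] at h
      simpa using h
    have hs := ae_summable_of_tsum_eLpNorm_ne_top (p := P) (μ := μ)
      (fun n => measurable_pi_iff.1 (measurable_cocycle_mulVec ha₁ ha₂ n (hpm t)
        (measurable_const (a := fun _ => 1))) 0) hP1 (ne_top_of_le_ne_top
        (tsum_geometric_mul_ne_top hρ1 (memLp_const (μ := μ) (p := P) (1 : ℝ)).eLpNorm_ne_top)
        (ENNReal.tsum_le_tsum hb))
    filter_upwards [hs] with ω hω
    exact hω.tendsto_atTop_zero
  have hsol : IsSolution μ f₁ f₂ Z ε fun t ω => stateLimit f₁ f₂ v₀ (past W t ω) :=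
    isSolution_stateLimit h₁ h₂ hconv
  have herg : IsStationaryErgodic μ fun t ω => stateLimit f₁ f₂ v₀ (past W t ω) :=
    hZε.comp_past (measurable_stateLimit hf₁ hf₂ v₀)
  refine ⟨hsol, fun t => ⟨(herg.measurable t).aestronglyMeasurable, ?_⟩, fun Y' hY' hs' t =>
    IsSolution.ae_eq h₁ h₂ hzero herg.isStationary hY' hsol hs' t⟩
  have hVm : ∀ n, Measurable fun ω => stateIter f₁ f₂ v₀ n (past W t ω) 0 := fun n =>
    (measurable_pi_iff.1 (measurable_stateIter hf₁ hf₂ v₀ n) 0).comp (hpm t)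
  set C : ℝ≥0∞ := eLpNorm (fun _ : Ω => v₀ 0) P μ + ∑' n, eLpNorm (F t 0 n) P μ with hC
  have hCt : C ≠ ⊤ := ENNReal.add_ne_top.2 ⟨(memLp_const _).eLpNorm_ne_top, hFs t 0⟩
  have hVn : ∀ n, eLpNorm (fun ω => stateIter f₁ f₂ v₀ n (past W t ω) 0) P μ
      ≤ eLpNorm (fun _ : Ω => v₀ 0) P μ + ∑ k ∈ Finset.range n, eLpNorm (F t 0 k) P μ := by
    intro n
    induction n with
    | zero => simp [stateIter]
    | succ n ih =>
      rw [Finset.sum_range_succ, ← add_assoc]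
      have hsplit : (fun ω => stateIter f₁ f₂ v₀ (n + 1) (past W t ω) 0)
          = (fun ω => stateIter f₁ f₂ v₀ n (past W t ω) 0) + fun ω =>
            (stateIter f₁ f₂ v₀ (n + 1) (past W t ω) 0 - stateIter f₁ f₂ v₀ n (past W t ω) 0) := by
        ext ω; simp
      rw [hsplit]
      refine (eLpNorm_add_le (hVm n).aestronglyMeasurable
        ((hVm (n + 1)).sub (hVm n)).aestronglyMeasurable hP1).trans (add_le_add ih ?_)
      exact eLpNorm_mono_real fun ω => abs_stateIter_succ_sub_le h₁ h₂ v₀ n _ 0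
  -- Fatou carries the uniform `L^p` bound of the iterates over to their limit.
  have hlim := Lp.eLpNorm_lim_le_liminf_eLpNorm (p := P) (μ := μ)
    (fun n => (hVm n).aestronglyMeasurable)
    (fun ω => stateLimit f₁ f₂ v₀ (past W t ω)) (by
      filter_upwards [hconv t] with ω hω
      obtain ⟨v, hv⟩ := hω
      have h0 := tendsto_pi_nhds.1 hv 0
      rw [stateLimit, h0.limsup_eq]
      exact h0)
  refine lt_of_le_of_lt (hlim.trans ?_) hCt.lt_top
  refine (liminf_le_liminf (Eventually.of_forall fun n => ?_)).trans
    (liminf_const (f := (atTop : Filter ℕ)) C).le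
  exact (hVn n).trans (add_le_add le_rfl (ENNReal.sum_le_tsum _))

end NonAnticipative

/-! ### Linear recursive inequalities and their tail sums. -/

section TailSums

variable {q : ℕ} {α : Fin (q + 1) → ℝ≥0∞} {K M : ℝ≥0∞} {z : ℕ → ℝ≥0∞} {d : ℤ → ℝ≥0∞}

lemma sum_range_sub_le (hneg : ∀ t < 0, d t = 0) (j N : ℕ) :
    ∑ n ∈ Finset.range N, d ((n : ℤ) - j) ≤ ∑ n ∈ Finset.range N, d n := by
  induction j generalizing N with
  | zero => simp
  | succ j ih =>
    cases N with
    | zero => simp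
    | succ N =>
      rw [Finset.sum_range_succ', hneg _ (by push_cast; omega), add_zero]
      have h : ∀ n : ℕ, ((n + 1 : ℕ) : ℤ) - ((j + 1 : ℕ) : ℤ) = (n : ℤ) - j := fun n => by
        push_cast; ring
      simp only [h]
      exact (ih N).trans (Finset.sum_le_sum_of_subset (Finset.range_mono (Nat.le_succ N)))

/-- Terms at negative times vanish, so the truncated subtraction `h - j` loses nothing. -/
lemma tsum_sub_eq (hneg : ∀ t < 0, d t = 0) (h j : ℕ) :
    ∑' n : ℕ, d ((h : ℤ) - j + n) = ∑' n : ℕ, d (((h - j : ℕ) : ℤ) + n) := by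
  have key : ∀ k : ℕ, ∑' n : ℕ, d (-(k : ℤ) + n) = ∑' n : ℕ, d n := by
    intro k
    induction k with
    | zero => simp
    | succ k ih =>
      rw [tsum_eq_zero_add' ENNReal.summable, hneg _ (by push_cast; omega), zero_add, ← ih]
      refine tsum_congr fun n => ?_
      congr 1; push_cast; ring
  rcases le_total j h with hj | hj
  · rw [Nat.cast_sub hj]
  · obtain ⟨k, rfl⟩ := Nat.exists_eq_add_of_le hj
    rw [Nat.sub_eq_zero_of_le hj]
    simp only [Nat.cast_zero, zero_add]
    rw [← key k]
    refine tsum_congr fun n => ?_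
    congr 1; push_cast; ring

/-- Summing the recursion gives `S ≤ M + K ∑ z + (∑ α j) S` for the partial sums. They are finite
thanks to `hdM`, so the last term may be subtracted. -/
lemma tsum_le_of_linear_recursion (hα : ∑ j, α j < 1) (hM : M ≠ ⊤)
    (hneg : ∀ t < 0, d t = 0) (hdM : ∀ t, d t ≤ M)
    (hrec : ∀ n : ℕ, d ((n : ℤ) + 1) ≤ ∑ j : Fin (q + 1), α j * d ((n : ℤ) - (j : ℕ)) + K * z n) :
    ∑' n : ℕ, d n ≤ (M + K * ∑' n, z n) / (1 - ∑ j, α j) := by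
  refine ENNReal.tsum_le_of_sum_range_le fun N => ?_
  set S : ℕ → ℝ≥0∞ := fun N => ∑ n ∈ Finset.range N, d n with hS
  have hSt : ∀ N, S N ≠ ⊤ := fun N =>
    (ENNReal.sum_lt_top (f := fun n : ℕ => d n)).2
      (fun n _ => lt_of_le_of_lt (hdM n) hM.lt_top) |>.ne
  have hmono : ∀ N, S N ≤ S (N + 1) := fun N =>
    Finset.sum_le_sum_of_subset (Finset.range_mono (Nat.le_succ N))
  have hstep : ∀ N, S (N + 1) ≤ (M + K * ∑' n, z n) + (∑ j, α j) * S (N + 1) := by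
    intro N
    calc S (N + 1) = ∑ n ∈ Finset.range N, d ((n : ℤ) + 1) + d 0 := by
          simp only [hS]
          rw [Finset.sum_range_succ']
          simp
      _ ≤ ∑ n ∈ Finset.range N, (∑ j : Fin (q + 1), α j * d ((n : ℤ) - (j : ℕ)) + K * z n) + M :=
          add_le_add (Finset.sum_le_sum fun n _ => hrec n) (hdM 0)
      _ = ∑ j : Fin (q + 1), α j * ∑ n ∈ Finset.range N, d ((n : ℤ) - (j : ℕ))
            + K * ∑ n ∈ Finset.range N, z n + M := by
          rw [Finset.sum_add_distrib, Finset.sum_comm, Finset.mul_sum]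
          simp only [Finset.mul_sum]
      _ ≤ (∑ j, α j) * S (N + 1) + K * ∑' n, z n + M := by
          rw [Finset.sum_mul]
          gcongr with j
          · exact (sum_range_sub_le hneg _ _).trans (hmono N)
          · exact ENNReal.sum_le_tsum _
      _ = _ := by ring
  refine (hmono N).trans ?_
  have hb : (∑ j, α j) * S (N + 1) ≠ ⊤ :=
    ENNReal.mul_ne_top (hα.trans ENNReal.one_lt_top).ne (hSt _)
  rw [ENNReal.le_div_iff_mul_le (Or.inl (tsub_pos_of_lt hα).ne')
    (Or.inl (ne_top_of_le_ne_top ENNReal.one_ne_top tsub_le_self)), mul_comm,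
    ENNReal.sub_mul fun _ _ => hSt _, one_mul]
  exact tsub_le_iff_right.2 (hstep N)

lemma sum_Icc_one_eq_sum_range (F : ℕ → ℝ≥0∞) (h : ℕ) :
    ∑ i ∈ Finset.Icc 1 h, F i = ∑ k ∈ Finset.range h, F (k + 1) := by
  rw [Finset.range_eq_Ico, Finset.sum_Ico_add' F 0 h 1]
  rfl

/-- Geometric control of the tail sums of a nonnegative sequence which satisfies a linear recursive
inequality. -/
lemma exists_const_tail_sum_le (hα : ∑ j, α j < 1) (hK : K ≠ ⊤) (hM : M ≠ ⊤) {ρ : ℝ≥0}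
    (hρ0 : 0 < ρ) (hρ1 : ρ < 1) (hρ : ∑ j, α j * ((ρ : ℝ≥0∞)⁻¹) ^ (j : ℕ) ≤ ρ) (z : ℕ → ℝ≥0∞) :
    ∃ C : ℝ, 0 < C ∧ ∀ d : ℤ → ℝ≥0∞, (∀ t < 0, d t = 0) → (∀ t, d t ≤ M) →
      (∀ n : ℕ, d ((n : ℤ) + 1) ≤ ∑ j : Fin (q + 1), α j * d ((n : ℤ) - (j : ℕ)) + K * z n) →
      ∀ h : ℕ, 1 ≤ h → ∑' n : ℕ, d ((h : ℤ) + n) ≤ ENNReal.ofReal C * (ENNReal.ofReal ((ρ : ℝ) ^ h)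
        + ∑ i ∈ Finset.Icc 1 h, ENNReal.ofReal ((ρ : ℝ) ^ i) * ∑' n, z (h - i + n)) := by
  have hρe0 : (ρ : ℝ≥0∞) ≠ 0 := by exact_mod_cast hρ0.ne'
  have hinv : 1 ≤ (ρ : ℝ≥0∞)⁻¹ := ENNReal.one_le_inv.2 (by exact_mod_cast hρ1.le)
  have hpow : ∀ i : ℕ, ENNReal.ofReal ((ρ : ℝ) ^ i) = (ρ : ℝ≥0∞) ^ i := fun i => by
    rw [ENNReal.ofReal_pow ρ.coe_nonneg, ENNReal.ofReal_coe_nnreal]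
  simp only [hpow]
  set Z : ℕ → ℝ≥0∞ := fun k => ∑' n, z (k + n) with hZ
  have hZ0 : Z 0 = ∑' n, z n := by simp [hZ]
  by_cases hZt : Z 0 = ⊤
  -- If the total input is infinite, the term `i = h` already makes the right-hand side infinite.
  · refine ⟨1, one_pos, fun d _ _ _ h hh => ?_⟩
    have hterm : (ρ : ℝ≥0∞) ^ h * Z (h - h) = ⊤ := by
      rw [Nat.sub_self, hZt, ENNReal.mul_top (pow_ne_zero _ hρe0)]
    have hle := Finset.single_le_sum (f := fun i => (ρ : ℝ≥0∞) ^ i * Z (h - i))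
      (fun _ _ => bot_le) (Finset.mem_Icc.2 ⟨hh, le_rfl⟩)
    rw [hterm] at hle
    rw [top_le_iff.1 hle]
    simp
  -- The three terms of `C` serve in turn for positivity, for the base case `h = 0`, and for `K ≤ C
  -- * ρ` in the inductive step.
  · set C : ℝ≥0∞ := 1 + (M + K * Z 0) / (1 - ∑ j, α j) + K * (ρ : ℝ≥0∞)⁻¹ with hC
    have hCt : C ≠ ⊤ := by
      refine ENNReal.add_ne_top.2 ⟨ENNReal.add_ne_top.2 ⟨ENNReal.one_ne_top, ENNReal.div_ne_top
        (ENNReal.add_ne_top.2 ⟨hM, ENNReal.mul_ne_top hK hZt⟩) (tsub_pos_of_lt hα).ne'⟩,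
        ENNReal.mul_ne_top hK (ENNReal.inv_ne_top.2 hρe0)⟩
    have hC1 : 1 ≤ C := by rw [hC, add_assoc]; exact le_self_add
    refine ⟨C.toReal, ENNReal.toReal_pos (one_pos.trans_le hC1).ne' hCt,
      fun d hneg hdM hrec h _ => ?_⟩
    rw [ENNReal.ofReal_toReal hCt]
    set B : ℕ → ℝ≥0∞ := fun h => (ρ : ℝ≥0∞) ^ h
      + ∑ i ∈ Finset.Icc 1 h, (ρ : ℝ≥0∞) ^ i * Z (h - i) with hB
    have hB0 : B 0 = 1 := by simp [hB]
    -- The bracket of the claimed bound solves this recursion exactly, and therefore shrinks by at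
    -- most a factor `ρ` per step. This compensates the lags through the weights `ρ^{-j}` in `hρ`.
    have hBs : ∀ h, B (h + 1) = ρ * B h + ρ * Z h := by
      intro h
      simp only [hB, sum_Icc_one_eq_sum_range]
      rw [Finset.sum_range_succ']
      simp only [Nat.add_sub_add_right, zero_add, pow_one]
      rw [mul_add, Finset.mul_sum, pow_succ', ← add_assoc]
      congr 2
      exact Finset.sum_congr rfl fun k _ => by ring
    have hBadd : ∀ h j, (ρ : ℝ≥0∞) ^ j * B h ≤ B (h + j) := by
      intro h j
      induction j with
      | zero => simp
      | succ j ih =>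
        rw [pow_succ', mul_assoc, ← add_assoc, hBs]
        exact (mul_le_mul_right ih _).trans le_self_add
    have hBsub : ∀ h j, B (h - j) ≤ ((ρ : ℝ≥0∞)⁻¹) ^ j * B h := by
      intro h j
      have h1 := hBadd (h - j) (min j h)
      rw [show h - j + min j h = h by omega] at h1
      calc B (h - j) = ((ρ : ℝ≥0∞)⁻¹) ^ (min j h) * ((ρ : ℝ≥0∞) ^ (min j h) * B (h - j)) := by
            rw [← mul_assoc, ← mul_pow, ENNReal.inv_mul_cancel hρe0 ENNReal.coe_ne_top, one_pow,
              one_mul]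
        _ ≤ ((ρ : ℝ≥0∞)⁻¹) ^ j * B h :=
            mul_le_mul' (pow_le_pow_right₀ hinv (min_le_left _ _)) h1
    have hKC : K ≤ C * ρ := by
      calc K = K * (ρ : ℝ≥0∞)⁻¹ * ρ := by
            rw [mul_assoc, ENNReal.inv_mul_cancel hρe0 ENNReal.coe_ne_top, mul_one]
        _ ≤ C * ρ := mul_le_mul_left le_add_self _
    have main : ∀ h : ℕ, ∑' n : ℕ, d ((h : ℤ) + n) ≤ C * B h := by
      intro h
      induction h using Nat.strong_induction_on with
      | _ h ih =>
        cases h with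
        | zero =>
          rw [hB0, mul_one]
          simp only [Nat.cast_zero, zero_add]
          refine (tsum_le_of_linear_recursion hα hM hneg hdM hrec).trans ?_
          rw [← hZ0, hC, add_comm 1, add_assoc]
          exact le_self_add
        | succ h =>
          calc ∑' n : ℕ, d (((h + 1 : ℕ) : ℤ) + n)
              ≤ ∑' n : ℕ, (∑ j : Fin (q + 1), α j * d ((h : ℤ) - (j : ℕ) + n) + K * z (h + n)) := by
                refine ENNReal.tsum_le_tsum fun n => ?_
                have h1 := hrec (h + n)
                have e1 : ((h + n : ℕ) : ℤ) + 1 = ((h + 1 : ℕ) : ℤ) + n := by push_cast; ring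
                have e2 : ∀ j : ℕ, ((h + n : ℕ) : ℤ) - j = (h : ℤ) - j + n := fun j => by
                  push_cast; ring
                simpa only [e1, e2] using h1
            _ = ∑ j : Fin (q + 1), α j * ∑' n : ℕ, d (((h - j : ℕ) : ℤ) + n) + K * Z h := by
                rw [ENNReal.tsum_add, ENNReal.tsum_mul_left,
                  Summable.tsum_finsetSum fun _ _ => ENNReal.summable]
                simp only [ENNReal.tsum_mul_left, tsum_sub_eq hneg]
                rfl
            _ ≤ ∑ j : Fin (q + 1), α j * (C * (((ρ : ℝ≥0∞)⁻¹) ^ (j : ℕ) * B h))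
                  + C * ρ * Z h := by
                refine add_le_add (Finset.sum_le_sum fun j _ => mul_le_mul_right ?_ _)
                  (mul_le_mul_left hKC _)
                exact (ih (h - j) (by omega)).trans (mul_le_mul_right (hBsub h j) _)
            _ = C * ((∑ j : Fin (q + 1), α j * ((ρ : ℝ≥0∞)⁻¹) ^ (j : ℕ)) * B h + ρ * Z h) := by
                rw [Finset.sum_mul, mul_add, Finset.mul_sum]
                congr 1
                · exact Finset.sum_congr rfl fun j _ => by ring
                · ring
            _ ≤ C * B (h + 1) := by
                rw [hBs]
                exact mul_le_mul_right (add_le_add (mul_le_mul_left hρ _) le_rfl) _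
    exact main h

end TailSums

/-! ### Replacing one innovation: law and independence. -/

section Coupling

variable {Ω G : Type*} [MeasurableSpace Ω] [MeasurableSpace G] {μ : Measure Ω}
  [IsProbabilityMeasure μ] {ξ : ℤ → Ω → G}

lemma measurable_coupled (hξ : ∀ t, Measurable (ξ t)) (t : ℤ) : Measurable (coupled ξ t) := by
  unfold coupled
  split_ifs
  · exact (hξ 0).comp measurable_snd
  · exact (hξ t).comp measurable_fst

lemma map_coupled (hξ : ∀ t, Measurable (ξ t)) (t : ℤ) :
    (μ.prod μ).map (coupled ξ t) = μ.map (ξ t) := by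
  by_cases ht : t = 0
  · subst ht
    have : coupled ξ 0 = ξ 0 ∘ Prod.snd := by funext ω; simp [coupled]
    rw [this, ← Measure.map_map (hξ 0) measurable_snd, measurePreserving_snd.map_eq]
  · have : coupled ξ t = ξ t ∘ Prod.fst := by funext ω; simp [coupled, ht]
    rw [this, ← Measure.map_map (hξ t) measurable_fst, measurePreserving_fst.map_eq]

/-- Only index `0` reads the second coordinate of `Ω × Ω`, so a cylinder event is a rectangle: the
constraints at nonzero times by the one at time `0`. -/
lemma iIndepFun_coupled (hξ : ∀ t, Measurable (ξ t)) (h : iIndepFun ξ μ) :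
    iIndepFun (coupled ξ) (μ.prod μ) := by
  rw [iIndepFun_iff_measure_inter_preimage_eq_mul] at h ⊢
  intro S s hs
  have hmarg : ∀ i ∈ S, (μ.prod μ) (coupled ξ i ⁻¹' s i) = μ (ξ i ⁻¹' s i) := fun i hi => by
    rw [← Measure.map_apply (measurable_coupled hξ i) (hs i hi), map_coupled hξ,
      Measure.map_apply (hξ i) (hs i hi)]
  rw [Finset.prod_congr rfl hmarg]
  have herase : ∀ i ∈ S.erase 0, MeasurableSet (s i) := fun i hi => hs i (Finset.mem_of_mem_erase hi)
  by_cases h0 : (0 : ℤ) ∈ S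
  · have hset : ⋂ i ∈ S, coupled ξ i ⁻¹' s i
        = (⋂ i ∈ S.erase 0, ξ i ⁻¹' s i) ×ˢ (ξ 0 ⁻¹' s 0) := by
      ext ω
      simp only [Set.mem_iInter, Set.mem_preimage, Set.mem_prod, Finset.mem_erase]
      constructor
      · intro hω
        refine ⟨fun i hi => ?_, ?_⟩
        · have := hω i hi.2
          rwa [coupled, if_neg hi.1] at this
        · have := hω 0 h0
          rwa [coupled, if_pos rfl] at this
      · rintro ⟨h1, h2⟩ i hi
        by_cases hi0 : i = 0
        · subst hi0
          rwa [coupled, if_pos rfl]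
        · rw [coupled, if_neg hi0]
          exact h1 i ⟨hi0, hi⟩
    rw [hset, Measure.prod_prod, h _ herase, mul_comm]
    exact Finset.mul_prod_erase S (fun i => μ (ξ i ⁻¹' s i)) h0
  · have hset : ⋂ i ∈ S, coupled ξ i ⁻¹' s i = (⋂ i ∈ S, ξ i ⁻¹' s i) ×ˢ Set.univ := by
      ext ω
      simp only [Set.mem_iInter, Set.mem_preimage, Set.mem_prod, Set.mem_univ, and_true]
      refine forall₂_congr fun i hi => ?_
      rw [coupled, if_neg fun hi0 : i = 0 => h0 (hi0 ▸ hi)]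
    rw [hset, Measure.prod_prod, measure_univ, mul_one, h _ hs]

/-- Replacing `ξ₀` by an independent copy does not change the law of the trajectory of an
independent sequence. -/
lemma pathLaw_coupled (hξ : ∀ t, Measurable (ξ t)) (h : iIndepFun ξ μ) :
    pathLaw (μ.prod μ) (coupled ξ) = pathLaw μ ξ := by
  unfold pathLaw
  rw [(iIndepFun_coupled hξ h).map_fun_eq_infinitePi_map (measurable_coupled hξ),
    h.map_fun_eq_infinitePi_map hξ]
  simp only [map_coupled hξ]

lemma past_coupled_of_neg {Ω G : Type*} (ξ : ℤ → Ω → G) {t : ℤ} (ht : t < 0) (ω : Ω × Ω) :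
    past (coupled ξ) t ω = past ξ t ω.1 := by
  funext j
  simp only [past, coupled]
  rw [if_neg (by omega)]

/-- The information carried by the trajectory up to time `t` and by the independent copy. -/
@[reducible]
def coupledPast (ξ : ℤ → Ω → G) (t : ℤ) : MeasurableSpace (Ω × Ω) :=
  MeasurableSpace.comap (fun ω : Ω × Ω => (past ξ t ω.1, ω.2)) inferInstance

omit [IsProbabilityMeasure μ] in
lemma measurable_coupledPast_past (ξ : ℤ → Ω → G) {s t : ℤ} (hst : s ≤ t) :
    Measurable[coupledPast ξ t] fun ω : Ω × Ω => past ξ s ω.1 := by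
  have hm : Measurable[coupledPast ξ t] fun ω : Ω × Ω => (past ξ t ω.1, ω.2) :=
    comap_measurable _
  have hφ : Measurable fun (y : (ℕ → G) × Ω) (j : ℕ) => y.1 ((t - s).toNat + j) :=
    measurable_pi_lambda _ fun j => (measurable_pi_apply _).comp measurable_fst
  have := hφ.comp hm
  refine (congrArg _ ?_).mp this
  funext ω j
  simp only [Function.comp, past]
  congr 1; push_cast; omega

lemma measurable_coupledPast_past_coupled (hξ : ∀ t, Measurable (ξ t)) {s t : ℤ} (hst : s ≤ t) :
    Measurable[coupledPast ξ t] (past (coupled ξ) s) := by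
  have hm : Measurable[coupledPast ξ t] fun ω : Ω × Ω => (past ξ t ω.1, ω.2) :=
    comap_measurable _
  have hφ : Measurable fun (y : (ℕ → G) × Ω) (j : ℕ) =>
      if s - j = 0 then ξ 0 y.2 else y.1 ((t - s).toNat + j) := by
    refine measurable_pi_lambda _ fun j => ?_
    split_ifs
    · exact (hξ 0).comp measurable_snd
    · exact (measurable_pi_apply _).comp measurable_fst
  have := hφ.comp hm
  refine (congrArg _ ?_).mp this
  funext ω j
  simp only [Function.comp, past, coupled]
  split_ifs
  · rfl
  · congr 1; push_cast; omega

lemma coupledPast_le (hξ : ∀ t, Measurable (ξ t)) (t : ℤ) :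
    coupledPast ξ t ≤ Prod.instMeasurableSpace :=
  Measurable.comap_le (((measurable_past hξ t).comp measurable_fst).prodMk measurable_snd)

omit [IsProbabilityMeasure μ] in
lemma indepFun_past (hξ : ∀ t, Measurable (ξ t)) (h : iIndepFun ξ μ) {s t : ℤ} (hst : s < t) :
    IndepFun (past ξ s) (ξ t) μ := by
  have hi := indep_iSup_of_disjoint (m := fun i => MeasurableSpace.comap (ξ i) inferInstance)
    (fun i => (hξ i).comap_le) h.iIndep (S := Set.Iic s) (T := {t})
    (Set.disjoint_singleton_right.2 (by simpa using hst))
  rw [IndepFun_iff_Indep]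
  refine indep_of_indep_of_le_left (indep_of_indep_of_le_right hi ?_) ?_
  · simp
  · have : MeasurableSpace.comap (past ξ s) MeasurableSpace.pi
        ≤ ⨆ n ∈ Set.Iic s, MeasurableSpace.comap (ξ n) inferInstance := by
      rw [MeasurableSpace.pi, MeasurableSpace.comap_iSup]
      refine iSup_le fun j => ?_
      rw [MeasurableSpace.comap_comp]
      exact le_iSup₂_of_le (s - j) (by simp) le_rfl
    exact this

/-- Fix the second coordinate, use the independence of `X` and `Y` on each section, and integrate.
-/
lemma indepFun_prodMk_snd {Ω' β γ : Type*} [MeasurableSpace Ω'] {μ' : Measure Ω'}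
    [IsProbabilityMeasure μ'] [MeasurableSpace β] [MeasurableSpace γ] {X : Ω → β} {Y : Ω → γ}
    (hX : Measurable X) (hY : Measurable Y) (h : IndepFun X Y μ) :
    IndepFun (fun ω : Ω × Ω' => (X ω.1, ω.2)) (fun ω => Y ω.1) (μ.prod μ') := by
  have hmX : Measurable fun ω : Ω × Ω' => (X ω.1, ω.2) :=
    (hX.comp measurable_fst).prodMk measurable_snd
  have hmY : Measurable fun ω : Ω × Ω' => Y ω.1 := hY.comp measurable_fst
  rw [indepFun_iff_measure_inter_preimage_eq_mul]
  intro s t hs ht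
  have hY' : (μ.prod μ') ((fun ω : Ω × Ω' => Y ω.1) ⁻¹' t) = μ (Y ⁻¹' t) := by
    exact measurePreserving_fst.measure_preimage (hY ht).nullMeasurableSet
  rw [hY', Measure.prod_apply_symm ((hmX hs).inter (hmY ht)), Measure.prod_apply_symm (hmX hs),
    ← lintegral_mul_const _ (measurable_measure_prodMk_right (hmX hs))]
  refine lintegral_congr fun y => ?_
  have h1 := (indepFun_iff_measure_inter_preimage_eq_mul.1 h) {b | (b, y) ∈ s} t
    (measurable_prodMk_right hs) ht
  exact h1

/-- An innovation at a later time is independent of everything built from both trajectories up to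
time `s`, the independent copy included. -/
lemma indepFun_of_measurable_coupledPast (hξ : ∀ t, Measurable (ξ t)) (h : iIndepFun ξ μ)
    {β γ : Type*} [MeasurableSpace β] [MeasurableSpace γ] {s t : ℤ} (hst : s < t)
    {X : Ω × Ω → β} (hX : Measurable[coupledPast ξ s] X) {φ : G → γ} (hφ : Measurable φ) :
    IndepFun X (fun ω => φ (ξ t ω.1)) (μ.prod μ) := by
  have h1 := indepFun_prodMk_snd (μ' := μ) (measurable_past hξ s) (hξ t) (indepFun_past hξ h hst)
  have h2 : IndepFun (fun ω : Ω × Ω => (past ξ s ω.1, ω.2)) (fun ω => φ (ξ t ω.1)) (μ.prod μ) :=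
    h1.comp measurable_id hφ
  rw [IndepFun_iff_Indep] at h2 ⊢
  exact indep_of_indep_of_le_left h2 hX.comap_le

end Coupling

/-! ### Invariance of the equation under a change of probability space. -/

section Transfer

variable {Ω Ω' G₁ E : Type*} [MeasurableSpace Ω] [MeasurableSpace Ω'] [MeasurableSpace G₁]
  [MeasurableSpace E] {μ : Measure Ω} {μ' : Measure Ω'} {q : ℕ}
  {f₁ f₂ : (Fin (q + 1) → ℝ) × E → ℝ} {ξ : ℤ → Ω → ℝ × G₁} {ξ' : ℤ → Ω' → ℝ × G₁}
  {g : (ℕ → ℝ × G₁) → ℝ} {H : (ℕ → G₁) → E}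

/-- With `Z` and `Y` written as functionals of the innovations, the equation at time `t` is a
measurable event of their trajectory, so its validity depends only on the path law. -/
lemma isSolution_of_pathLaw_eq (hf₁ : Measurable f₁) (hf₂ : Measurable f₂) (hg : Measurable g)
    (hH : Measurable H) (hξ : ∀ t, Measurable (ξ t)) (hξ' : ∀ t, Measurable (ξ' t))
    (hlaw : pathLaw μ' ξ' = pathLaw μ ξ)
    (hsol : IsSolution μ f₁ f₂ (fun t ω => H (past (fun t ω => (ξ t ω).2) t ω))
      (fun t ω => (ξ t ω).1) fun t ω => g (past ξ t ω)) :
    IsSolution μ' f₁ f₂ (fun t ω => H (past (fun t ω => (ξ' t ω).2) t ω))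
      (fun t ω => (ξ' t ω).1) fun t ω => g (past ξ' t ω) := by
  intro t
  set X : ℤ → (ℤ → ℝ × G₁) → ℝ × G₁ := fun t y => y t
  have hX : ∀ t, Measurable (X t) := fun t => measurable_pi_apply t
  set Y : ℤ → (ℤ → ℝ × G₁) → ℝ := fun t y => g (past X t y)
  set Z : ℤ → (ℤ → ℝ × G₁) → E := fun t y => H (past (fun t y => (X t y).2) t y)
  have hY : ∀ t, Measurable (Y t) := fun t => hg.comp (measurable_past hX t)
  have hZ : ∀ t, Measurable (Z t) := fun t =>
    hH.comp (measurable_past (fun t => measurable_snd.comp (hX t)) t)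
  have hset : MeasurableSet {y | Y t y = f₁ (lags (q + 1) Y t y, Z (t - 1) y)
      + (X t y).1 * f₂ (lags (q + 1) Y t y, Z (t - 1) y)} :=
    measurableSet_eq_fun (hY t) ((hf₁.comp ((measurable_lags hY t).prodMk (hZ _))).add
      ((measurable_fst.comp (hX t)).mul (hf₂.comp ((measurable_lags hY t).prodMk (hZ _)))))
  have h1 := (ae_map_iff (measurable_path hξ).aemeasurable hset).2 (hsol t)
  rw [show μ.map (fun ω t => ξ t ω) = μ'.map (fun ω t => ξ' t ω) from hlaw.symm] at h1
  exact (ae_map_iff (measurable_path hξ').aemeasurable hset).1 h1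

lemma eLpNorm_past_eq_of_pathLaw_eq (hg : Measurable g) (hξ : ∀ t, Measurable (ξ t))
    (hξ' : ∀ t, Measurable (ξ' t)) (hlaw : pathLaw μ' ξ' = pathLaw μ ξ) (p : ℝ≥0∞) (t : ℤ) :
    eLpNorm (fun ω => g (past ξ' t ω)) p μ' = eLpNorm (fun ω => g (past ξ t ω)) p μ := by
  have hm : Measurable fun y : ℤ → ℝ × G₁ => g fun j : ℕ => y (t - j) :=
    hg.comp (measurable_pi_lambda _ fun _ => measurable_pi_apply _)
  have h1 := eLpNorm_map_measure (p := p) (μ := μ) hm.aestronglyMeasurable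
    (measurable_path hξ).aemeasurable
  have h2 := eLpNorm_map_measure (p := p) (μ := μ') hm.aestronglyMeasurable
    (measurable_path hξ').aemeasurable
  rw [show μ.map (fun ω t => ξ t ω) = μ'.map (fun ω t => ξ' t ω) from hlaw.symm] at h1
  exact h2.symm.trans h1

end Transfer

/-! ### Bernoulli shift representation of the solution. -/

section InnovationPast

variable {Ω G₁ E : Type*} [MeasurableSpace Ω] {μ : Measure Ω} {q : ℕ}
  {f₁ f₂ : (Fin (q + 1) → ℝ) × E → ℝ} {Z : ℤ → Ω → E} {ε Y : ℤ → Ω → ℝ} {η : ℤ → Ω → G₁}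
  {H : (ℕ → G₁) → E} {v₀ : Fin (q + 1) → ℝ}

/-- Reads the past of the covariate/noise process from the past of the innovations. -/
def readPast (H : (ℕ → G₁) → E) (x : ℕ → ℝ × G₁) : ℕ → E × ℝ :=
  fun k => (H fun j => (x (k + j)).2, (x k).1)

variable [MeasurableSpace G₁] [MeasurableSpace E]

lemma isBernoulliShift_stateLimit (hf₁ : Measurable f₁) (hf₂ : Measurable f₂)
    (hB : IsBernoulliShift μ η H Z)
    (hY : ∀ t, Y t =ᵐ[μ] fun ω => stateLimit f₁ f₂ v₀ (past (fun t ω => (Z t ω, ε t ω)) t ω)) :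
    IsBernoulliShift μ (fun t ω => (ε t ω, η t ω))
      (fun x => stateLimit f₁ f₂ v₀ (readPast H x)) Y := by
  refine ⟨(measurable_stateLimit hf₁ hf₂ v₀).comp (measurable_pi_lambda _ fun k => ?_), fun t => ?_⟩
  · exact (hB.measurable.comp (measurable_pi_lambda _ fun j =>
      measurable_snd.comp (measurable_pi_apply _))).prodMk
      (measurable_fst.comp (measurable_pi_apply _))
  · filter_upwards [hY t, ae_all_iff.2 hB.eq_ae] with ω hω hZ
    rw [hω]
    congr 1
    funext k
    refine Prod.ext ((hZ _).trans (congrArg H (funext fun j => ?_))) rfl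
    change η (t - k - j) ω = η (t - (k + j : ℕ)) ω
    rw [show t - k - j = t - (k + j : ℕ) by push_cast; ring]

/-- Replaces almost sure representations by exact functionals of the innovations, which can be
evaluated on the coupled trajectory. -/
lemma isSolution_congr (hB : IsBernoulliShift μ η H Z) {Y' : ℤ → Ω → ℝ}
    (hY : ∀ t, ∀ᵐ ω ∂μ, Y t ω = Y' t ω) (hsol : IsSolution μ f₁ f₂ Z ε Y) :
    IsSolution μ f₁ f₂ (fun t ω => H (past η t ω)) ε Y' := by
  intro t
  filter_upwards [ae_all_iff.2 hY, hB.eq_ae (t - 1), hsol t] with ω hω hZ hs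
  have hl : lags (q + 1) Y' t ω = lags (q + 1) Y t ω := funext fun i => (hω _).symm
  rw [hl, ← hω, ← hZ, hs]

end InnovationPast

/-! ### Part 3: functional dependence measures. -/

section Dependence

variable {Ω : Type*} {mΩ : MeasurableSpace Ω} {μ : Measure Ω} [IsProbabilityMeasure μ]
  {V : Type*} [NormedAddCommGroup V] {E₁ : Set V} {G₁ : Type*} [MeasurableSpace G₁] {q : ℕ}
  {f₁ f₂ : (Fin (q + 1) → ℝ) × E₁ → ℝ} {a₁ a₂ : Fin (q + 1) → E₁ → ℝ≥0}
  {L₁ L₂ : (Fin (q + 1) → ℝ) → ℝ}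

/-- The comparison passes through `(y, z')`, so that `L` is evaluated at the lags of the original
solution, where its moment is assumed. The absolute value covers `E₁` with at most one point, where
`L` may be negative. -/
lemma abs_model_sub_le (h₁ : LipschitzInLags f₁ a₁) (h₂ : LipschitzInLags f₂ a₂)
    (hL₁ : ∀ y (z z' : E₁), |f₁ (y, z) - f₁ (y, z')| ≤ L₁ y * ‖(z : V) - (z' : V)‖)
    (hL₂ : ∀ y (z z' : E₁), |f₂ (y, z) - f₂ (y, z')| ≤ L₂ y * ‖(z : V) - (z' : V)‖)
    (y y' : Fin (q + 1) → ℝ) (z z' : E₁) (e : ℝ) :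
    |(f₁ (y, z) + e * f₂ (y, z)) - (f₁ (y', z') + e * f₂ (y', z'))|
      ≤ ∑ j, ((a₁ j z' : ℝ) + (a₂ j z' : ℝ) * |e|) * |y j - y' j|
        + (|L₁ y| * ‖(z : V) - (z' : V)‖ + |e| * (|L₂ y| * ‖(z : V) - (z' : V)‖)) := by
  have hf : ∀ (f : (Fin (q + 1) → ℝ) × E₁ → ℝ) (a : Fin (q + 1) → E₁ → ℝ≥0)
      (L : (Fin (q + 1) → ℝ) → ℝ), LipschitzInLags f a →
      (∀ y (z z' : E₁), |f (y, z) - f (y, z')| ≤ L y * ‖(z : V) - (z' : V)‖) →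
      |f (y, z) - f (y', z')| ≤ ∑ j, (a j z' : ℝ) * |y j - y' j|
        + |L y| * ‖(z : V) - (z' : V)‖ := by
    intro f a L hf hL
    have h3 := abs_sub_le (f (y, z)) (f (y, z')) (f (y', z'))
    have h4 := hL y z z'
    have h5 := hf y y' z'
    have h6 : L y * ‖(z : V) - (z' : V)‖ ≤ |L y| * ‖(z : V) - (z' : V)‖ :=
      mul_le_mul_of_nonneg_right (le_abs_self _) (norm_nonneg _)
    linarith
  have e1 : (f₁ (y, z) + e * f₂ (y, z)) - (f₁ (y', z') + e * f₂ (y', z'))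
      = (f₁ (y, z) - f₁ (y', z')) + e * (f₂ (y, z) - f₂ (y', z')) := by ring
  have e2 : ∑ j, ((a₁ j z' : ℝ) + (a₂ j z' : ℝ) * |e|) * |y j - y' j|
      = ∑ j, (a₁ j z' : ℝ) * |y j - y' j| + |e| * ∑ j, (a₂ j z' : ℝ) * |y j - y' j| := by
    rw [Finset.mul_sum, ← Finset.sum_add_distrib]
    exact Finset.sum_congr rfl fun j _ => by ring
  rw [e1, e2]
  have h7 := abs_add_le (f₁ (y, z) - f₁ (y', z')) (e * (f₂ (y, z) - f₂ (y', z')))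
  rw [abs_mul] at h7
  have h8 := hf f₁ a₁ L₁ h₁ hL₁
  have h9 := mul_le_mul_of_nonneg_left (hf f₂ a₂ L₂ h₂ hL₂) (abs_nonneg e)
  rw [mul_add] at h9
  linarith

variable [MeasurableSpace V] [BorelSpace V] [SecondCountableTopology V]
  {ε : ℤ → Ω → ℝ} {η : ℤ → Ω → G₁} {H : (ℕ → G₁) → E₁} {g : (ℕ → ℝ × G₁) → ℝ}

/-- The recursive inequality satisfied by the functional dependence measures. -/
lemma eLpNorm_sub_coupled_le
    (hf₁ : Measurable f₁) (hf₂ : Measurable f₂)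
    (ha₁ : ∀ i, Measurable (a₁ i)) (ha₂ : ∀ i, Measurable (a₂ i))
    (h₁ : LipschitzInLags f₁ a₁) (h₂ : LipschitzInLags f₂ a₂)
    (hLm₁ : Measurable L₁) (hLm₂ : Measurable L₂)
    (hL₁ : ∀ y (z z' : E₁), |f₁ (y, z) - f₁ (y, z')| ≤ L₁ y * ‖(z : V) - (z' : V)‖)
    (hL₂ : ∀ y (z z' : E₁), |f₂ (y, z) - f₂ (y, z')| ≤ L₂ y * ‖(z : V) - (z' : V)‖)
    (hε : ∀ t, Measurable (ε t)) (hη : ∀ t, Measurable (η t))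
    (hiid : iIndepFun (fun t ω => (ε t ω, η t ω)) μ)
    {p : ℝ} (hp : 1 ≤ p) {r s : ℝ≥0∞} (hrs : s.HolderTriple r (ENNReal.ofReal p))
    {α : Fin (q + 1) → ℝ≥0∞}
    (hα : ∀ t j z, eLpNorm (fun ω => (a₁ j z : ℝ) + (a₂ j z : ℝ) * |ε t ω|) (ENNReal.ofReal p) μ
      ≤ α j)
    (hH : Measurable H) (hg : Measurable g)
    (hsol : IsSolution μ f₁ f₂ (fun t ω => H (past η t ω)) ε
      fun t ω => g (past (fun t ω => (ε t ω, η t ω)) t ω))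
    {κ k₁ k₂ : ℝ≥0∞} (hκ : ∀ t, eLpNorm (ε t) (ENNReal.ofReal p) μ ≤ κ)
    (hk₁ : ∀ t, eLpNorm (fun ω => L₁ (lags (q + 1)
      (fun t ω => g (past (fun t ω => (ε t ω, η t ω)) t ω)) t ω)) s μ ≤ k₁)
    (hk₂ : ∀ t, eLpNorm (fun ω => L₂ (lags (q + 1)
      (fun t ω => g (past (fun t ω => (ε t ω, η t ω)) t ω)) t ω)) s μ ≤ k₂)
    {t : ℤ} (ht : 0 < t) :
    eLpNorm (fun ω : Ω × Ω => g (past (fun t ω => (ε t ω, η t ω)) t ω.1)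
        - g (past (coupled fun t ω => (ε t ω, η t ω)) t ω)) (ENNReal.ofReal p) (μ.prod μ)
      ≤ ∑ j : Fin (q + 1), α j * eLpNorm (fun ω : Ω × Ω =>
          g (past (fun t ω => (ε t ω, η t ω)) (t - 1 - (j : ℕ)) ω.1)
          - g (past (coupled fun t ω => (ε t ω, η t ω)) (t - 1 - (j : ℕ)) ω))
          (ENNReal.ofReal p) (μ.prod μ)
        + (k₁ + κ * k₂) * eLpNorm (fun ω : Ω × Ω => (H (past η (t - 1) ω.1) : V)
          - (H (past (coupled η) (t - 1) ω) : V)) r (μ.prod μ) := by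
  set ξ : ℤ → Ω → ℝ × G₁ := fun t ω => (ε t ω, η t ω) with hξdef
  set P : ℝ≥0∞ := ENNReal.ofReal p with hP
  have hP1 : 1 ≤ P := by simpa [hP] using hp
  have hξ : ∀ t, Measurable (ξ t) := fun t => (hε t).prodMk (hη t)
  have hcξ : ∀ t, Measurable (coupled ξ t) := measurable_coupled hξ
  have hsnd : ∀ (t : ℤ) (ω : Ω × Ω),
      past (coupled η) t ω = fun j => (past (coupled ξ) t ω j).2 := by
    intro t ω; funext j
    simp only [past, coupled, hξdef]
    split_ifs <;> rfl
  have hsndm : Measurable fun (x : ℕ → ℝ × G₁) (j : ℕ) => (x j).2 :=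
    measurable_pi_lambda _ fun j => measurable_snd.comp (measurable_pi_apply j)
  -- the two solutions, their covariates and the noise on the product space
  set y : ℤ → Ω × Ω → ℝ := fun t ω => g (past ξ t ω.1) with hy
  set y' : ℤ → Ω × Ω → ℝ := fun t ω => g (past (coupled ξ) t ω) with hy'
  set z : Ω × Ω → E₁ := fun ω => H (past η (t - 1) ω.1) with hz
  set z' : Ω × Ω → E₁ := fun ω => H (past (coupled η) (t - 1) ω) with hz'
  set e : Ω × Ω → ℝ := fun ω => ε t ω.1 with he
  have hle := coupledPast_le hξ (t - 1)
  have hyF : ∀ s ≤ t - 1, Measurable[coupledPast ξ (t - 1)] (y s) := fun s hs =>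
    hg.comp (measurable_coupledPast_past ξ hs)
  have hy'F : ∀ s ≤ t - 1, Measurable[coupledPast ξ (t - 1)] (y' s) := fun s hs =>
    hg.comp (measurable_coupledPast_past_coupled hξ hs)
  have hzF : Measurable[coupledPast ξ (t - 1)] z :=
    (hH.comp hsndm).comp (measurable_coupledPast_past ξ le_rfl)
  have hz'F : Measurable[coupledPast ξ (t - 1)] z' := by
    have h3 := (hH.comp hsndm).comp (measurable_coupledPast_past_coupled hξ (le_refl (t - 1)))
    simp only [hz', hsnd]
    exact h3
  have hlagF : Measurable[coupledPast ξ (t - 1)] (lags (q + 1) y t) :=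
    @measurable_pi_lambda _ _ _ (coupledPast ξ (t - 1)) _ _ fun j => hyF _ (by omega)
  have hym := fun s hs => (hyF s hs).mono hle le_rfl
  have hy'm := fun s hs => (hy'F s hs).mono hle le_rfl
  have hzm := hzF.mono hle le_rfl
  have hz'm := hz'F.mono hle le_rfl
  have hlagm := hlagF.mono hle le_rfl
  have hem : Measurable e := (hε t).comp measurable_fst
  -- both processes solve the equation at time `t`
  have hsol1 : ∀ᵐ ω ∂(μ.prod μ), y t ω = f₁ (lags (q + 1) y t ω, z ω)
      + e ω * f₂ (lags (q + 1) y t ω, z ω) :=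
    (measurePreserving_fst (μ := μ) (ν := μ)).quasiMeasurePreserving.ae (hsol t)
  -- The coupled trajectory has the same path law, so it solves the equation too; since `t > 0`, its
  -- noise at time `t` is still `e`.
  have hsol2 : ∀ᵐ ω ∂(μ.prod μ), y' t ω = f₁ (lags (q + 1) y' t ω, z' ω)
      + e ω * f₂ (lags (q + 1) y' t ω, z' ω) := by
    have h3 := isSolution_of_pathLaw_eq hf₁ hf₂ hg hH hξ hcξ (pathLaw_coupled hξ hiid) hsol t
    filter_upwards [h3] with ω hω
    have h4 : (coupled ξ t ω).1 = e ω := by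
      simp only [coupled, if_neg ht.ne', hξdef, he]
    rw [h4] at hω
    simp only [hz', hsnd]
    exact hω
  set S : Ω × Ω → ℝ := fun ω => ∑ j, ((a₁ j (z' ω) : ℝ) + (a₂ j (z' ω) : ℝ) * |e ω|)
    * |y (t - 1 - (j : ℕ)) ω - y' (t - 1 - (j : ℕ)) ω| with hS
  set Q : ((Fin (q + 1) → ℝ) → ℝ) → Ω × Ω → ℝ := fun L ω =>
    |L (lags (q + 1) y t ω)| * ‖(z ω : V) - (z' ω : V)‖ with hQ
  have hptw : ∀ᵐ ω ∂(μ.prod μ), ‖y t ω - y' t ω‖ ≤ S ω + (Q L₁ ω + |e ω| * Q L₂ ω) := by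
    filter_upwards [hsol1, hsol2] with ω hω hω'
    rw [hω, hω', Real.norm_eq_abs]
    exact abs_model_sub_le h₁ h₂ hL₁ hL₂ _ _ _ _ _
  have hzzm : Measurable fun ω => (z ω : V) - (z' ω : V) :=
    (measurable_subtype_coe.comp hzm).sub (measurable_subtype_coe.comp hz'm)
  have hQm : ∀ {L : (Fin (q + 1) → ℝ) → ℝ}, Measurable L → Measurable (Q L) := fun hL =>
    (hL.comp hlagm).abs.mul hzzm.norm
  have hQF : ∀ {L : (Fin (q + 1) → ℝ) → ℝ}, Measurable L →
      Measurable[coupledPast ξ (t - 1)] (Q L) := fun {L} hL => by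
    have hΦ : Measurable fun w : (Fin (q + 1) → ℝ) × E₁ × E₁ =>
        |L w.1| * ‖(w.2.1 : V) - (w.2.2 : V)‖ :=
      (hL.comp measurable_fst).abs.mul
        ((measurable_subtype_coe.comp (measurable_fst.comp measurable_snd)).sub
          (measurable_subtype_coe.comp (measurable_snd.comp measurable_snd))).norm
    exact hΦ.comp (hlagF.prodMk (hzF.prodMk hz'F))
  have hcm : ∀ j, Measurable fun ω => (a₁ j (z' ω) : ℝ) + (a₂ j (z' ω) : ℝ) * |e ω| := fun j =>
    ((ha₁ j).comp hz'm).coe_nnreal_real.add (((ha₂ j).comp hz'm).coe_nnreal_real.mul hem.abs)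
  have hSm : Measurable S := Finset.measurable_sum _ fun j _ =>
    (hcm j).mul ((hym _ (by omega)).sub (hy'm _ (by omega))).abs
  have hfst : ∀ {F : Ω → ℝ}, Measurable F → ∀ m : ℝ≥0∞,
      eLpNorm (fun ω : Ω × Ω => F ω.1) m (μ.prod μ) = eLpNorm F m μ := fun hF m =>
    eLpNorm_comp_measurePreserving hF.aestronglyMeasurable measurePreserving_fst
  have hSn : eLpNorm S P (μ.prod μ) ≤ ∑ j : Fin (q + 1), α j * eLpNorm
      (fun ω => y (t - 1 - (j : ℕ)) ω - y' (t - 1 - (j : ℕ)) ω) P (μ.prod μ) := by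
    have hXF : ∀ j : Fin (q + 1), Measurable[coupledPast ξ (t - 1)] fun ω =>
        |y (t - 1 - (j : ℕ)) ω - y' (t - 1 - (j : ℕ)) ω| := fun j => by
      have hΦ : Measurable fun w : ℝ × ℝ => |w.1 - w.2| :=
        (measurable_fst.sub measurable_snd).abs
      exact hΦ.comp ((hyF _ (by omega)).prodMk (hy'F _ (by omega)))
    have h3 := eLpNorm_sum_coeff_mul_le (μ := μ.prod μ) (ζ := z') (e := e)
      (X := fun (j : Fin (q + 1)) ω => |y (t - 1 - (j : ℕ)) ω - y' (t - 1 - (j : ℕ)) ω|)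
      ha₁ ha₂ hz'm hem (fun j => (hXF j).mono hle le_rfl)
      (fun j => indepFun_of_measurable_coupledPast hξ hiid (by omega : t - 1 < t)
        (hz'F.prodMk (hXF j)) measurable_fst) hp (α := α) (fun j z => by
          have h4 := hfst (F := fun ω => (a₁ j z : ℝ) + (a₂ j z : ℝ) * |ε t ω|)
            (measurable_const.add (measurable_const.mul (hε t).abs)) P
          exact h4.le.trans (hα t j z))
    refine h3.trans (le_of_eq (Finset.sum_congr rfl fun j _ => ?_))
    congr 1
    exact eLpNorm_norm fun ω => y (t - 1 - (j : ℕ)) ω - y' (t - 1 - (j : ℕ)) ω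
  set θ : ℝ≥0∞ := eLpNorm (fun ω => (z ω : V) - (z' ω : V)) r (μ.prod μ) with hθ
  have hQn : ∀ {L : (Fin (q + 1) → ℝ) → ℝ} {k : ℝ≥0∞}, Measurable L →
      (∀ t, eLpNorm (fun ω => L (lags (q + 1) (fun t ω => g (past ξ t ω)) t ω)) s μ ≤ k) →
      eLpNorm (Q L) P (μ.prod μ) ≤ k * θ := by
    intro L k hL hk
    have h3 : eLpNorm (fun ω => L (lags (q + 1) y t ω)) s (μ.prod μ) ≤ k :=
      (hfst (F := fun ω => L (lags (q + 1) (fun t ω => g (past ξ t ω)) t ω))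
        (hL.comp (measurable_lags (fun t => hg.comp (measurable_past hξ t)) t)) s).le.trans (hk t)
    -- Hölder with exponents `s` and `r`.
    have h4 := eLpNorm_le_eLpNorm_mul_eLpNorm'_of_norm (μ := μ.prod μ) (p := s) (q := r) (r := P)
      (f := fun ω => L (lags (q + 1) y t ω)) (g := fun ω => ‖(z ω : V) - (z' ω : V)‖)
      (hL.comp hlagm).aestronglyMeasurable hzzm.norm.aestronglyMeasurable (fun a b => |a| * b) 1
      (Eventually.of_forall fun ω => by simp)
    refine h4.trans ?_
    rw [eLpNorm_norm, ENNReal.coe_one, one_mul]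
    exact mul_le_mul_left h3 _
  -- `e` is independent of `Q L₂`, so the norm of the product factors and only a moment of order `p`
  -- of the noise is needed. The parameter `W` is trivial here.
  have heQ : eLpNorm (fun ω => |e ω| * Q L₂ ω) P (μ.prod μ) ≤ κ * (k₂ * θ) := by
    have h3 := eLpNorm_mul_le_of_indepFun (μ := μ.prod μ) (W := fun _ : Ω × Ω => ())
      (X := Q L₂) (e := e) measurable_const (hQm hLm₂) hem
      (indepFun_of_measurable_coupledPast hξ hiid (by omega : t - 1 < t)
        (Measurable.prodMk measurable_const (hQF hLm₂)) measurable_fst)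
      (k := fun _ v => |v|) measurable_snd.abs hp (α := κ) (fun _ => by
        have h5 : eLpNorm (fun ω => |e ω|) P (μ.prod μ) = eLpNorm e P (μ.prod μ) := eLpNorm_norm e
        rw [h5]
        exact (hfst (hε t) P).le.trans (hκ t))
    exact h3.trans (mul_le_mul_right (hQn hLm₂ hk₂) _)
  calc eLpNorm (fun ω => y t ω - y' t ω) P (μ.prod μ)
      ≤ eLpNorm (fun ω => S ω + (Q L₁ ω + |e ω| * Q L₂ ω)) P (μ.prod μ) :=
        eLpNorm_mono_ae_real hptw
    _ ≤ eLpNorm S P (μ.prod μ) + (eLpNorm (Q L₁) P (μ.prod μ)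
          + eLpNorm (fun ω => |e ω| * Q L₂ ω) P (μ.prod μ)) := by
        have hm2 : Measurable fun ω => |e ω| * Q L₂ ω := hem.abs.mul (hQm hLm₂)
        refine (eLpNorm_add_le hSm.aestronglyMeasurable
          ((hQm hLm₁).add hm2).aestronglyMeasurable hP1).trans (add_le_add le_rfl ?_)
        exact eLpNorm_add_le (hQm hLm₁).aestronglyMeasurable hm2.aestronglyMeasurable hP1
    _ ≤ _ := by
        refine add_le_add hSn ?_
        rw [add_mul, mul_assoc]
        exact add_le_add (hQn hLm₁ hk₁) heQ

variable {Z : ℤ → Ω → E₁} {Y : ℤ → Ω → ℝ}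

/-- Control of the functional dependence measures of a stationary solution by those of the
covariates. -/
theorem exists_Theta_le (hf₁ : Measurable f₁) (hf₂ : Measurable f₂)
    (hZε : IsStationaryErgodic μ fun t ω => (Z t ω, ε t ω))
    (ha₁ : ∀ i, Measurable (a₁ i)) (ha₂ : ∀ i, Measurable (a₂ i))
    (h₁ : LipschitzInLags f₁ a₁) (h₂ : LipschitzInLags f₂ a₂)
    (hε : ∀ t, Measurable (ε t)) {p : ℝ} (hp : 1 ≤ p)
    (hα : (∑ i, ⨆ z : E₁, eLpNorm (fun ω => (a₁ i z : ℝ) + (a₂ i z : ℝ) * |ε 1 ω|)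
        (ENNReal.ofReal p) μ) < 1)
    {r : ℝ} {s : ℝ≥0∞} (hrs : (ENNReal.ofReal r)⁻¹ + s⁻¹ = (ENNReal.ofReal p)⁻¹)
    (hεp : MemLp (ε 1) (ENNReal.ofReal p) μ) (hLm₁ : Measurable L₁) (hLm₂ : Measurable L₂)
    (hL₁ : ∀ y (z z' : E₁), |f₁ (y, z) - f₁ (y, z')| ≤ L₁ y * ‖(z : V) - (z' : V)‖)
    (hL₂ : ∀ y (z z' : E₁), |f₂ (y, z) - f₂ (y, z')| ≤ L₂ y * ‖(z : V) - (z' : V)‖)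
    (hη : ∀ t, Measurable (η t)) (hB : IsBernoulliShift μ η H Z)
    (hiid : iIndepFun (fun t ω => (ε t ω, η t ω)) μ)
    (hY : IsStationary μ Y) (hsol : IsSolution μ f₁ f₂ Z ε Y)
    (hYp : MemLp (Y 0) (ENNReal.ofReal p) μ) {t₀ : ℤ}
    (hYL₁ : MemLp (fun ω => L₁ (lags (q + 1) Y t₀ ω)) s μ)
    (hYL₂ : MemLp (fun ω => L₂ (lags (q + 1) Y t₀ ω)) s μ) :
    ∃ C : ℝ, 0 < C ∧ ∃ ρ : ℝ, 0 < ρ ∧ ρ < 1 ∧ ∀ g : (ℕ → ℝ × G₁) → ℝ,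
      IsBernoulliShift μ (fun t ω => (ε t ω, η t ω)) g Y → ∀ h : ℕ, 1 ≤ h →
        Theta μ (fun t ω => (ε t ω, η t ω)) g p h ≤
          ENNReal.ofReal C * (ENNReal.ofReal (ρ ^ h) +
            ∑ i ∈ Finset.Icc 1 h, ENNReal.ofReal (ρ ^ i) *
              Theta μ η (fun x => (H x : V)) r (h - i)) := by
  set P : ℝ≥0∞ := ENNReal.ofReal p with hP
  have hP1 : 1 ≤ P := by simpa [hP] using hp
  obtain ⟨ρ, hρ0, hρ1, hρ⟩ := exists_geometric_rate hα
  set κ : ℝ≥0∞ := eLpNorm (ε 1) P μ with hκ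
  set k₁ : ℝ≥0∞ := eLpNorm (fun ω => L₁ (lags (q + 1) Y t₀ ω)) s μ with hk₁
  set k₂ : ℝ≥0∞ := eLpNorm (fun ω => L₂ (lags (q + 1) Y t₀ ω)) s μ with hk₂
  have hK : k₁ + κ * k₂ ≠ ⊤ := ENNReal.add_ne_top.2 ⟨hYL₁.eLpNorm_ne_top,
    ENNReal.mul_ne_top hεp.eLpNorm_ne_top hYL₂.eLpNorm_ne_top⟩
  have hM : eLpNorm (Y 0) P μ + eLpNorm (Y 0) P μ ≠ ⊤ :=
    ENNReal.add_ne_top.2 ⟨hYp.eLpNorm_ne_top, hYp.eLpNorm_ne_top⟩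
  -- The constants involve only `Y`, `ε` and the dependence measures of `Z`, so `C` and `ρ` are
  -- fixed before the representation `g`.
  obtain ⟨C, hC0, hC⟩ := exists_const_tail_sum_le hα hK hM hρ0 hρ1 hρ
    (fun n => theta μ η (fun x => (H x : V)) r n)
  refine ⟨C, hC0, ρ, by exact_mod_cast hρ0, by exact_mod_cast hρ1, fun g hg h hh => ?_⟩
  set ξ : ℤ → Ω → ℝ × G₁ := fun t ω => (ε t ω, η t ω) with hξdef
  have hξ : ∀ t, Measurable (ξ t) := fun t => (hε t).prodMk (hη t)
  set d : ℤ → ℝ≥0∞ := fun t => eLpNorm (fun ω : Ω × Ω => g (past ξ t ω.1)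
    - g (past (coupled ξ) t ω)) P (μ.prod μ) with hd
  have hgm : ∀ t, Measurable fun ω => g (past ξ t ω) := fun t =>
    hg.measurable.comp (measurable_past hξ t)
  have hgm' : ∀ t, Measurable fun ω => g (past (coupled ξ) t ω) := fun t =>
    hg.measurable.comp (measurable_past (measurable_coupled hξ) t)
  have hneg : ∀ t < 0, d t = 0 := by
    intro t ht
    simp only [hd, past_coupled_of_neg ξ ht, sub_self]
    exact eLpNorm_zero'
  have hgY : ∀ t, eLpNorm (fun ω => g (past ξ t ω)) P μ = eLpNorm (Y 0) P μ := by
    intro t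
    have h3 : ∀ k, eLpNorm (Y k) P μ = eLpNorm id P (μ.map (Y k)) := fun k =>
      (eLpNorm_map_measure measurable_id.aestronglyMeasurable (hY.measurable k).aemeasurable).symm
    rw [← eLpNorm_congr_ae (hg.eq_ae t), h3, hY.map_eq t 0, ← h3]
  have hdM : ∀ t, d t ≤ eLpNorm (Y 0) P μ + eLpNorm (Y 0) P μ := by
    intro t
    refine (eLpNorm_sub_le ((hgm t).comp measurable_fst).aestronglyMeasurable
      (hgm' t).aestronglyMeasurable hP1).trans (add_le_add ?_ ?_)
    · rw [← hgY t]
      exact (eLpNorm_comp_measurePreserving (hgm t).aestronglyMeasurable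
        (measurePreserving_fst (μ := μ) (ν := μ))).le
    · rw [← hgY t]
      exact (eLpNorm_past_eq_of_pathLaw_eq hg.measurable hξ (measurable_coupled hξ)
        (pathLaw_coupled hξ hiid) P t).le
  have hlagL : ∀ {L : (Fin (q + 1) → ℝ) → ℝ}, Measurable L → ∀ t,
      eLpNorm (fun ω => L (lags (q + 1) (fun t ω => g (past ξ t ω)) t ω)) s μ
        ≤ eLpNorm (fun ω => L (lags (q + 1) Y t₀ ω)) s μ := by
    intro L hL t
    have h3 : (fun ω => L (lags (q + 1) (fun t ω => g (past ξ t ω)) t ω))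
        =ᵐ[μ] fun ω => L (lags (q + 1) Y t ω) := by
      filter_upwards [ae_all_iff.2 hg.eq_ae] with ω hω
      congr 1
      exact funext fun i => (hω _).symm
    have h4 : ∀ k, eLpNorm (fun ω => L (lags (q + 1) Y k ω)) s μ
        = eLpNorm L s (μ.map (lags (q + 1) Y k)) := fun k =>
      (eLpNorm_map_measure hL.aestronglyMeasurable
        (measurable_lags hY.measurable k).aemeasurable).symm
    rw [eLpNorm_congr_ae h3, h4, hY.map_lags t t₀, ← h4]
  have hκt : ∀ t, eLpNorm (ε t) P μ ≤ κ := by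
    intro t
    have h3 := eLpNorm_noise_coeff_eq hZε 0 1 P t 1
    simp only [zero_add, one_mul] at h3
    have h4 : ∀ k, eLpNorm (fun ω => |ε k ω|) P μ = eLpNorm (ε k) P μ := fun k =>
      eLpNorm_norm (ε k)
    rw [h4, h4] at h3
    exact h3.le
  have hrec : ∀ n : ℕ, d ((n : ℤ) + 1) ≤ ∑ j : Fin (q + 1),
      (⨆ z : E₁, eLpNorm (fun ω => (a₁ j z : ℝ) + (a₂ j z : ℝ) * |ε 1 ω|) P μ)
        * d ((n : ℤ) - (j : ℕ)) + (k₁ + κ * k₂) * theta μ η (fun x => (H x : V)) r n := by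
    intro n
    have h3 := eLpNorm_sub_coupled_le hf₁ hf₂ ha₁ ha₂ h₁ h₂ hLm₁ hLm₂ hL₁ hL₂ hε hη hiid hp
      (r := ENNReal.ofReal r) (s := s) ⟨by rw [add_comm]; exact hrs⟩
      (fun t j z => by
        rw [eLpNorm_noise_coeff_eq hZε _ _ _ t 1]
        exact le_iSup (fun z : E₁ => eLpNorm (fun ω => (a₁ j z : ℝ)
          + (a₂ j z : ℝ) * |ε 1 ω|) P μ) z) hB.measurable hg.measurable
      (isSolution_congr hB hg.eq_ae hsol) hκt (hlagL hLm₁) (hlagL hLm₂)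
      (t := (n : ℤ) + 1) (by omega)
    simp only [add_sub_cancel_right] at h3
    exact h3
  have hmain := hC d hneg hdM hrec h hh
  have hTh : Theta μ ξ g p h = ∑' n : ℕ, d ((h : ℤ) + n) := by
    refine tsum_congr fun n => ?_
    simp only [theta, hd, Nat.cast_add]
    rfl
  rw [hTh]
  exact hmain

end Dependence

end CHARN

end

/-! ### The three parts assembled. -/

theorem mainTheorem7
    {Ω : Type*} {mΩ : MeasurableSpace Ω} (μ : Measure Ω) [IsProbabilityMeasure μ]
    {V : Type*} [NormedAddCommGroup V] [NormedSpace ℝ V] [FiniteDimensional ℝ V]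
    [MeasurableSpace V] [BorelSpace V] (E₁ : Set V) (hE₁ : MeasurableSet E₁)
    {G₁ : Type*} [MeasurableSpace G₁]
    (q : ℕ) (hq : 1 ≤ q)
    (f₁ f₂ : (Fin q → ℝ) × E₁ → ℝ) (hf₁ : Measurable f₁) (hf₂ : Measurable f₂)
    (Z : ℤ → Ω → E₁) (ε : ℤ → Ω → ℝ)
    -- the covariate/noise process is stationary and ergodic
    (hZε : CHARN.IsStationaryErgodic μ (fun t ω => (Z t ω, ε t ω)))
    -- Lipschitz coefficients
    (a₁ a₂ : Fin q → E₁ → ℝ≥0) (ha₁ : ∀ i, Measurable (a₁ i)) (ha₂ : ∀ i, Measurable (a₂ i))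
    (hLip₁ : CHARN.LipschitzInLags f₁ a₁) (hLip₂ : CHARN.LipschitzInLags f₂ a₂) :
    -- Part 1: negative Lyapunov exponent, for an arbitrary norm `N` on the matrices
    (∀ (N : Seminorm ℝ (Matrix (Fin q) (Fin q) ℝ)), (∀ M, N M = 0 → M = 0) →
      Integrable (fun ω => Real.posLog (N (CHARN.companion a₁ a₂ Z ε 1 ω))) μ →
      (∃ x : Fin q → ℝ, Integrable
        (fun ω => Real.posLog |f₁ (x, Z 0 ω) + ε 1 ω * f₂ (x, Z 0 ω)|) μ) →
      CHARN.lyapunovExponent μ N (CHARN.companion a₁ a₂ Z ε) < 0 →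
      ∃ Y : ℤ → Ω → ℝ,
        CHARN.IsStationary μ Y ∧ CHARN.IsSolution μ f₁ f₂ Z ε Y ∧
        CHARN.IsStationaryErgodic μ Y ∧
        ∀ Y' : ℤ → Ω → ℝ, CHARN.IsStationary μ Y' → CHARN.IsSolution μ f₁ f₂ Z ε Y' →
          ∀ t, Y' t =ᵐ[μ] Y t) ∧
    -- Parts 2 and 3 share the following data and hypotheses
    (∀ (𝓕 : Filtration ℤ mΩ),
      (∀ t, Measurable[𝓕 t] (Z t)) → (∀ t, Measurable[𝓕 t] (ε t)) →
      (∀ t, Indep (MeasurableSpace.comap (ε t) inferInstance) (𝓕 (t - 1)) μ) →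
      ∀ p : ℝ, 1 ≤ p →
      (∃ x : Fin q → ℝ, MemLp (fun ω => f₁ (x, Z 0 ω) + ε 1 ω * f₂ (x, Z 0 ω))
        (ENNReal.ofReal p) μ) →
      (∑ i, ⨆ z : E₁, eLpNorm (fun ω => (a₁ i z : ℝ) + (a₂ i z : ℝ) * |ε 1 ω|)
        (ENNReal.ofReal p) μ) < 1 →
      -- Part 2: a unique stationary non-anticipative solution, ergodic with a moment of order `p`
      (∃ Y : ℤ → Ω → ℝ,
        CHARN.IsStationary μ Y ∧ (∀ t, Measurable[𝓕 t] (Y t)) ∧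
        CHARN.IsSolution μ f₁ f₂ Z ε Y ∧
        CHARN.IsStationaryErgodic μ Y ∧ MemLp (Y 1) (ENNReal.ofReal p) μ ∧
        ∀ Y' : ℤ → Ω → ℝ, CHARN.IsStationary μ Y' → (∀ t, Measurable[𝓕 t] (Y' t)) →
          CHARN.IsSolution μ f₁ f₂ Z ε Y' → ∀ t, Y' t =ᵐ[μ] Y t) ∧
      -- Part 3: control of the functional dependence measure of that solution
      (∀ (r : ℝ) (s : ℝ≥0∞) (L₁ L₂ : (Fin q → ℝ) → ℝ),
        p ≤ r → ENNReal.ofReal p ≤ s →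
        (ENNReal.ofReal r)⁻¹ + s⁻¹ = (ENNReal.ofReal p)⁻¹ →
        MemLp (ε 1) (ENNReal.ofReal p) μ →
        MemLp (fun ω => (Z 0 ω : V)) (ENNReal.ofReal r) μ →
        Measurable L₁ → Measurable L₂ →
        (∀ y (z z' : E₁), |f₁ (y, z) - f₁ (y, z')| ≤ L₁ y * ‖(z : V) - (z' : V)‖) →
        (∀ y (z z' : E₁), |f₂ (y, z) - f₂ (y, z')| ≤ L₂ y * ‖(z : V) - (z' : V)‖) →
        ∀ (η : ℤ → Ω → G₁) (H' : (ℕ → G₁) → E₁),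
        (∀ t, Measurable (η t)) →
        CHARN.IsBernoulliShift μ η H' Z →
        iIndepFun (fun (t : ℤ) (ω : Ω) => (ε t ω, η t ω)) μ →
        (∀ t, IdentDistrib (fun ω => (ε t ω, η t ω)) (fun ω => (ε 0 ω, η 0 ω)) μ μ) →
        ∀ Y : ℤ → Ω → ℝ, CHARN.IsStationary μ Y → (∀ t, Measurable[𝓕 t] (Y t)) →
        CHARN.IsSolution μ f₁ f₂ Z ε Y →
        MemLp (fun ω => L₁ (CHARN.lags q Y ((q : ℤ) + 1) ω)) s μ →
        MemLp (fun ω => L₂ (CHARN.lags q Y ((q : ℤ) + 1) ω)) s μ →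
        (∃ g : (ℕ → ℝ × G₁) → ℝ,
          CHARN.IsBernoulliShift μ (fun t ω => (ε t ω, η t ω)) g Y) ∧
        ∃ C : ℝ, 0 < C ∧ ∃ ρ : ℝ, 0 < ρ ∧ ρ < 1 ∧
          ∀ g : (ℕ → ℝ × G₁) → ℝ,
            CHARN.IsBernoulliShift μ (fun t ω => (ε t ω, η t ω)) g Y →
          ∀ h : ℕ, 1 ≤ h →
            CHARN.Theta μ (fun t ω => (ε t ω, η t ω)) g p h ≤
              ENNReal.ofReal C * (ENNReal.ofReal (ρ ^ h) +
                ∑ i ∈ Finset.Icc 1 h, ENNReal.ofReal (ρ ^ i) *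
                  CHARN.Theta μ η (fun x => (H' x : V)) r (h - i)))) := by
  obtain ⟨q, rfl⟩ : ∃ k, q = k + 1 := ⟨q - 1, by omega⟩
  refine ⟨fun N hN hint ⟨x, hx⟩ hlyap =>
    CHARN.exists_stationary_solution_of_lyapunovExponent_neg hf₁ hf₂ hZε ha₁ ha₂ hLip₁ hLip₂ N hN
      hint hx hlyap, fun 𝓕 hZ hε hind p hp ⟨x, hx⟩ hα => ?_⟩
  obtain ⟨hsol, hmem, huniq⟩ := CHARN.stateLimit_spec_of_contraction hf₁ hf₂ hZε ha₁ ha₂ hLip₁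
    hLip₂ hZ hε hind hp hx hα
  have herg : CHARN.IsStationaryErgodic μ fun t ω => CHARN.stateLimit f₁ f₂ x
      (CHARN.past (fun t ω => (Z t ω, ε t ω)) t ω) :=
    hZε.comp_past (CHARN.measurable_stateLimit hf₁ hf₂ x)
  refine ⟨⟨_, herg.isStationary, fun t => (CHARN.measurable_stateLimit hf₁ hf₂ x).comp
    (CHARN.measurable_past_filtration hZ hε t), hsol, herg, hmem 1,
    fun Y' hY' _ hs' t => huniq Y' hY' hs' t⟩, ?_⟩
  intro r s L₁ L₂ _ _ hrs hεp _ hLm₁ hLm₂ hL₁ hL₂ η H' hη hB hiid _ Y hY _ hYs hYL₁ hYL₂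
  -- Uniqueness identifies the given solution with `stateLimit`, from which it inherits the
  -- representation and the moment of order `p`.
  have hYeq := huniq Y hY hYs
  exact ⟨⟨_, CHARN.isBernoulliShift_stateLimit hf₁ hf₂ hB hYeq⟩,
    CHARN.exists_Theta_le hf₁ hf₂ hZε ha₁ ha₂ hLip₁ hLip₂ (fun t => (hε t).mono (𝓕.le t) le_rfl)
      hp hα hrs hεp hLm₁ hLm₂ hL₁ hL₂ hη hB hiid hY hYs ((hmem 0).ae_eq (hYeq 0).symm) hYL₁ hYL₂⟩
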